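/- All vector spaces are over $\mathbb{C}$. A vertex algebra $(V,Y,\mathbf 1)$ has fields $Y(u,z)=\sum_{m\in\mathbb Z}u_m z^{-m-1}$ and operator $\mathcal D v=v_{-2}\mathbf 1$. A conformal vector is $\omega\in V$ such that the operators $L(m)=\omega_{m+1}$ satisfy the Virasoro relations for some central charge, $L(-1)=\mathcal D$, $L(0)$ is semisimple, and $L(m)$ is locally nilpotent for every $m\ge 1$. The pair $(V,\omega)$ is a vertex operator algebra if, moreover, the eigenvalues of $L(0)$ are integers, the eigenspaces $V_k$ of $L(0)$ are finite-dimensional, and $V_k=0$ for all sufficiently negative $k$. An automorphism of $(V,\omega)$ is a vertex algebra automorphism $g$ with $g(\omega)=\omega$. Let $g$ be an automorphism of $(V,\omega)$ of finite order $T\ge 1$, and let $V^r=\{v\in V\mid gv=e^{-2\pi\sqrt{-1}\,r/T}v\}$ for $0\le r\le T-1$. Let $n\in\frac1T\mathbb N$ and write $n=\lfloor n\rfloor+\bar n/T$ with $\bar n\in\{0,\dots,T-1\}$. For $0\le l\le T$ put $\delta_{\bar n}(l)=1$ if $l\le \bar n$ and $\delta_{\bar n}(l)=0$ otherwise. For $u\in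 V^r$ homogeneous of weight $\operatorname{wt}u$ and $v\in V$ put $$u\circ_{g,n}v=\operatorname{Res}_z\frac{(1+z)^{\operatorname{wt}u-1+\delta_{\bar n}(r)+\lfloor n\rfloor+r/T}}{z^{2\lfloor n\rfloor+\delta_{\bar n}(r)+\delta_{\bar n}(T-r)+1}}\,Y(u,z)v .$$ Let $O_{g,n}(V,\omega)$ be the linear span of all such $u\circ_{g,n}v$ and all $L(-1)u+L(0)u$ with $u\in V$. Let $*_{g,n}$ be the bilinear product on $V$ given by $$u*_{g,n}v=\sum_{m=0}^{\lfloor n\rfloor}(-1)^m\binom{m+\lfloor n\rfloor}{\lfloor n\rfloor}\operatorname{Res}_z\frac{(1+z)^{\operatorname{wt}u+\lfloor n\rfloor}}{z^{\lfloor n\rfloor+m+1}}\,Y(u,z)v$$ for homogeneous $u\in V^0$, and by $u*_{g,n}v=0$ for $u\in V^r$ with $0<r<T$. Denote by $A_{g,n}(V,\omega)$ the quotient $V/O_{g,n}(V,\omega)$ with the product induced by $*_{g,n}$. **Lemma.** Let $(V,\omega)$ and $(V,\omega')$ be two vertex operator algebra structures on the same underlying vertex algebra $V$, and let $g$ be an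 automorphism of both structures, of finite order $T$. Then for every $n\in\frac1T\mathbb N$, $A_{g,n}(V,\omega)$ and $A_{g,n}(V,\omega')$ are well-defined associative algebras with identity the class of $\mathbf 1$, and they are isomorphic as associative algebras. -/

import Mathlib

noncomputable section

/-- A vertex algebra structure on a complex vector space `V`: a linear map `Y` sending `u` to the
vertex operator `Y(u, z) = ∑ₙ uₙ z⁻ⁿ⁻¹` and a vacuum vector.  That `Y(u, z)v` is a Laurent series in
`z` for all `u`, `v` (so `uₙ v = 0` for `n` large) is part of Mathlib's type `VertexOperator ℂ V`.
The mode `uₙ` is `VertexOperator.ncoeff (Y u) n`. -/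
structure VertexAlgebra (V : Type*) [AddCommGroup V] [Module ℂ V] where
  /-- the state-field correspondence -/
  Y : V →ₗ[ℂ] VertexOperator ℂ V
  /-- the vacuum vector -/
  vac : V
  vac_mode : ∀ (n : ℤ) (v : V), (Y vac).ncoeff n v = if n = -1 then v else 0
  mode_vac : ∀ (u : V) (n : ℤ), -1 ≤ n → (Y u).ncoeff n vac = if n = -1 then u else 0
  /-- The Jacobi identity: equality of the coefficients of `z₀⁻ˡ⁻¹ z₁⁻ᵐ⁻¹ z₂⁻ⁿ⁻¹`, applied to `w`.
  All three sums have only finitely many nonzero terms. -/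
  jacobi : ∀ (u v w : V) (l m n : ℤ),
    (∑ᶠ i : ℕ, ((-1 : ℤ) ^ i * Ring.choose l i) •
        (Y u).ncoeff (m + l - i) ((Y v).ncoeff (n + i) w))
      - (l.negOnePow : ℤ) • (∑ᶠ i : ℕ, ((-1 : ℤ) ^ i * Ring.choose l i) •
        (Y v).ncoeff (n + l - i) ((Y u).ncoeff (m + i) w))
      = ∑ᶠ i : ℕ, Ring.choose m i • (Y ((Y u).ncoeff (l + i) v)).ncoeff (m + n - i) w

namespace VertexAlgebra

variable {V : Type*} [AddCommGroup V] [Module ℂ V] (𝒱 : VertexAlgebra V)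

/-- The mode `uₙ`, i.e. the coefficient of `z⁻ⁿ⁻¹` in `Y(u, z)`. -/
abbrev mode (u : V) (n : ℤ) : Module.End ℂ V := (𝒱.Y u).ncoeff n

/-- The operator `𝒟 v = v₋₂ 𝟏`. -/
def D : Module.End ℂ V where
  toFun v := 𝒱.mode v (-2) 𝒱.vac
  map_add' u v := by simp [mode]
  map_smul' c v := by simp [mode]

/-- Vertex algebra automorphisms: linear isomorphisms fixing the vacuum and satisfying
`g (Y(u, z) v) = Y(g u, z) (g v)`. -/
structure IsAutomorphism (g : V ≃ₗ[ℂ] V) : Prop where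
  map_vac : g 𝒱.vac = 𝒱.vac
  map_mode : ∀ (u v : V) (n : ℤ), g (𝒱.mode u n v) = 𝒱.mode (g u) n (g v)

/-- The operator `L(n) = ω_{n+1}` attached to a vector `ω`. -/
def L (ω : V) (n : ℤ) : Module.End ℂ V := 𝒱.mode ω (n + 1)

/-- The eigenspace `V_μ` of `L(0)`. -/
def weightSpace (ω : V) (μ : ℂ) : Submodule ℂ V := Module.End.eigenspace (𝒱.L ω 0) μ

/-- `ω` is a conformal vector: Virasoro relations for some central charge `c`, `L(-1) = 𝒟`,
`L(0)` is semisimple, and the `L(n)` with `n ≥ 1` are locally nilpotent. -/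
structure IsConformalVector (ω : V) : Prop where
  virasoro : ∃ c : ℂ, ∀ m n : ℤ,
    𝒱.L ω m * 𝒱.L ω n - 𝒱.L ω n * 𝒱.L ω m =
      ((m : ℂ) - n) • 𝒱.L ω (m + n)
        + (if m + n = 0 then ((m : ℂ) ^ 3 - m) / 12 * c else 0) • (1 : Module.End ℂ V)
  L_neg_one : 𝒱.L ω (-1) = 𝒱.D
  isInternal : DirectSum.IsInternal (𝒱.weightSpace ω)
  locally_nilpotent : ∀ n : ℤ, 1 ≤ n → ∀ v : V, ∃ k : ℕ, (𝒱.L ω n ^ k) v = 0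

/-- `(V, ω)` is a vertex operator algebra: a conformal vertex algebra with integer conformal
weights, finite-dimensional weight spaces, and weights bounded below. -/
structure IsVertexOperatorAlgebra (ω : V) : Prop extends 𝒱.IsConformalVector ω where
  integral : ∀ μ : ℂ, 𝒱.weightSpace ω μ ≠ ⊥ → ∃ k : ℤ, μ = k
  finite_dim : ∀ k : ℤ, FiniteDimensional ℂ (𝒱.weightSpace ω (k : ℂ))
  bounded_below : ∃ K : ℤ, ∀ k : ℤ, k < K → 𝒱.weightSpace ω (k : ℂ) = ⊥

/-- `V^r = {v | g v = exp(-2π√-1 r / T) v}`. -/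
def sector (g : V ≃ₗ[ℂ] V) (T r : ℕ) : Submodule ℂ V :=
  Module.End.eigenspace (g : V →ₗ[ℂ] V) (Complex.exp (-2 * Real.pi * Complex.I * r / T))

/-- `Res_z f(z) Y(u, z) v`, the coefficient of `z⁻¹`, for a Laurent series `f`. -/
def res (f : LaurentSeries ℂ) : V →ₗ[ℂ] V →ₗ[ℂ] V :=
  LinearMap.mk₂ ℂ (fun u v => ((HahnModule.of ℂ).symm (f • 𝒱.Y u v)).coeff (-1))
    (by intros; simp [smul_add])
    (by intro c u v; rw [𝒱.Y.map_smul, LinearMap.smul_apply, ← smul_comm c f]; rfl)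
    (by intros; simp [smul_add])
    (by intro c u v; rw [(𝒱.Y u).map_smul, ← smul_comm c f]; rfl)

/-- The Laurent series `(1 + z)^a / z^b`, where `(1 + z)^a = ∑ⱼ (a choose j) zʲ`. -/
def kernel (a : ℂ) (b : ℕ) : LaurentSeries ℂ :=
  ((PowerSeries.binomialSeries ℂ a : PowerSeries ℂ) : LaurentSeries ℂ)
    * HahnSeries.single (-(b : ℤ)) 1

/-- `δ_k(l) = 1` if `k ≥ l` and `0` otherwise.  It is used for `0 ≤ k < T` and `0 ≤ l ≤ T`, so that
`δ_k(T) = 0`. -/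
def delta (k l : ℕ) : ℕ := if l ≤ k then 1 else 0

/-- For `n ∈ (1/T)ℕ`, the number `n̄ ∈ {0, …, T - 1}` with `n = ⌊n⌋ + n̄ / T`. -/
def nbar (T : ℕ) (n : ℚ) : ℕ := ⌊(T : ℚ) * Int.fract n⌋₊

/-- `u ∘_{g,n} v` for `u ∈ V^r` homogeneous of weight `μ`. -/
def circ (T : ℕ) (n : ℚ) (r : ℕ) (μ : ℂ) (u v : V) : V :=
  𝒱.res (kernel (μ - 1 + delta (nbar T n) r + ⌊n⌋₊ + r / T)
    (2 * ⌊n⌋₊ + delta (nbar T n) r + delta (nbar T n) (T - r) + 1)) u v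

/-- `O_{g,n}(V, ω)`: the span of all `u ∘_{g,n} v` and all `L(-1) u + L(0) u`. -/
def O (ω : V) (g : V ≃ₗ[ℂ] V) (T : ℕ) (n : ℚ) : Submodule ℂ V :=
  Submodule.span ℂ
    ({x | ∃ r < T, ∃ μ : ℂ, ∃ u ∈ sector g T r ⊓ 𝒱.weightSpace ω μ, ∃ v : V,
        x = 𝒱.circ T n r μ u v} ∪
      {x | ∃ u : V, x = 𝒱.L ω (-1) u + 𝒱.L ω 0 u})

/-- `u *_{g,n} v` for `u ∈ V^0` homogeneous of weight `μ`. -/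
def starAux (n : ℚ) (μ : ℂ) : V →ₗ[ℂ] V →ₗ[ℂ] V :=
  ∑ m ∈ Finset.range (⌊n⌋₊ + 1), ((-1 : ℂ) ^ m * ((m + ⌊n⌋₊).choose ⌊n⌋₊ : ℂ)) •
    𝒱.res (kernel (μ + ⌊n⌋₊) (⌊n⌋₊ + m + 1))

/-- `(1/T) ∑_{i < T} gⁱ`: for `g` of order `T`, the projection of `V = ⨁ᵣ V^r` onto `V^0`. -/
def fixedProj (g : V ≃ₗ[ℂ] V) (T : ℕ) : Module.End ℂ V :=
  (T : ℂ)⁻¹ • ∑ i ∈ Finset.range T, (g : V →ₗ[ℂ] V) ^ i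

variable {𝒱} in
/-- The decomposition `V = ⨁_μ V_μ` into weight spaces. -/
def IsConformalVector.decomp {ω : V} (hω : 𝒱.IsConformalVector ω) :
    (DirectSum ℂ fun μ => 𝒱.weightSpace ω μ) ≃ₗ[ℂ] V :=
  LinearEquiv.ofBijective (DirectSum.coeLinearMap (𝒱.weightSpace ω)) hω.isInternal

variable {𝒱} in
/-- The product `*_{g,n}`: the bilinear map that is `starAux` on homogeneous elements of `V^0` in
the first argument and vanishes on `V^r` for `0 < r < T`; see `star_of_mem_sector_zero` and
`star_of_mem_sector_pos`. -/
def IsConformalVector.star {ω : V} (hω : 𝒱.IsConformalVector ω) (g : V ≃ₗ[ℂ] V) (T : ℕ) (n : ℚ) :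
    V →ₗ[ℂ] V →ₗ[ℂ] V :=
  DirectSum.toModule ℂ ℂ (V →ₗ[ℂ] V) (fun μ => 𝒱.starAux n μ ∘ₗ (𝒱.weightSpace ω μ).subtype)
    ∘ₗ hω.decomp.symm.toLinearMap ∘ₗ fixedProj g T

theorem fixedProj_of_mem_sector {g : V ≃ₗ[ℂ] V} {T r : ℕ} (hr : r < T) {u : V}
    (hu : u ∈ sector g T r) : fixedProj g T u = if r = 0 then u else 0 := by
  have hT : (T : ℂ) ≠ 0 := by exact_mod_cast (by omega : T ≠ 0)
  set ζ : ℂ := Complex.exp (-2 * Real.pi * Complex.I * r / T) with hζ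
  have hgu : ∀ i : ℕ, ((g : V →ₗ[ℂ] V) ^ i) u = ζ ^ i • u := by
    intro i
    induction i with
    | zero => simp
    | succ i ih =>
      rw [pow_succ', Module.End.mul_apply, ih, map_smul, Module.End.mem_eigenspace_iff.1 hu,
        smul_smul, pow_succ]
  have key : fixedProj g T u = ((T : ℂ)⁻¹ * ∑ i ∈ Finset.range T, ζ ^ i) • u := by
    simp only [fixedProj, LinearMap.smul_apply, LinearMap.sum_apply, hgu]
    rw [← Finset.sum_smul, smul_smul]
  rw [key]
  split_ifs with h
  · have : ζ = 1 := by simp [hζ, h]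
    simp [this, hT]
  · have h1 : ζ ≠ 1 := by
      intro hc
      obtain ⟨k, hk⟩ := Complex.exp_eq_one_iff.1 hc
      have hpi : (2 * Real.pi * Complex.I : ℂ) ≠ 0 := Complex.two_pi_I_ne_zero
      have h2 : (2 * Real.pi * Complex.I : ℂ) * (-(r : ℂ)) = 2 * Real.pi * Complex.I * (k * T) := by
        field_simp at hk
        linear_combination (2 * Real.pi * Complex.I) * hk
      have h3 := mul_left_cancel₀ hpi h2
      have h4 : -(r : ℤ) = k * T := by exact_mod_cast h3
      have h5 : (T : ℤ) ∣ r := ⟨-k, by linarith⟩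
      have h6 : T ∣ r := by exact_mod_cast h5
      exact absurd (Nat.le_of_dvd (Nat.pos_of_ne_zero h) h6) (by omega)
    have hpow : ζ ^ T = 1 := by
      rw [hζ, ← Complex.exp_nat_mul]
      refine Complex.exp_eq_one_iff.2 ⟨-(r : ℤ), ?_⟩
      push_cast
      field_simp
    rw [geom_sum_eq h1, hpow]
    simp

variable {𝒱} in
theorem IsConformalVector.star_of_mem_sector_zero {ω : V} (hω : 𝒱.IsConformalVector ω)
    {g : V ≃ₗ[ℂ] V} {T : ℕ} (hT : 0 < T) (n : ℚ) {μ : ℂ} {u : V}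
    (hu : u ∈ sector g T 0 ⊓ 𝒱.weightSpace ω μ) (v : V) :
    hω.star g T n u v =
      ∑ m ∈ Finset.range (⌊n⌋₊ + 1), ((-1 : ℂ) ^ m * ((m + ⌊n⌋₊).choose ⌊n⌋₊ : ℂ)) •
        𝒱.res (kernel (μ + ⌊n⌋₊) (⌊n⌋₊ + m + 1)) u v := by
  have h : hω.decomp.symm u = DirectSum.lof ℂ ℂ (fun μ => 𝒱.weightSpace ω μ) μ ⟨u, hu.2⟩ := by
    rw [LinearEquiv.symm_apply_eq]
    exact (DirectSum.coeLinearMap_lof (𝒱.weightSpace ω) μ ⟨u, hu.2⟩).symm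
  simp [IsConformalVector.star, fixedProj_of_mem_sector hT hu.1, h, starAux, LinearMap.sum_apply]

variable {𝒱} in
theorem IsConformalVector.star_of_mem_sector_pos {ω : V} (hω : 𝒱.IsConformalVector ω)
    {g : V ≃ₗ[ℂ] V} {T r : ℕ} (hr : 0 < r) (hrT : r < T) (n : ℚ) {u : V}
    (hu : u ∈ sector g T r) (v : V) : hω.star g T n u v = 0 := by
  simp [IsConformalVector.star, fixedProj_of_mem_sector hrT hu, hr.ne']

end VertexAlgebra

/-- The bilinear product `star` on `V` induces on `V ⧸ O` the structure of an associative algebra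
with identity element `e + O`. -/
structure InducesAlgebra {V : Type*} [AddCommGroup V] [Module ℂ V] (O : Submodule ℂ V)
    (star : V →ₗ[ℂ] V →ₗ[ℂ] V) (e : V) : Prop where
  star_mem_left : ∀ u ∈ O, ∀ v : V, star u v ∈ O
  star_mem_right : ∀ u : V, ∀ v ∈ O, star u v ∈ O
  assoc : ∀ u v w : V, star (star u v) w - star u (star v w) ∈ O
  one_star : ∀ u : V, star e u - u ∈ O
  star_one : ∀ u : V, star u e - u ∈ O

/-- The quotient `V ⧸ O`, as an associative algebra under the product induced by `star`. -/
def QuotientAlgebra {V : Type*} [AddCommGroup V] [Module ℂ V] {O : Submodule ℂ V}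
    {star : V →ₗ[ℂ] V →ₗ[ℂ] V} {e : V} (_h : InducesAlgebra O star e) : Type _ := V ⧸ O

namespace QuotientAlgebra

variable {V : Type*} [AddCommGroup V] [Module ℂ V] {O : Submodule ℂ V}
  {star : V →ₗ[ℂ] V →ₗ[ℂ] V} {e : V} (h : InducesAlgebra O star e)

instance : AddCommGroup (QuotientAlgebra h) := inferInstanceAs (AddCommGroup (V ⧸ O))

instance : Module ℂ (QuotientAlgebra h) := inferInstanceAs (Module ℂ (V ⧸ O))

/-- The quotient map. -/
def mk : V →ₗ[ℂ] QuotientAlgebra h := O.mkQ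

theorem mk_surjective : Function.Surjective (mk h) := O.mkQ_surjective

theorem mk_eq_iff {u v : V} : mk h u = mk h v ↔ u - v ∈ O := Submodule.Quotient.eq O

/-- The product induced by `star`. -/
def mulMap : QuotientAlgebra h →ₗ[ℂ] QuotientAlgebra h →ₗ[ℂ] QuotientAlgebra h :=
  O.liftQ
    { toFun := fun u => O.mapQ O (star u) (fun v hv => h.star_mem_right u v hv)
      map_add' := fun u u' => Submodule.linearMap_qext _ (by ext v; simp; rfl)
      map_smul' := fun c u => Submodule.linearMap_qext _ (by ext v; simp; rfl) }
    (fun u hu => Submodule.linearMap_qext _ <| by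
      ext v
      exact (Submodule.Quotient.mk_eq_zero O).2 (h.star_mem_left u hu v))

theorem mulMap_mk (u v : V) : mulMap h (mk h u) (mk h v) = mk h (star u v) := rfl

instance : Ring (QuotientAlgebra h) where
  __ := (inferInstance : AddCommGroup (QuotientAlgebra h))
  mul x y := mulMap h x y
  one := mk h e
  left_distrib x y z := (mulMap h x).map_add y z
  right_distrib x y z := (mulMap h).map_add₂ x y z
  zero_mul x := (mulMap h).map_zero₂ x
  mul_zero x := (mulMap h x).map_zero
  mul_assoc x y z := by
    obtain ⟨u, rfl⟩ := mk_surjective h x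
    obtain ⟨v, rfl⟩ := mk_surjective h y
    obtain ⟨w, rfl⟩ := mk_surjective h z
    exact (mk_eq_iff h).2 (h.assoc u v w)
  one_mul x := by
    obtain ⟨u, rfl⟩ := mk_surjective h x
    exact (mk_eq_iff h).2 (h.one_star u)
  mul_one x := by
    obtain ⟨u, rfl⟩ := mk_surjective h x
    exact (mk_eq_iff h).2 (h.star_one u)

theorem mk_mul_mk (u v : V) : mk h u * mk h v = mk h (star u v) := rfl

theorem one_def : (1 : QuotientAlgebra h) = mk h e := rfl

instance : Algebra ℂ (QuotientAlgebra h) :=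
  Algebra.ofModule (fun c x y => (mulMap h).map_smul₂ c x y) (fun c x y => (mulMap h x).map_smul c y)

end QuotientAlgebra

end

/-! The conformal vector enters $A_{g,n}$ only through the factors $(1+z)^{\operatorname{wt}u-1}$
and through $L(-1)+L(0)$, and both are artefacts of the coordinate $z$. In the coordinate
$x=\log(1+z)$ they disappear: $(1+z)^a z^{-b}$ becomes $e^{ax}(e^x-1)^{-b}$ and $L(-1)+L(0)$ becomes
$\mathcal D$. What remains, `logO` and `logStar`, uses only the vertex algebra and $g$. So each
$A_{g,n}(V,\omega)$ is isomorphic to one and the same algebra.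

The change of coordinate acts on $V$ by an invertible operator $U$ (`coordChange`) built from the
$L(j)$, $j\ge1$, with $U(u_kv)=\operatorname{Res}_z
\log(1+z)^k(1+z)^{\operatorname{wt}-1}\,Y(Uu,z)Uv$ (`coordChange_mode_eq_bracket`). To prove this,
put $\log(1+z)$ in the family $t^{-1}\log(1+tz)$. Then $U_t=\sum_m t^mU_m$ solves
$t\,\partial_tU_t=C_tU_t$ with $C_t=\sum_{j\ge1}c_jt^jL(j)$, where $\sum_j
c_jz^{j+1}=(1+z)\log(1+z)-z$. The transported modes $M_t$ solve $t\,\partial_tM_t=[C_t,M_t]$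
(`smul_modePart`), and comparing powers of $t$ gives $U_tu_k=M_tU_t$ (`coordPart_mul_mode`). Weights
are bounded below, so all sums are finite on each vector and $U-1$ is locally nilpotent.

Associativity is proved once, for `logStar` (`inducesAlgebra_log`). Write $y=1/(e^x-1)$ and
$N=\lfloor n\rfloor$. Then $y'=-y(1+y)$, and $x\mapsto-x$ sends $y$ to $-1-y$. On $V^0$ the
relations are residues against multiples of $(y(1+y))^{N+1}$, and the product is the residue against
$H(y)$ with $H\equiv1$ modulo $y^{N+1}$ and $H\equiv0$ modulo $(1+y)^{N+1}$. Thus $H$ is an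
idempotent modulo $(y(1+y))^{N+1}$, its derivative vanishes there, and $x\mapsto -x$ turns it into
the complementary idempotent. In the iterate formula for $(u*v)*w$ every term except $u*(v*w)$ then
lies in `logO`. The sectors $V^r$ with $0<r<T$ lie entirely in `logO` (`sector_le_logO`). -/

namespace LaurentSeries

/-! ### Derivatives, the reflection of the variable, and exponentials of Laurent series. -/

section CommRing

variable {R : Type*} [CommRing R]

theorem coeff_neg_one_derivative (f : LaurentSeries R) : (derivative R f).coeff (-1) = 0 := by
  simp

/-- The Euler operator $z\,d/dz$ multiplies the $n$-th coefficient by $n$, so its Leibniz rule is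
$n=i+j$ in each term of the convolution. Dividing by $z$ gives the rule for $d/dz$. -/
theorem derivative_mul (f g : LaurentSeries R) :
    derivative R (f * g) = derivative R f * g + f * derivative R g := by
  have euler : ∀ h : LaurentSeries R, ∀ n : ℤ,
      (HahnSeries.single (1 : ℤ) (1 : R) * derivative R h).coeff n = (n : R) * h.coeff n := by
    intro h n
    rw [HahnSeries.coeff_single_mul]
    simp
  have sub : ∀ h : LaurentSeries R,
      (HahnSeries.single (1 : ℤ) (1 : R) * derivative R h).support ⊆ h.support := by
    intro h n hn
    rw [HahnSeries.mem_support, euler] at hn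
    exact right_ne_zero_of_mul hn
  have key : HahnSeries.single (1 : ℤ) (1 : R) * derivative R (f * g) =
      HahnSeries.single (1 : ℤ) (1 : R) * derivative R f * g +
        f * (HahnSeries.single (1 : ℤ) (1 : R) * derivative R g) := by
    ext n
    rw [euler, HahnSeries.coeff_add, HahnSeries.coeff_mul, Finset.mul_sum,
      HahnSeries.coeff_mul_left' f.isPWO_support (sub f),
      HahnSeries.coeff_mul_right' g.isPWO_support (sub g), ← Finset.sum_add_distrib]
    refine Finset.sum_congr rfl fun ij hij => ?_
    rw [euler, euler, ← (Finset.mem_antidiagonal.1 hij).2.2]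
    push_cast
    ring
  have inv : ∀ h : LaurentSeries R,
      HahnSeries.single (-1 : ℤ) (1 : R) * (HahnSeries.single (1 : ℤ) (1 : R) * h) = h := by
    intro h
    rw [← mul_assoc, HahnSeries.single_mul_single]
    simp
  rw [← inv (derivative R (f * g)), key, ← inv (derivative R f * g + f * derivative R g)]
  ring

theorem derivative_one : derivative R (1 : LaurentSeries R) = 0 := by
  rw [← HahnSeries.single_zero_one, derivative_apply, hasseDeriv_single]
  simp

theorem derivative_pow (f : LaurentSeries R) (k : ℕ) :
    derivative R (f ^ k) = (k : LaurentSeries R) * f ^ (k - 1) * derivative R f := by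
  induction k with
  | zero => simp [derivative_one, -derivative_apply]
  | succ k ih =>
    rw [pow_succ, derivative_mul, ih]
    rcases k with _ | k
    · simp
    · simp only [add_tsub_cancel_right, Nat.cast_add, Nat.cast_one]
      ring

theorem derivative_coe (f : PowerSeries R) :
    derivative R (f : LaurentSeries R) = (PowerSeries.derivative R f : PowerSeries R) := by
  ext n
  simp only [derivative_apply, hasseDeriv_coeff, PowerSeries.coeff_coe]
  rcases lt_trichotomy n (-1) with h | rfl | h
  · rw [if_pos (by omega), if_pos (by omega), smul_zero]
  · simp
  · rw [if_neg (by push_cast; omega), if_neg (by omega), PowerSeries.coeff_derivative]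
    obtain ⟨k, rfl⟩ := Int.eq_ofNat_of_zero_le (show 0 ≤ n by omega)
    rw [show ((k : ℤ) + ((1 : ℕ) : ℤ)).natAbs = k + 1 by omega]
    simp
    ring

/-- The substitution `z ↦ -z`. -/
noncomputable def flip : LaurentSeries R →+* LaurentSeries R where
  toFun f :=
    { coeff := fun n => ((n.negOnePow : ℤ) : R) * f.coeff n
      isPWO_support' := f.isPWO_support.mono fun _ hn => right_ne_zero_of_mul hn }
  map_one' := by
    ext n
    rcases eq_or_ne n 0 with rfl | h <;> simp [HahnSeries.coeff_one, *]
  map_zero' := by ext; simp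
  map_add' f g := by ext; simp [mul_add]
  map_mul' f g := by
    ext n
    have sub : ∀ h : LaurentSeries R,
        (HahnSeries.mk (fun n : ℤ => ((n.negOnePow : ℤ) : R) * h.coeff n)
        (h.isPWO_support.mono fun _ hn => right_ne_zero_of_mul hn)).support ⊆ h.support :=
      fun h _ hn => right_ne_zero_of_mul hn
    rw [HahnSeries.coeff_mul_left' f.isPWO_support (sub f)]
    have := sub g
    rw [Finset.sum_subset (s₂ := Finset.antidiagonal f.isPWO_support g.isPWO_support n)]
    · simp only [HahnSeries.coeff_mul, Finset.mul_sum]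
      refine Finset.sum_congr rfl fun ij hij => ?_
      rw [← (Finset.mem_antidiagonal.1 hij).2.2, Int.negOnePow_add]
      push_cast
      ring
    · intro ij hij
      rw [Finset.mem_antidiagonal] at hij ⊢
      exact ⟨hij.1, sub g hij.2.1, hij.2.2⟩
    · intro ij hij hij'
      rw [Finset.mem_antidiagonal] at hij hij'
      have : (HahnSeries.mk (fun n : ℤ => ((n.negOnePow : ℤ) : R) * g.coeff n)
        (g.isPWO_support.mono fun _ hn => right_ne_zero_of_mul hn)).coeff ij.2 = 0 := by
        by_contra h
        exact hij' ⟨hij.1, h, hij.2.2⟩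
      rw [this, mul_zero]

@[simp]
theorem coeff_flip (f : LaurentSeries R) (n : ℤ) :
    (flip f).coeff n = ((n.negOnePow : ℤ) : R) * f.coeff n := rfl

theorem flip_smul (c : R) (f : LaurentSeries R) : flip (c • f) = c • flip f := by
  ext n
  simp
  ring

end CommRing

/-- A space of Laurent series over `ℂ` stable under `d/dz` is stable under all Hasse derivatives. -/
theorem hasseDeriv_mem {S : Submodule ℂ (LaurentSeries ℂ)}
    (hS : ∀ f ∈ S, derivative ℂ f ∈ S) (i : ℕ) {f : LaurentSeries ℂ} (hf : f ∈ S) :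
    hasseDeriv ℂ i f ∈ S := by
  have h1 : ∀ k : ℕ, (derivative ℂ)^[k] f ∈ S := by
    intro k
    induction k with
    | zero => exact hf
    | succ k ih => rw [Function.iterate_succ', Function.comp_apply]; exact hS _ ih
  have h2 := h1 i
  rw [derivative_iterate, ← Nat.cast_smul_eq_nsmul ℂ] at h2
  exact (Submodule.smul_mem_iff S (by exact_mod_cast i.factorial_ne_zero)).1 h2

/-- The series `exp(a z)`. -/
noncomputable def expSeries (a : ℂ) : PowerSeries ℂ := PowerSeries.rescale a (PowerSeries.exp ℂ)

/-- The series `exp(a z)` as a Laurent series. -/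
noncomputable def expL (a : ℂ) : LaurentSeries ℂ := (expSeries a : PowerSeries ℂ)

theorem expSeries_add (a b : ℂ) : expSeries (a + b) = expSeries a * expSeries b :=
  (PowerSeries.exp_mul_exp_eq_exp_add a b).symm

theorem derivative_expSeries (a : ℂ) :
    PowerSeries.derivative ℂ (expSeries a) = a • expSeries a := by
  ext n
  have : ((n.factorial : ℂ)) ≠ 0 := by exact_mod_cast n.factorial_ne_zero
  have h2 : (n : ℂ) + 1 ≠ 0 := by exact_mod_cast n.succ_ne_zero
  simp [expSeries, PowerSeries.coeff_derivative, PowerSeries.coeff_exp, Nat.factorial_succ]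
  field_simp
  ring

theorem expL_zero : expL 0 = 1 := by
  simp [expL, expSeries]

theorem expL_add (a b : ℂ) : expL (a + b) = expL a * expL b := by
  simp [expL, expSeries_add]

theorem derivative_expL (a : ℂ) : derivative ℂ (expL a) = a • expL a := by
  rw [expL, derivative_coe, derivative_expSeries, PowerSeries.coe_smul]

theorem flip_expL (a : ℂ) : flip (expL a) = expL (-a) := by
  ext n
  simp only [coeff_flip, expL, expSeries, PowerSeries.coeff_coe]
  split_ifs with h
  · simp
  · obtain ⟨k, rfl⟩ := Int.eq_ofNat_of_zero_le (show 0 ≤ n by omega)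
    simp only [Int.natAbs_natCast, PowerSeries.coeff_rescale, neg_pow a]
    rw [Int.cast_negOnePow_natCast]
    ring

theorem expL_one_sub_one_ne_zero : expL 1 - 1 ≠ 0 := by
  intro h
  have := congrArg (fun f => HahnSeries.coeff f (1 : ℤ)) h
  simp [expL, expSeries, PowerSeries.coeff_coe, HahnSeries.coeff_one, PowerSeries.coeff_exp] at this

/-- The Laurent series `1 / (exp z - 1)`. -/
noncomputable def invExpSubOne : LaurentSeries ℂ := (expL 1 - 1)⁻¹

theorem expL_one_mul_invExpSubOne : expL 1 * invExpSubOne = 1 + invExpSubOne := by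
  rw [invExpSubOne]
  field_simp [expL_one_sub_one_ne_zero]
  ring

/-- With `flip_invExpSubOne`, this makes the polynomials in $1/(e^z-1)$ stable under $d/dz$ and
under $z\mapsto-z$. -/
theorem derivative_invExpSubOne :
    derivative ℂ invExpSubOne = -(invExpSubOne + invExpSubOne ^ 2) := by
  have h1 : (expL 1 - 1) * invExpSubOne = 1 := mul_inv_cancel₀ expL_one_sub_one_ne_zero
  have h2 := congrArg (derivative ℂ) h1
  rw [derivative_mul, derivative_one, map_sub, derivative_one, derivative_expL, sub_zero,
    one_smul, expL_one_mul_invExpSubOne] at h2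
  linear_combination invExpSubOne * h2 - derivative ℂ invExpSubOne * h1

theorem flip_invExpSubOne : flip invExpSubOne = -1 - invExpSubOne := by
  have h1 : (expL 1 - 1) * invExpSubOne = 1 := mul_inv_cancel₀ expL_one_sub_one_ne_zero
  have h2 := congrArg flip h1
  rw [map_mul, map_sub, map_one, flip_expL] at h2
  have h3 : expL 1 * expL (-1) = 1 := by rw [← expL_add, add_neg_cancel, expL_zero]
  have h4 := expL_one_mul_invExpSubOne
  linear_combination (-1 - invExpSubOne) * h2 + (-flip invExpSubOne * expL (-1)) * h4
    + flip invExpSubOne * invExpSubOne * h3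

end LaurentSeries

/-! ### Linear maps on Laurent series that are continuous for the $z$-adic topology. -/

namespace LaurentSeries

/-- Laurent series in `zᴮ ℂ[[z]]`. -/
def filtration (B : ℤ) : Submodule ℂ (LaurentSeries ℂ) where
  carrier := {f | ∀ k < B, f.coeff k = 0}
  add_mem' hf hg k hk := by simp [hf k hk, hg k hk]
  zero_mem' k _ := rfl
  smul_mem' c f hf k hk := by simp [hf k hk]

theorem exists_mem_filtration (f : LaurentSeries ℂ) : ∃ B : ℤ, f ∈ filtration B :=
  ⟨f.order, fun _ hk => HahnSeries.coeff_eq_zero_of_lt_order hk⟩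

theorem mul_mem_filtration {A B : ℤ} {f g : LaurentSeries ℂ} (hf : f ∈ filtration A)
    (hg : g ∈ filtration B) : f * g ∈ filtration (A + B) := by
  intro k hk
  rw [HahnSeries.coeff_mul]
  refine Finset.sum_eq_zero fun ij hij => ?_
  have h := (Finset.mem_antidiagonal.1 hij).2.2
  rcases lt_or_ge ij.1 A with h1 | h1
  · rw [hf _ h1, zero_mul]
  · rw [hg _ (by omega), mul_zero]

theorem hasseDeriv_mem_filtration {B : ℤ} {f : LaurentSeries ℂ} (hf : f ∈ filtration B) (i : ℕ) :
    hasseDeriv ℂ i f ∈ filtration (B - i) := by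
  intro k hk
  rw [hasseDeriv_coeff, hf _ (by omega), smul_zero]

theorem flip_mem_filtration {B : ℤ} {f : LaurentSeries ℂ} (hf : f ∈ filtration B) :
    flip f ∈ filtration B := by
  intro k hk
  rw [coeff_flip, hf _ hk, mul_zero]

theorem single_mem_filtration (k : ℤ) (c : ℂ) : HahnSeries.single k c ∈ filtration k :=
  fun _ hj => HahnSeries.coeff_single_of_ne hj.ne

section

variable {V W : Type*} [AddCommGroup V] [Module ℂ V] [AddCommGroup W] [Module ℂ W]

/-- Linear maps `ℂ((z)) → V` that vanish on some `zᴮ ℂ[[z]]`. -/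
def continuousMaps (V : Type*) [AddCommGroup V] [Module ℂ V] :
    Submodule ℂ (LaurentSeries ℂ →ₗ[ℂ] V) where
  carrier := {φ | ∃ B : ℤ, ∀ f ∈ filtration B, φ f = 0}
  add_mem' := by
    rintro φ ψ ⟨A, hA⟩ ⟨B, hB⟩
    refine ⟨max A B, fun f hf => ?_⟩
    rw [LinearMap.add_apply, hA f fun k hk => hf k (hk.trans_le (le_max_left _ _)),
      hB f fun k hk => hf k (hk.trans_le (le_max_right _ _)), add_zero]
  zero_mem' := ⟨0, fun _ _ => rfl⟩
  smul_mem' := by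
    rintro c φ ⟨A, hA⟩
    exact ⟨A, fun f hf => by rw [LinearMap.smul_apply, hA f hf, smul_zero]⟩

theorem comp_mem_continuousMaps {φ : LaurentSeries ℂ →ₗ[ℂ] V} (hφ : φ ∈ continuousMaps V)
    (ψ : V →ₗ[ℂ] W) : ψ ∘ₗ φ ∈ continuousMaps W := by
  obtain ⟨B, hB⟩ := hφ
  exact ⟨B, fun f hf => by rw [LinearMap.comp_apply, hB f hf, map_zero]⟩

/-- Multiplication by a Laurent series. -/
noncomputable def mulMap (g : LaurentSeries ℂ) : LaurentSeries ℂ →ₗ[ℂ] LaurentSeries ℂ where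
  toFun f := g * f
  map_add' := mul_add g
  map_smul' c f := by
    rw [← HahnSeries.C_mul_eq_smul, ← HahnSeries.C_mul_eq_smul, RingHom.id_apply, mul_left_comm]

@[simp]
theorem mulMap_apply (g f : LaurentSeries ℂ) : mulMap g f = g * f := rfl

theorem comp_mul_mem_continuousMaps {φ : LaurentSeries ℂ →ₗ[ℂ] V} (hφ : φ ∈ continuousMaps V)
    (g : LaurentSeries ℂ) : φ ∘ₗ mulMap g ∈ continuousMaps V := by
  obtain ⟨B, hB⟩ := hφ
  obtain ⟨A, hA⟩ := exists_mem_filtration g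
  refine ⟨B - A, fun f hf => hB _ ?_⟩
  have := mul_mem_filtration hA hf
  rwa [add_sub_cancel] at this

theorem comp_hasseDeriv_mem_continuousMaps {φ : LaurentSeries ℂ →ₗ[ℂ] V}
    (hφ : φ ∈ continuousMaps V) (i : ℕ) : φ ∘ₗ hasseDeriv ℂ i ∈ continuousMaps V := by
  obtain ⟨B, hB⟩ := hφ
  refine ⟨B + i, fun f hf => hB _ ?_⟩
  have := hasseDeriv_mem_filtration hf i
  rwa [add_sub_cancel_right] at this

/-- `z ↦ -z` as a linear map. -/
noncomputable def flipₗ : LaurentSeries ℂ →ₗ[ℂ] LaurentSeries ℂ where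
  toFun := flip
  map_add' := map_add flip
  map_smul' := flip_smul

@[simp]
theorem flipₗ_apply (f : LaurentSeries ℂ) : flipₗ f = flip f := rfl

theorem comp_flip_mem_continuousMaps {φ : LaurentSeries ℂ →ₗ[ℂ] V}
    (hφ : φ ∈ continuousMaps V) : φ ∘ₗ flipₗ ∈ continuousMaps V := by
  obtain ⟨B, hB⟩ := hφ
  exact ⟨B, fun f hf => hB _ (flip_mem_filtration hf)⟩

theorem eq_zero_of_single {φ : LaurentSeries ℂ →ₗ[ℂ] V} (hφ : φ ∈ continuousMaps V) {A : ℤ}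
    (hs : ∀ k, A ≤ k → φ (HahnSeries.single k 1) = 0) {f : LaurentSeries ℂ}
    (hf : f ∈ filtration A) : φ f = 0 := by
  obtain ⟨B, hB⟩ := hφ
  have h : f - ∑ k ∈ Finset.Ico A B, f.coeff k • HahnSeries.single k (1 : ℂ) ∈ filtration B := by
    intro j hj
    rw [HahnSeries.coeff_sub, HahnSeries.coeff_sum]
    simp only [HahnSeries.coeff_smul, HahnSeries.coeff_single, smul_eq_mul, mul_ite, mul_one,
      mul_zero, Finset.sum_ite_eq, Finset.mem_Ico]
    split_ifs with h
    · exact sub_self _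
    · rw [hf j (by by_contra hc; exact h ⟨by omega, hj⟩), sub_zero]
  have h2 := hB _ h
  rw [map_sub, map_sum, Finset.sum_eq_zero, sub_zero] at h2
  · exact h2
  · intro k hk
    rw [map_smul, hs k (Finset.mem_Ico.1 hk).1, smul_zero]

/-- Laurent polynomials are dense. Identities between residues are therefore identities between
modes, checked on monomials and extended by this lemma. -/
theorem eq_of_single {φ ψ : LaurentSeries ℂ →ₗ[ℂ] V} (hφ : φ ∈ continuousMaps V)
    (hψ : ψ ∈ continuousMaps V)
    (hs : ∀ k : ℤ, φ (HahnSeries.single k 1) = ψ (HahnSeries.single k 1)) : φ = ψ := by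
  ext f
  obtain ⟨A, hA⟩ := exists_mem_filtration f
  rw [← sub_eq_zero, ← LinearMap.sub_apply]
  exact eq_zero_of_single (sub_mem hφ hψ) (fun k _ => by simp [hs k]) hA

end

end LaurentSeries

/-! ### Residue calculus in a vertex algebra: commutator, iterate and skew-symmetry formulas. -/

namespace VertexAlgebra

open LaurentSeries

theorem finsum_eq_sum_range {V : Type*} [AddCommGroup V] {I : ℕ} {F : ℕ → V}
    (hF : ∀ i, I ≤ i → F i = 0) : ∑ᶠ i, F i = ∑ i ∈ Finset.range I, F i :=
  finsum_eq_sum_of_support_subset _ fun i hi => by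
    by_contra h
    exact hi (hF i (by simpa using h))

variable {V : Type*} [AddCommGroup V] [Module ℂ V] (𝒱 : VertexAlgebra V)

theorem exists_mode_eq_zero (u v : V) : ∃ N : ℤ, ∀ k, N ≤ k → 𝒱.mode u k v = 0 :=
  ⟨-HahnSeries.order ((HahnModule.of ℂ).symm (𝒱.Y u v)), fun k hk =>
    VertexOperator.ncoeff_eq_zero_of_lt_order _ _ _ (by omega)⟩

theorem res_eq_sum {f : LaurentSeries ℂ} {u v : V} (s : Finset ℤ)
    (hs : ∀ k, f.coeff k ≠ 0 → 𝒱.mode u k v ≠ 0 → k ∈ s) :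
    𝒱.res f u v = ∑ k ∈ s, f.coeff k • 𝒱.mode u k v := by
  change ((HahnModule.of ℂ).symm (f • 𝒱.Y u v)).coeff (-1) = _
  rw [HahnModule.coeff_smul]
  have hm : ∀ j : ℤ, ((HahnModule.of ℂ).symm (𝒱.Y u v)).coeff j = 𝒱.mode u (-j - 1) v := by
    intro j
    rw [mode, VertexOperator.ncoeff_apply]
    simp [HVertexOperator.coeff]
  refine Finset.sum_bij_ne_zero (fun ij _ _ => ij.1) ?_ ?_ ?_ ?_
  · intro ij hij h0
    have h := (Finset.mem_vaddAntidiagonal _ _).1 hij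
    have h2 : ij.1 + ij.2 = -1 := h.2.2
    rw [hm, show -ij.2 - 1 = ij.1 by omega] at h0
    exact hs _ (left_ne_zero_of_smul h0) (right_ne_zero_of_smul h0)
  · intro a ha _ b hb _ hab
    have h1 : a.1 + a.2 = -1 := ((Finset.mem_vaddAntidiagonal _ _).1 ha).2.2
    have h2 : b.1 + b.2 = -1 := ((Finset.mem_vaddAntidiagonal _ _).1 hb).2.2
    ext <;> omega
  · intro k _ h0
    refine ⟨(k, -1 - k), ?_, ?_, rfl⟩
    · rw [Finset.mem_vaddAntidiagonal]
      refine ⟨left_ne_zero_of_smul h0, ?_, ?_⟩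
      · change _ ≠ _
        rw [hm, show -(-1 - k) - 1 = k by omega]
        exact right_ne_zero_of_smul h0
      · change k + (-1 - k) = -1
        omega
    · rw [hm, show -(-1 - k) - 1 = k by omega]
      exact h0
  · intro ij hij _
    have h2 : ij.1 + ij.2 = -1 := ((Finset.mem_vaddAntidiagonal _ _).1 hij).2.2
    rw [hm, show -ij.2 - 1 = ij.1 by omega]

@[simp]
theorem res_single (k : ℤ) (c : ℂ) (u v : V) :
    𝒱.res (HahnSeries.single k c) u v = c • 𝒱.mode u k v := by
  rw [𝒱.res_eq_sum {k}]
  · simp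
  · intro j hj _
    by_contra h
    exact hj (HahnSeries.coeff_single_of_ne (by simpa using h))

/-- `f ↦ Res_z f(z) Y(u, z) v` as a linear map. -/
noncomputable def resMap (u v : V) : LaurentSeries ℂ →ₗ[ℂ] V where
  toFun f := 𝒱.res f u v
  map_add' f g := by
    change ((HahnModule.of ℂ).symm ((f + g) • 𝒱.Y u v)).coeff (-1) = _
    rw [add_smul]
    rfl
  map_smul' c f := by
    change ((HahnModule.of ℂ).symm ((c • f) • 𝒱.Y u v)).coeff (-1) = _
    rw [smul_assoc]
    rfl

@[simp]
theorem resMap_apply (f : LaurentSeries ℂ) (u v : V) : 𝒱.resMap u v f = 𝒱.res f u v := rfl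

theorem res_add (f g : LaurentSeries ℂ) (u v : V) :
    𝒱.res (f + g) u v = 𝒱.res f u v + 𝒱.res g u v := (𝒱.resMap u v).map_add f g

theorem res_sub (f g : LaurentSeries ℂ) (u v : V) :
    𝒱.res (f - g) u v = 𝒱.res f u v - 𝒱.res g u v := (𝒱.resMap u v).map_sub f g

theorem res_smul (c : ℂ) (f : LaurentSeries ℂ) (u v : V) :
    𝒱.res (c • f) u v = c • 𝒱.res f u v := (𝒱.resMap u v).map_smul c f

theorem res_eq_zero {B : ℤ} {u v : V} (hB : ∀ k, B ≤ k → 𝒱.mode u k v = 0)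
    {f : LaurentSeries ℂ} (hf : f ∈ filtration B) : 𝒱.res f u v = 0 := by
  rw [𝒱.res_eq_sum ∅, Finset.sum_empty]
  intro k h1 h2
  rcases lt_or_ge k B with h | h
  · exact (h1 (hf k h)).elim
  · exact (h2 (hB k h)).elim

theorem resMap_mem (u v : V) : 𝒱.resMap u v ∈ continuousMaps V := by
  obtain ⟨B, hB⟩ := 𝒱.exists_mode_eq_zero u v
  exact ⟨B, fun f hf => 𝒱.res_eq_zero hB hf⟩

/-- The commutator formula for modes. -/
theorem mode_comm {u v : V} {I : ℕ} (hI : ∀ i : ℕ, I ≤ i → 𝒱.mode u i v = 0) (m n : ℤ) (w : V) :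
    𝒱.mode u m (𝒱.mode v n w) - 𝒱.mode v n (𝒱.mode u m w) =
      ∑ i ∈ Finset.range I, ((Ring.choose m i : ℤ) : ℂ) • 𝒱.mode (𝒱.mode u i v) (m + n - i) w := by
  have h := 𝒱.jacobi u v w 0 m n
  have h0 : ∀ i : ℕ, 1 ≤ i → Ring.choose (0 : ℤ) i = 0 := fun i hi =>
    Ring.choose_zero_pos ℤ (by omega)
  rw [finsum_eq_sum_range (I := 1), finsum_eq_sum_range (I := 1), finsum_eq_sum_range (I := I)] at h
  · simpa [Int.cast_smul_eq_zsmul] using h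
  · intro i hi
    rw [zero_add, hI i hi]
    simp
  · intro i hi
    simp [h0 i hi]
  · intro i hi
    simp [h0 i hi]

/-- The Jacobi identity at $m=0$, where only the $i=0$ term survives on the right. One bound `I`
truncates both sums. -/
theorem mode_assoc {u v w : V} {I : ℕ} {n : ℤ} (hI : ∀ i : ℕ, I ≤ i → 𝒱.mode u i w = 0)
    (hI' : ∀ k : ℤ, n + I ≤ k → 𝒱.mode v k w = 0) (l : ℤ) :
    𝒱.mode (𝒱.mode u l v) n w =
      ∑ i ∈ Finset.range I, ((-1) ^ i * (Ring.choose l i : ℤ) : ℂ) •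
          𝒱.mode u (l - i) (𝒱.mode v (n + i) w)
        - ∑ i ∈ Finset.range I, (((l - i).negOnePow : ℤ) * (Ring.choose l i : ℤ) : ℂ) •
          𝒱.mode v (l - i + n) (𝒱.mode u i w) := by
  have h := 𝒱.jacobi u v w l 0 n
  have h0 : ∀ i : ℕ, 1 ≤ i → Ring.choose (0 : ℤ) i = 0 := fun i hi =>
    Ring.choose_zero_pos ℤ (by omega)
  rw [finsum_eq_sum_range (I := I), finsum_eq_sum_range (I := I), finsum_eq_sum_range (I := 1)] at h
  · simp only [Finset.sum_range_one, zero_add, Ring.choose_zero_right, one_smul, Nat.cast_zero,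
      add_zero, sub_zero] at h
    rw [mode, mode, ← h, Finset.smul_sum]
    congr 1
    · refine Finset.sum_congr rfl fun i _ => ?_
      rw [← Int.cast_smul_eq_zsmul ℂ]
      push_cast
      rfl
    · refine Finset.sum_congr rfl fun i _ => ?_
      rw [smul_smul, ← Int.cast_smul_eq_zsmul ℂ, show l - i + n = n + l - i by ring, ← mul_assoc,
        Int.negOnePow_sub]
      push_cast
      rw [Int.cast_negOnePow_natCast]
  · intro i hi
    simp [h0 i hi]
  · intro i hi
    rw [zero_add]
    simp [hI i hi]
  · intro i hi
    rw [hI' (n + i) (by omega)]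
    simp

/-- The commutator formula: `u_[f] v_[g] - v_[g] u_[f] = ∑ᵢ (uᵢ v)_[f⁽ⁱ⁾ g / i!]`. -/
theorem res_comm {u v : V} {I : ℕ} (hI : ∀ i : ℕ, I ≤ i → 𝒱.mode u i v = 0)
    (f g : LaurentSeries ℂ) (w : V) :
    𝒱.res f u (𝒱.res g v w) - 𝒱.res g v (𝒱.res f u w) =
      ∑ i ∈ Finset.range I, 𝒱.res (g * hasseDeriv ℂ i f) (𝒱.mode u i v) w := by
  -- Density is used in one variable at a time: here $g=z^n$ and $f$ varies, in `key2` $f$ is fixed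
  -- and $g$ varies.
  have key : ∀ n : ℤ, 𝒱.resMap u (𝒱.mode v n w) - 𝒱.mode v n ∘ₗ 𝒱.resMap u w =
      ∑ i ∈ Finset.range I, (𝒱.resMap (𝒱.mode u i v) w ∘ₗ
        mulMap (HahnSeries.single n 1)) ∘ₗ hasseDeriv ℂ i := by
    intro n
    refine eq_of_single (sub_mem (𝒱.resMap_mem _ _) (comp_mem_continuousMaps (𝒱.resMap_mem _ _) _))
      (Submodule.sum_mem _ fun i _ => ?_) fun m => ?_
    · exact comp_hasseDeriv_mem_continuousMaps
        (comp_mul_mem_continuousMaps (𝒱.resMap_mem _ _) _) i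
    · have := 𝒱.mode_comm hI m n w
      simp only [LinearMap.sub_apply, LinearMap.comp_apply, resMap_apply, res_single, one_smul,
        LinearMap.sum_apply, hasseDeriv_single, mulMap_apply,
        HahnSeries.single_mul_single, this]
      refine Finset.sum_congr rfl fun i _ => ?_
      rw [show n + (m - i) = m + n - i by ring]
      simp
  have key2 : 𝒱.res f u ∘ₗ 𝒱.resMap v w - 𝒱.resMap v (𝒱.res f u w) =
      ∑ i ∈ Finset.range I, 𝒱.resMap (𝒱.mode u i v) w ∘ₗ
        mulMap (hasseDeriv ℂ i f) := by
    refine eq_of_single (sub_mem (comp_mem_continuousMaps (𝒱.resMap_mem _ _) _) (𝒱.resMap_mem _ _))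
      (Submodule.sum_mem _ fun i _ => comp_mul_mem_continuousMaps (𝒱.resMap_mem _ _) _)
      fun n => ?_
    have := LinearMap.congr_fun (key n) f
    simp only [LinearMap.sub_apply, LinearMap.comp_apply, resMap_apply, res_single, one_smul,
        LinearMap.sum_apply, mulMap_apply] at this ⊢
    rw [this]
    exact Finset.sum_congr rfl fun i _ => by rw [mul_comm]
  have := LinearMap.congr_fun key2 g
  simp only [LinearMap.sub_apply, LinearMap.comp_apply, resMap_apply,
        LinearMap.sum_apply, mulMap_apply] at this
  rw [this]
  exact Finset.sum_congr rfl fun i _ => by rw [mul_comm]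

/-- The iterate formula for `(u_[f] v)_[g] w`. -/
theorem res_assoc {u v w : V} {I : ℕ} {A : ℤ} (hI : ∀ i : ℕ, I ≤ i → 𝒱.mode u i w = 0)
    (hI' : ∀ k : ℤ, A + I ≤ k → 𝒱.mode v k w = 0) (f : LaurentSeries ℂ) {g : LaurentSeries ℂ}
    (hg : g ∈ filtration A) :
    𝒱.res g (𝒱.res f u v) w =
      ∑ i ∈ Finset.range I, (-1 : ℂ) ^ i •
          𝒱.res (hasseDeriv ℂ i f) u (𝒱.res (HahnSeries.single (i : ℤ) 1 * g) v w)
        - ∑ i ∈ Finset.range I, 𝒱.res (flip (hasseDeriv ℂ i f) * g) v (𝒱.mode u i w) := by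
  have single : ∀ n : ℤ, A ≤ n → (𝒱.res (HahnSeries.single n 1)).flip w ∘ₗ 𝒱.resMap u v =
      ∑ i ∈ Finset.range I, (-1 : ℂ) ^ i •
          (𝒱.resMap u (𝒱.mode v (n + i) w) ∘ₗ hasseDeriv ℂ i)
        - ∑ i ∈ Finset.range I, ((𝒱.resMap v (𝒱.mode u i w) ∘ₗ mulMap (HahnSeries.single n 1)) ∘ₗ
          flipₗ) ∘ₗ hasseDeriv ℂ i := by
    intro n hn
    refine eq_of_single (comp_mem_continuousMaps (𝒱.resMap_mem _ _) _)
      (sub_mem (Submodule.sum_mem _ fun i _ => Submodule.smul_mem _ _ ?_)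
        (Submodule.sum_mem _ fun i _ => ?_)) fun l => ?_
    · exact comp_hasseDeriv_mem_continuousMaps (𝒱.resMap_mem _ _) i
    · exact comp_hasseDeriv_mem_continuousMaps (comp_flip_mem_continuousMaps
        (comp_mul_mem_continuousMaps (𝒱.resMap_mem _ _) _)) i
    · have := 𝒱.mode_assoc (n := n) hI (fun k hk => hI' k (by omega)) l
      simp only [LinearMap.sub_apply, LinearMap.comp_apply, resMap_apply, res_single, one_smul,
        LinearMap.flip_apply, LinearMap.smul_apply,
        LinearMap.sum_apply, hasseDeriv_single, mulMap_apply, flipₗ_apply, this]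
      congr 1
      · refine Finset.sum_congr rfl fun i _ => ?_
        rw [smul_smul]
        simp
      · refine Finset.sum_congr rfl fun i _ => ?_
        have : HahnSeries.single n (1 : ℂ) *
            flip (HahnSeries.single (l - i) (Ring.choose l i • 1)) =
            HahnSeries.single (l - i + n)
              (((l - i).negOnePow : ℤ) * (Ring.choose l i : ℤ) : ℂ) := by
          ext k
          rw [HahnSeries.coeff_single_mul, coeff_flip]
          rcases eq_or_ne k (l - i + n) with rfl | h
          · simp
          · rw [HahnSeries.coeff_single_of_ne h, HahnSeries.coeff_single_of_ne (by omega)]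
            simp
        rw [this, res_single]
  have key2 : 𝒱.resMap (𝒱.res f u v) w -
      (∑ i ∈ Finset.range I, (-1 : ℂ) ^ i • (𝒱.res (hasseDeriv ℂ i f) u ∘ₗ (𝒱.resMap v w ∘ₗ
          mulMap (HahnSeries.single (i : ℤ) 1)))
        - ∑ i ∈ Finset.range I, 𝒱.resMap v (𝒱.mode u i w) ∘ₗ
            mulMap (flip (hasseDeriv ℂ i f))) ∈ continuousMaps V :=
    sub_mem (𝒱.resMap_mem _ _) (sub_mem
      (Submodule.sum_mem _ fun i _ => Submodule.smul_mem _ _ (comp_mem_continuousMaps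
        (comp_mul_mem_continuousMaps (𝒱.resMap_mem _ _) _) _))
      (Submodule.sum_mem _ fun i _ => comp_mul_mem_continuousMaps (𝒱.resMap_mem _ _) _))
  -- The truncation at `I` is valid only for $g=z^n$ with $n\ge A$, so density is applied inside
  -- $z^A\mathbb C[[z]]$.
  have := eq_zero_of_single key2 (A := A) (fun n hn => ?_) hg
  · simpa [sub_eq_zero] using this
  · have h := LinearMap.congr_fun (single n hn) f
    rw [LinearMap.sub_apply, sub_eq_zero]
    simp only [LinearMap.sub_apply, LinearMap.comp_apply, resMap_apply, res_single, one_smul,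
      LinearMap.flip_apply, LinearMap.smul_apply, LinearMap.sum_apply, mulMap_apply,
      flipₗ_apply, HahnSeries.single_mul_single, mul_one] at h ⊢
    rw [h]
    congr 1
    · exact Finset.sum_congr rfl fun i _ => by rw [add_comm]
    · exact Finset.sum_congr rfl fun i _ => by rw [mul_comm]

theorem D_vac : 𝒱.D 𝒱.vac = 0 := by
  change 𝒱.mode 𝒱.vac (-2) 𝒱.vac = 0
  rw [mode, 𝒱.vac_mode]
  simp

theorem mode_vac_of_nonneg (u : V) {n : ℤ} (hn : 0 ≤ n) : 𝒱.mode u n 𝒱.vac = 0 := by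
  rw [mode, 𝒱.mode_vac u n (by omega), if_neg (by omega)]

theorem mode_neg_one_vac (u : V) : 𝒱.mode u (-1) 𝒱.vac = u := by
  rw [mode, 𝒱.mode_vac u _ le_rfl, if_pos rfl]

/-- The iterate formula for $(u_nv)_{-2}\mathbf 1$: the terms with $u_i\mathbf 1$, $i\ge0$, vanish,
and $v_{-2+i}\mathbf 1$ is nonzero only for $i=0,1$. -/
theorem D_mode (u v : V) (n : ℤ) :
    𝒱.D (𝒱.mode u n v) = 𝒱.mode u n (𝒱.D v) - (n : ℂ) • 𝒱.mode u (n - 1) v := by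
  have h := 𝒱.mode_assoc (u := u) (v := v) (w := 𝒱.vac) (I := 2) (n := -2)
    (fun i _ => 𝒱.mode_vac_of_nonneg u (by omega))
    (fun k hk => 𝒱.mode_vac_of_nonneg v (by omega)) n
  change 𝒱.mode (𝒱.mode u n v) (-2) 𝒱.vac = _
  rw [h, Finset.sum_range_succ, Finset.sum_range_one, Finset.sum_range_succ, Finset.sum_range_one,
    𝒱.mode_vac_of_nonneg u (by omega), 𝒱.mode_vac_of_nonneg u (by omega)]
  simp [D, sub_eq_add_neg, 𝒱.mode_vac]

theorem mode_D (u : V) (n : ℤ) (w : V) :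
    𝒱.mode (𝒱.D u) n w = -(n : ℂ) • 𝒱.mode u (n - 1) w := by
  obtain ⟨N, hN⟩ := 𝒱.exists_mode_eq_zero u w
  have h := 𝒱.mode_assoc (u := u) (v := 𝒱.vac) (w := w) (I := N.natAbs + n.natAbs + 3) (n := n)
    (fun i hi => hN _ (by omega))
    (fun k hk => by rw [mode, 𝒱.vac_mode, if_neg (by omega)]) (-2)
  have choose : ∀ i : ℕ, ((Ring.choose (-2 : ℤ) i : ℤ) : ℂ) = (-1) ^ i * (i + 1) := by
    intro i
    rw [show (-2 : ℤ) = -((2 : ℕ) : ℤ) by norm_num, Ring.choose_neg]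
    rw [show (((2 : ℕ) : ℤ) + i - 1) = ((i + 1 : ℕ) : ℤ) by push_cast; ring, Ring.choose_natCast,
      Units.smul_def, smul_eq_mul, Int.cast_mul, Int.cast_negOnePow_natCast]
    simp
  change 𝒱.mode (𝒱.mode u (-2) 𝒱.vac) n w = _
  rw [h]
  simp only [mode, 𝒱.vac_mode, choose]
  -- Only the mode $-1$ of the vacuum is nonzero. It occurs in the first sum at $i=-1-n$ when $n<0$,
  -- in the second at $i=n-1$ when $n>0$, and nowhere when $n=0$.
  rcases lt_trichotomy n 0 with hn | rfl | hn
  · obtain ⟨k, rfl⟩ : ∃ k : ℕ, n = -1 - k := ⟨(-1 - n).toNat, by omega⟩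
    rw [Finset.sum_eq_single k, Finset.sum_eq_zero, sub_zero, if_pos (by ring)]
    · rw [← mul_assoc, ← mul_pow, show (-2 : ℤ) - k = -1 - k - 1 by ring]
      simp
    · intro i _
      rw [if_neg (by omega), smul_zero]
    · intro i _ hi
      rw [if_neg (by omega), map_zero, smul_zero]
    · intro hk
      exact (hk (Finset.mem_range.2 (by omega))).elim
  · rw [Finset.sum_eq_zero, Finset.sum_eq_zero]
    · simp
    · intro i _
      rw [if_neg (by omega), smul_zero]
    · intro i _
      rw [if_neg (by omega), map_zero, smul_zero]
  · obtain ⟨k, rfl⟩ : ∃ k : ℕ, n = k + 1 := ⟨(n - 1).toNat, by omega⟩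
    rw [Finset.sum_eq_zero, Finset.sum_eq_single k, zero_sub, if_pos (by ring)]
    · rw [show (-2 : ℤ) - k = -(2 + k) by ring, Int.negOnePow_neg, Int.negOnePow_add,
        Units.val_mul, Int.cast_mul, Int.cast_negOnePow_natCast, mul_assoc,
        ← mul_assoc ((-1 : ℂ) ^ k), ← mul_pow, add_sub_cancel_right]
      simp [Int.negOnePow_even 2 (by decide), -neg_add_rev]
    · intro i _ hi
      rw [if_neg (by omega), smul_zero]
    · intro hk
      exact (hk (Finset.mem_range.2 (by omega))).elim
    · intro i _
      rw [if_neg (by omega), map_zero, smul_zero]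

theorem mode_neg_vac_mem (w : V) (i : ℕ) : 𝒱.mode w (-1 - (i + 1 : ℕ)) 𝒱.vac ∈
    LinearMap.range 𝒱.D := by
  have h := 𝒱.D_mode w 𝒱.vac (-1 - i)
  rw [D_vac, map_zero, zero_sub, ← neg_smul] at h
  have h2 : -(((-1 - i : ℤ)) : ℂ) ≠ 0 := by
    push_cast
    rw [show -(-1 - (i : ℂ)) = i + 1 by ring]
    exact_mod_cast i.succ_ne_zero
  rw [show (-1 : ℤ) - (i + 1 : ℕ) = -1 - i - 1 by push_cast; ring]
  exact (Submodule.smul_mem_iff _ h2).1 (h ▸ LinearMap.mem_range_self _ _)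

/-- The Jacobi identity on the vacuum with middle index $-1$ and last index $0$. On the right the
$i=0$ term is $u_nv$, and the others $(u_{n+i}v)_{-1-i}\mathbf 1$ are in the image of $\mathcal D$.
-/
theorem skew_symmetry (u v : V) (n : ℤ) :
    𝒱.mode u n v + ((n.negOnePow : ℤ) : ℂ) • 𝒱.mode v n u ∈ LinearMap.range 𝒱.D := by
  obtain ⟨N, hN⟩ := 𝒱.exists_mode_eq_zero u v
  have h := 𝒱.jacobi u v 𝒱.vac n (-1) 0
  rw [finsum_eq_sum_range (I := 0), finsum_eq_sum_range (I := 1),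
    finsum_eq_sum_range (I := (N - n).toNat + 1)] at h
  · rw [Finset.sum_range_one, Finset.sum_range_succ'] at h
    simp only [Finset.sum_range_zero, zero_sub, pow_zero,
      Ring.choose_zero_right, Nat.cast_zero, mul_one, one_smul, zero_add, sub_zero, add_zero] at h
    change -((n.negOnePow : ℤ) • 𝒱.mode v n (𝒱.mode u (-1) 𝒱.vac)) =
      _ + 𝒱.mode (𝒱.mode u n v) (-1) 𝒱.vac at h
    rw [mode_neg_one_vac, mode_neg_one_vac] at h
    rw [Int.cast_smul_eq_zsmul, ← neg_neg ((n.negOnePow : ℤ) • 𝒱.mode v n u), h, neg_add_rev,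
      add_neg_cancel_left]
    refine neg_mem (Submodule.sum_mem _ fun i _ => zsmul_mem ?_ _)
    exact 𝒱.mode_neg_vac_mem _ i
  · intro i hi
    rw [show (𝒱.Y u).ncoeff (n + i) v = 𝒱.mode u (n + i) v from rfl, hN _ (by omega)]
    simp
  · intro i hi
    change _ • 𝒱.mode v _ (𝒱.mode u _ 𝒱.vac) = 0
    rw [𝒱.mode_vac_of_nonneg u (by omega), map_zero, smul_zero]
  · intro i hi
    change _ • 𝒱.mode u _ (𝒱.mode v _ 𝒱.vac) = 0
    rw [𝒱.mode_vac_of_nonneg v (by omega), map_zero, smul_zero]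

theorem D_res (f : LaurentSeries ℂ) (u v : V) :
    𝒱.D (𝒱.res f u v) = 𝒱.res f u (𝒱.D v) + 𝒱.res f (𝒱.D u) v := by
  have : 𝒱.D ∘ₗ 𝒱.resMap u v = 𝒱.resMap u (𝒱.D v) + 𝒱.resMap (𝒱.D u) v := by
    refine eq_of_single (comp_mem_continuousMaps (𝒱.resMap_mem _ _) _)
      (add_mem (𝒱.resMap_mem _ _) (𝒱.resMap_mem _ _)) fun n => ?_
    simp [D_mode, mode_D, sub_eq_add_neg]
  exact LinearMap.congr_fun this f

/-- Integration by parts, since $Y(\mathcal Du,z)=\frac{d}{dz}Y(u,z)$. -/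
theorem res_D_left (f : LaurentSeries ℂ) (u v : V) :
    𝒱.res f (𝒱.D u) v = -𝒱.res (derivative ℂ f) u v := by
  have : 𝒱.resMap (𝒱.D u) v = -(𝒱.resMap u v ∘ₗ hasseDeriv ℂ 1) := by
    refine eq_of_single (𝒱.resMap_mem _ _) (neg_mem (comp_hasseDeriv_mem_continuousMaps
      (𝒱.resMap_mem _ _) 1)) fun n => ?_
    simp only [resMap_apply, LinearMap.neg_apply, LinearMap.comp_apply, hasseDeriv_single,
      res_single, mode_D]
    simp
  exact LinearMap.congr_fun this f

theorem res_skew (f : LaurentSeries ℂ) (u v : V) :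
    𝒱.res f u v + 𝒱.res (flip f) v u ∈ LinearMap.range 𝒱.D := by
  have : (LinearMap.range 𝒱.D).mkQ ∘ₗ (𝒱.resMap u v + 𝒱.resMap v u ∘ₗ flipₗ) = 0 := by
    refine eq_of_single (comp_mem_continuousMaps (add_mem (𝒱.resMap_mem _ _)
      (comp_flip_mem_continuousMaps (𝒱.resMap_mem _ _))) _) (zero_mem _) fun n => ?_
    have hf : flip (HahnSeries.single n (1 : ℂ)) =
        HahnSeries.single n ((n.negOnePow : ℤ) : ℂ) := by
      ext k
      rcases eq_or_ne k n with rfl | h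
      · simp
      · rw [coeff_flip, HahnSeries.coeff_single_of_ne h, HahnSeries.coeff_single_of_ne h, mul_zero]
    rw [LinearMap.comp_apply, LinearMap.zero_apply, Submodule.mkQ_apply,
      Submodule.Quotient.mk_eq_zero, LinearMap.add_apply, LinearMap.comp_apply, flipₗ_apply, hf,
      resMap_apply, resMap_apply, res_single, res_single, one_smul]
    exact 𝒱.skew_symmetry u v n
  have h := LinearMap.congr_fun this f
  rwa [LinearMap.comp_apply, LinearMap.zero_apply, Submodule.mkQ_apply,
      Submodule.Quotient.mk_eq_zero] at h

theorem res_vac_left (f : LaurentSeries ℂ) (v : V) : 𝒱.res f 𝒱.vac v = f.coeff (-1) • v := by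
  rw [𝒱.res_eq_sum {-1}]
  · simp [𝒱.vac_mode]
  · intro k _ hk
    by_contra h
    rw [Finset.mem_singleton] at h
    exact hk (by simp [𝒱.vac_mode, h])

/-- `u_[f] 𝟏 ≡ Res(f) u` modulo the image of `𝒟`. -/
theorem res_vac_right (f : LaurentSeries ℂ) (u : V) :
    𝒱.res f u 𝒱.vac - f.coeff (-1) • u ∈ LinearMap.range 𝒱.D := by
  have h := 𝒱.res_skew f u 𝒱.vac
  rw [res_vac_left] at h
  simpa [sub_eq_add_neg] using h

end VertexAlgebra

/-! ### Residues and congruences of polynomials in $1/(e^z-1)$. -/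

namespace LaurentSeries

open Polynomial

/-- The series `(exp z - 1) / z`. -/
noncomputable def expSubOneDiv : PowerSeries ℂ := PowerSeries.mk fun n => ((n + 1).factorial : ℂ)⁻¹

theorem constantCoeff_expSubOneDiv : PowerSeries.constantCoeff expSubOneDiv = 1 := by
  rw [← PowerSeries.coeff_zero_eq_constantCoeff_apply]
  simp [expSubOneDiv]

theorem X_mul_expSubOneDiv : PowerSeries.X * expSubOneDiv = expSeries 1 - 1 := by
  ext n
  rcases n with _ | n
  · simp [expSeries]
  · rw [PowerSeries.coeff_succ_X_mul, map_sub, PowerSeries.coeff_one, if_neg n.succ_ne_zero]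
    simp [expSeries, expSubOneDiv, PowerSeries.coeff_exp]

theorem invExpSubOne_eq :
    invExpSubOne =
      HahnSeries.single (-1 : ℤ) 1 * ((expSubOneDiv⁻¹ : PowerSeries ℂ) : LaurentSeries ℂ) := by
  refine inv_eq_of_mul_eq_one_right ?_
  have h1 : expL 1 - 1 =
      HahnSeries.single (1 : ℤ) 1 * ((expSubOneDiv : PowerSeries ℂ) : LaurentSeries ℂ) := by
    rw [expL, ← PowerSeries.coe_one, ← PowerSeries.coe_sub, ← X_mul_expSubOneDiv,
      PowerSeries.coe_mul, PowerSeries.coe_X]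
  rw [h1, mul_mul_mul_comm, HahnSeries.single_mul_single, ← PowerSeries.coe_mul,
    PowerSeries.mul_inv_cancel _ (by rw [constantCoeff_expSubOneDiv]; exact one_ne_zero)]
  simp

theorem coeff_expL_mul_invExpSubOne (a : ℂ) : (expL a * invExpSubOne).coeff (-1) = 1 := by
  rw [invExpSubOne_eq, mul_left_comm, HahnSeries.coeff_single_mul, expL, ← PowerSeries.coe_mul,
    PowerSeries.coeff_coe]
  rw [if_neg (by omega), show ((-1 : ℤ) - -1).natAbs = 0 from rfl,
    PowerSeries.coeff_zero_eq_constantCoeff_apply, map_mul, PowerSeries.constantCoeff_inv,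
    constantCoeff_expSubOneDiv, ← PowerSeries.coeff_zero_eq_constantCoeff_apply, expSeries,
    PowerSeries.coeff_rescale]
  simp

theorem derivative_expL_mul_pow (a : ℂ) (k : ℕ) :
    derivative ℂ (expL a * invExpSubOne ^ k) = (a - k) • (expL a * invExpSubOne ^ k) -
      (k : ℂ) • (expL a * invExpSubOne ^ (k + 1)) := by
  rw [derivative_mul, derivative_pow, derivative_expL, derivative_invExpSubOne]
  rcases k with _ | k
  · simp only [Nat.cast_zero, zero_mul, mul_zero, pow_zero, mul_one, add_zero, sub_zero]
    rw [← HahnSeries.C_mul_eq_smul (r := (0 : ℂ)), map_zero, zero_mul, sub_zero]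
  · simp only [add_tsub_cancel_right, ← HahnSeries.C_mul_eq_smul, map_sub, map_natCast]
    ring

/-- The residue of the total derivative in `derivative_expL_mul_pow` is zero, which relates
consecutive residues by factors that vanish only when $a$ is a natural number. The residue is in
fact $\binom{a-1}{k}$. -/
theorem coeff_expL_mul_pow_ne_zero {a : ℂ} (ha : ∀ k : ℕ, a ≠ k) (k : ℕ) :
    (expL a * invExpSubOne ^ (k + 1)).coeff (-1) ≠ 0 := by
  induction k with
  | zero => simp [coeff_expL_mul_invExpSubOne]
  | succ k ih =>
    intro h
    have h1 := congrArg (fun f => HahnSeries.coeff f (-1)) (derivative_expL_mul_pow a (k + 1))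
    simp only [coeff_neg_one_derivative, HahnSeries.coeff_sub, HahnSeries.coeff_smul, h,
      smul_eq_mul, mul_zero,
      sub_zero] at h1
    rcases mul_eq_zero.1 h1.symm with h2 | h2
    · exact ha _ (sub_eq_zero.1 h2)
    · exact ih h2

theorem expL_natCast (k : ℕ) : expL k = expL 1 ^ k := by
  induction k with
  | zero => simp [expL_zero]
  | succ k ih => rw [Nat.cast_succ, expL_add, ih, pow_succ]

/-- The substitution `Y ↦ 1 / (exp z - 1)` into polynomials. -/
noncomputable def polyY : ℂ[X] →+* LaurentSeries ℂ := eval₂RingHom HahnSeries.C invExpSubOne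

@[simp]
theorem polyY_C (c : ℂ) : polyY (C c) = HahnSeries.C c := by simp [polyY]

@[simp]
theorem polyY_X : polyY X = invExpSubOne := by simp [polyY]

theorem expL_mul_polyY_pow (k l : ℕ) :
    expL k * invExpSubOne ^ (k + l) = polyY ((1 + X) ^ k * X ^ l) := by
  rw [expL_natCast, pow_add, ← mul_assoc, ← mul_pow, expL_one_mul_invExpSubOne]
  simp

theorem derivative_C (c : ℂ) : derivative ℂ (HahnSeries.C c) = 0 := by
  rw [HahnSeries.C_apply, derivative_apply, hasseDeriv_single]
  simp

theorem derivative_polyY (q : ℂ[X]) :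
    derivative ℂ (polyY q) = polyY (-(X * (1 + X) * Polynomial.derivative q)) := by
  induction q using Polynomial.induction_on' with
  | add p q hp hq => rw [map_add, map_add, hp, hq, ← map_add]; congr 1; simp; ring
  | monomial k c =>
    rw [← C_mul_X_pow_eq_monomial, map_mul, derivative_mul, map_pow, derivative_pow, polyY_C,
      derivative_C, polyY_X, derivative_invExpSubOne, derivative_C_mul, derivative_X_pow]
    simp only [map_neg, map_mul, map_add, map_one, map_pow, polyY_X, polyY_C, map_natCast, zero_mul,
      zero_add]
    ring

theorem flip_polyY (q : ℂ[X]) : flip (polyY q) = polyY (q.comp (-1 - X)) := by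
  have : (flip.comp polyY : ℂ[X] →+* _) = polyY.comp (compRingHom (-1 - X)) := by
    refine Polynomial.ringHom_ext (fun c => ?_) ?_
    · ext n
      simp only [RingHom.comp_apply, polyY_C, coe_compRingHom, C_comp, coeff_flip,
        HahnSeries.C_apply]
      rcases eq_or_ne n 0 with rfl | h
      · simp
      · simp [HahnSeries.coeff_single_of_ne h]
    · simp [flip_invExpSubOne]
  exact RingHom.congr_fun this q

/-- In terms of $y=1/(e^z-1)$ the form $q\,dz$ is $-q(y)\,dy/(y(1+y))$, and $z=0$ is $y=\infty$. The
right side is the sum of the residues of $q(y)\,dy/(y(1+y))$ at $y=0$ and $y=-1$. -/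
theorem coeff_polyY (q : ℂ[X]) : (polyY q).coeff (-1) = q.eval 0 - q.eval (-1) := by
  have hX : ∀ k : ℕ, (invExpSubOne ^ (k + 1)).coeff (-1) = (-1) ^ k := by
    intro k
    induction k with
    | zero => simpa [expL_zero] using coeff_expL_mul_invExpSubOne 0
    | succ k ih =>
      have h1 := congrArg (fun f => HahnSeries.coeff f (-1)) (derivative_expL_mul_pow 0 (k + 1))
      simp only [coeff_neg_one_derivative, HahnSeries.coeff_sub, HahnSeries.coeff_smul, ih,
        expL_zero, one_mul, smul_eq_mul] at h1
      have h2 : ((k + 1 : ℕ) : ℂ) ≠ 0 := by exact_mod_cast k.succ_ne_zero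
      refine mul_left_cancel₀ h2 ?_
      rw [pow_succ (-1 : ℂ)]
      linear_combination h1
  induction q using Polynomial.induction_on' with
  | add p q hp hq => rw [map_add, HahnSeries.coeff_add, hp, hq]; simp; ring
  | monomial k c =>
    rw [← C_mul_X_pow_eq_monomial, map_mul, map_pow, polyY_C, polyY_X, HahnSeries.C_mul_eq_smul,
      HahnSeries.coeff_smul]
    rcases k with _ | k
    · simp [HahnSeries.coeff_one]
    · rw [hX]
      simp [pow_succ]

theorem isCoprime_X_pow_one_add_X_pow (M : ℕ) : IsCoprime (X ^ M : ℂ[X]) ((1 + X) ^ M) :=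
  IsCoprime.pow ⟨-1, 1, by ring⟩

theorem pow_dvd_mul_derivative {p q : ℂ[X]} {M : ℕ} {c : ℂ} (h : p ^ M ∣ q - C c) :
    p ^ M ∣ p * Polynomial.derivative q := by
  obtain ⟨d, hd⟩ := h
  have := congrArg Polynomial.derivative hd
  rw [derivative_sub, Polynomial.derivative_C, sub_zero, Polynomial.derivative_mul,
    Polynomial.derivative_pow] at this
  rw [this]
  rcases M with _ | M
  · simp
  · refine ⟨C ((M + 1 : ℕ) : ℂ) * Polynomial.derivative p * d + p * Polynomial.derivative d, ?_⟩
    simp only [add_tsub_cancel_right]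
    ring

/-- Differentiating lowers the order of vanishing of $q-c$ by one, and the factor $X$ restores it.
The same holds at $-1$, and the two prime powers are coprime. -/
theorem pow_dvd_of_congr {q : ℂ[X]} {M : ℕ} {c d : ℂ} (h1 : X ^ M ∣ q - C c)
    (h2 : (1 + X) ^ M ∣ q - C d) : (X * (1 + X)) ^ M ∣ X * (1 + X) * Polynomial.derivative q := by
  rw [mul_pow]
  refine (isCoprime_X_pow_one_add_X_pow M).mul_dvd ?_ ?_
  · rw [mul_right_comm]
    exact dvd_mul_of_dvd_left (pow_dvd_mul_derivative h1) _
  · rw [mul_assoc]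
    exact dvd_mul_of_dvd_right (pow_dvd_mul_derivative h2) _

/-- The multiples of `(Y (1 + Y))ᴹ` in `ℂ[Y]`, where `Y = 1 / (exp z - 1)`. -/
noncomputable def idealY (M : ℕ) : Submodule ℂ (LaurentSeries ℂ) where
  carrier := {f | ∃ q : ℂ[X], (X * (1 + X)) ^ M ∣ q ∧ f = polyY q}
  add_mem' := by
    rintro _ _ ⟨p, hp, rfl⟩ ⟨q, hq, rfl⟩
    exact ⟨p + q, dvd_add hp hq, (map_add _ _ _).symm⟩
  zero_mem' := ⟨0, dvd_zero _, (map_zero _).symm⟩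
  smul_mem' := by
    rintro c _ ⟨p, hp, rfl⟩
    exact ⟨C c * p, dvd_mul_of_dvd_right hp _, by
      rw [map_mul, polyY_C, HahnSeries.C_mul_eq_smul]⟩

theorem polyY_mem_idealY {M : ℕ} {q : ℂ[X]} (hq : (X * (1 + X)) ^ M ∣ q) : polyY q ∈ idealY M :=
  ⟨q, hq, rfl⟩

theorem derivative_mem_idealY {M : ℕ} {f : LaurentSeries ℂ} (hf : f ∈ idealY M) :
    derivative ℂ f ∈ idealY M := by
  obtain ⟨q, hq, rfl⟩ := hf
  rw [derivative_polyY]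
  refine polyY_mem_idealY ((dvd_neg).2 ?_)
  exact pow_dvd_mul_derivative (c := 0) (by simpa using hq)

theorem flip_mem_idealY {M : ℕ} {f : LaurentSeries ℂ} (hf : f ∈ idealY M) :
    flip f ∈ idealY M := by
  obtain ⟨q, ⟨d, rfl⟩, rfl⟩ := hf
  rw [flip_polyY]
  refine polyY_mem_idealY ⟨d.comp (-1 - X), ?_⟩
  simp
  left
  ring

theorem mul_mem_idealY {M : ℕ} {f : LaurentSeries ℂ} (hf : f ∈ idealY M) (q : ℂ[X]) :
    f * polyY q ∈ idealY M := by
  obtain ⟨p, hp, rfl⟩ := hf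
  rw [← map_mul]
  exact polyY_mem_idealY (dvd_mul_of_dvd_left hp q)

theorem hasseDeriv_succ_mem_idealY {M : ℕ} {f : LaurentSeries ℂ}
    (hf : derivative ℂ f ∈ idealY M) (i : ℕ) : hasseDeriv ℂ (i + 1) f ∈ idealY M := by
  -- The $i$-th Hasse derivative of $f'$ is $i+1$ times the $(i+1)$-st of $f$.
  have h := hasseDeriv_mem (fun f hf => derivative_mem_idealY hf) i hf
  rw [derivative_apply, hasseDeriv_comp, ← Nat.cast_smul_eq_nsmul ℂ] at h
  refine (Submodule.smul_mem_iff _ ?_).1 h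
  exact_mod_cast (Nat.choose_pos (Nat.le_add_right i 1)).ne'

/-- The polynomial `∑ₘ (-1)ᵐ (m + N choose N) (1 + X)ᴺ⁺¹ Xᵐ`, with `m ≤ N`. -/
noncomputable def unitPoly (N : ℕ) : ℂ[X] :=
  ∑ m ∈ Finset.range (N + 1), C ((-1 : ℂ) ^ m * ((m + N).choose N : ℂ)) *
    ((1 + X) ^ (N + 1) * X ^ m)

theorem one_add_X_pow_dvd_unitPoly (N : ℕ) : (1 + X) ^ (N + 1) ∣ unitPoly N :=
  Finset.dvd_sum fun _ _ => dvd_mul_of_dvd_right (dvd_mul_right _ _) _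

/-- The sum $\sum_{m\le N}(-1)^m\binom{m+N}{N}X^m$ is the truncation of $(1+X)^{-(N+1)}$ after
degree $N$. -/
theorem X_pow_dvd_unitPoly_sub_one (N : ℕ) : X ^ (N + 1) ∣ unitPoly N - 1 := by
  set S : ℂ[X] := ∑ m ∈ Finset.range (N + 1), C ((-1 : ℂ) ^ m * ((m + N).choose N : ℂ)) * X ^ m
    with hS
  have h1 : unitPoly N = (1 + X) ^ (N + 1) * S := by
    rw [unitPoly, hS, Finset.mul_sum]
    exact Finset.sum_congr rfl fun m _ => by ring
  have h2 : (((1 + X) ^ (N + 1) : ℂ[X]) : PowerSeries ℂ) *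
      PowerSeries.binomialSeries ℂ (-((N + 1 : ℕ) : ℤ)) = 1 := by
    rw [Polynomial.coe_pow, Polynomial.coe_add, Polynomial.coe_one, Polynomial.coe_X,
      ← PowerSeries.binomialSeries_nat (R := ℤ), ← PowerSeries.binomialSeries_add,
      Nat.cast_add, Int.add_right_neg, PowerSeries.binomialSeries_zero]
  rw [X_pow_dvd_iff]
  intro d hd
  have h3 := congrArg (PowerSeries.coeff d) h2
  rw [coeff_sub, sub_eq_zero, h1, ← Polynomial.coeff_coe, ← Polynomial.coeff_coe (1 : ℂ[X]),
    Polynomial.coe_one, ← h3, Polynomial.coe_mul, PowerSeries.coeff_mul, PowerSeries.coeff_mul]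
  refine Finset.sum_congr rfl fun ij hij => ?_
  congr 1
  have hj : ij.2 < N + 1 := by
    have := Finset.HasAntidiagonal.mem_antidiagonal.1 hij
    omega
  rw [Polynomial.coeff_coe, hS, finsetSum_coeff]
  simp only [coeff_C_mul_X_pow]
  rw [Finset.sum_ite_eq, if_pos (Finset.mem_range.2 hj), PowerSeries.binomialSeries_coeff,
    Ring.choose_neg, show ((N + 1 : ℕ) : ℤ) + ij.2 - 1 = ((ij.2 + N : ℕ) : ℤ) by push_cast; ring,
    Ring.choose_natCast, Nat.choose_symm_add, Units.smul_def, smul_eq_mul, zsmul_eq_mul,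
    Int.cast_mul, Int.cast_negOnePow_natCast]
  simp

theorem derivative_polyY_mem_idealY {q : ℂ[X]} {M : ℕ} {c d : ℂ} (h1 : X ^ M ∣ q - C c)
    (h2 : (1 + X) ^ M ∣ q - C d) : derivative ℂ (polyY q) ∈ idealY M := by
  rw [derivative_polyY]
  exact polyY_mem_idealY ((dvd_neg).2 (pow_dvd_of_congr h1 h2))

theorem X_pow_dvd_unitPoly_comp (N : ℕ) : X ^ (N + 1) ∣ (unitPoly N).comp (-1 - X) := by
  obtain ⟨d, hd⟩ := one_add_X_pow_dvd_unitPoly N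
  refine ⟨(-1) ^ (N + 1) * d.comp (-1 - X), ?_⟩
  rw [hd, mul_comp, pow_comp, add_comp, one_comp, X_comp, ← mul_assoc, ← mul_pow]
  ring

theorem one_add_X_pow_dvd_unitPoly_comp (N : ℕ) :
    (1 + X) ^ (N + 1) ∣ (unitPoly N).comp (-1 - X) - 1 := by
  obtain ⟨d, hd⟩ := X_pow_dvd_unitPoly_sub_one N
  refine ⟨(-1) ^ (N + 1) * d.comp (-1 - X), ?_⟩
  have := congrArg (fun p => p.comp (-1 - X)) hd
  simp only [sub_comp, one_comp, mul_comp, pow_comp, X_comp] at this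
  rw [this, ← mul_assoc, ← mul_pow]
  ring

/-- The reflection $y\mapsto-1-y$ exchanges the points $0$ and $-1$, so the two factors vanish to
order $N+1$ at different points. -/
theorem flip_mul_unitPoly_mem (N : ℕ) :
    flip (polyY (unitPoly N)) * polyY (unitPoly N) ∈ idealY (N + 1) := by
  rw [flip_polyY, ← map_mul]
  refine polyY_mem_idealY ?_
  rw [mul_pow]
  exact mul_dvd_mul (X_pow_dvd_unitPoly_comp N) (one_add_X_pow_dvd_unitPoly N)

theorem coeff_unitPoly (N : ℕ) : (polyY (unitPoly N)).coeff (-1) = 1 := by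
  obtain ⟨d, hd⟩ := X_pow_dvd_unitPoly_sub_one N
  obtain ⟨e, he⟩ := one_add_X_pow_dvd_unitPoly N
  have h1 := congrArg (Polynomial.eval 0) hd
  have h2 := congrArg (Polynomial.eval (-1)) he
  simp [sub_eq_zero] at h1 h2
  rw [coeff_polyY, h1, h2, sub_zero]

end LaurentSeries

/-! ### The algebra in the logarithmic coordinate. -/

namespace VertexAlgebra

open LaurentSeries Polynomial

theorem nbar_lt {T : ℕ} (hT : 0 < T) (n : ℚ) : nbar T n < T := by
  have hT' : (0 : ℚ) < T := by exact_mod_cast hT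
  rw [nbar, Nat.floor_lt (mul_nonneg hT'.le (Int.fract_nonneg n))]
  exact mul_lt_of_lt_one_right hT' (Int.fract_lt_one n)

/-- The number `2⌊n⌋ + δ(r) + δ(T - r)`. -/
noncomputable def poleOrder (T : ℕ) (n : ℚ) (r : ℕ) : ℕ :=
  2 * ⌊n⌋₊ + delta (nbar T n) r + delta (nbar T n) (T - r)

/-- The number `δ(r) + ⌊n⌋ + r / T`. -/
noncomputable def expShift (T : ℕ) (n : ℚ) (r : ℕ) : ℂ :=
  delta (nbar T n) r + ⌊n⌋₊ + r / T

/-- The Laurent series defining `∘_{g,n}` on `V^r` in the coordinate `log (1 + z)`. -/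
noncomputable def twistFun (T : ℕ) (n : ℚ) (r : ℕ) : LaurentSeries ℂ :=
  expL (expShift T n r) * invExpSubOne ^ (poleOrder T n r + 1)

/-- For $r=0$ the exponents are $\lfloor n\rfloor+1$ and $2\lfloor n\rfloor+2$, because
$\delta(0)=1$ and $\delta(T)=0$; then $e^zy=1+y$ is used. -/
theorem twistFun_zero {T : ℕ} (hT : 0 < T) (n : ℚ) :
    twistFun T n 0 = polyY ((X * (1 + X)) ^ (⌊n⌋₊ + 1)) := by
  have h1 : delta (nbar T n) (T - 0) = 0 := if_neg (by have := nbar_lt hT n; omega)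
  have h2 : delta (nbar T n) 0 = 1 := if_pos (Nat.zero_le _)
  rw [twistFun, expShift, poleOrder, h1, h2]
  have := expL_mul_polyY_pow (⌊n⌋₊ + 1) (⌊n⌋₊ + 1)
  rw [mul_pow, mul_comm (X ^ _), ← this]
  congr 1
  · congr 1
    push_cast
    simp
    ring
  · congr 1
    ring

theorem expShift_ne_natCast {T : ℕ} (n : ℚ) {r : ℕ} (hr : 0 < r) (hrT : r < T) (k : ℕ) :
    expShift T n r ≠ k := by
  intro h
  have hT : (T : ℂ) ≠ 0 := by exact_mod_cast (by omega : T ≠ 0)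
  rw [expShift] at h
  have h2 : (r : ℂ) = (k - (delta (nbar T n) r + ⌊n⌋₊)) * T := by
    field_simp at h
    linear_combination h
  have h3 : (r : ℤ) = (k - (delta (nbar T n) r + ⌊n⌋₊)) * T := by exact_mod_cast h2
  have h4 : (T : ℤ) ∣ r := ⟨_, h3.trans (mul_comm _ _)⟩
  exact absurd (Nat.le_of_dvd hr (by exact_mod_cast h4)) (by omega)

variable {V : Type*} [AddCommGroup V] [Module ℂ V] (𝒱 : VertexAlgebra V)

/-- The subspace corresponding to `O_{g,n}` in the coordinate `log (1 + z)`. -/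
def logO (g : V ≃ₗ[ℂ] V) (T : ℕ) (n : ℚ) : Submodule ℂ V :=
  Submodule.span ℂ {x | ∃ r < T, ∃ u ∈ sector g T r, ∃ v : V, x = 𝒱.res (twistFun T n r) u v} ⊔
    LinearMap.range 𝒱.D

/-- The product corresponding to `*_{g,n}` in the coordinate `log (1 + z)`. -/
noncomputable def logStar (g : V ≃ₗ[ℂ] V) (T : ℕ) (n : ℚ) : V →ₗ[ℂ] V →ₗ[ℂ] V :=
  𝒱.res (polyY (unitPoly ⌊n⌋₊)) ∘ₗ fixedProj g T

theorem mem_sector {g : V ≃ₗ[ℂ] V} {T r : ℕ} {u : V} :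
    u ∈ sector g T r ↔ g u = Complex.exp (-2 * Real.pi * Complex.I * r / T) • u :=
  Module.End.mem_eigenspace_iff

theorem mem_sector_zero {g : V ≃ₗ[ℂ] V} {T : ℕ} {u : V} : u ∈ sector g T 0 ↔ g u = u := by
  rw [mem_sector]
  simp

section Automorphism

variable {𝒱} {g : V ≃ₗ[ℂ] V} (hg : 𝒱.IsAutomorphism g)
include hg

theorem IsAutomorphism.map_res (f : LaurentSeries ℂ) (u v : V) :
    g (𝒱.res f u v) = 𝒱.res f (g u) (g v) := by
  have : (g : V →ₗ[ℂ] V) ∘ₗ 𝒱.resMap u v = 𝒱.resMap (g u) (g v) := by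
    refine eq_of_single (comp_mem_continuousMaps (𝒱.resMap_mem _ _) _) (𝒱.resMap_mem _ _)
      fun k => ?_
    simpa using hg.map_mode u v k
  exact LinearMap.congr_fun this f

theorem IsAutomorphism.map_D (u : V) : g (𝒱.D u) = 𝒱.D (g u) := by
  change g (𝒱.mode u (-2) 𝒱.vac) = 𝒱.mode (g u) (-2) 𝒱.vac
  rw [hg.map_mode, hg.map_vac]

theorem IsAutomorphism.D_mem_sector {T r : ℕ} {u : V} (hu : u ∈ sector g T r) :
    𝒱.D u ∈ sector g T r := by
  rw [mem_sector] at hu ⊢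
  rw [hg.map_D, hu, map_smul]

theorem IsAutomorphism.mode_mem_sector {T r : ℕ} {u v : V} (hu : u ∈ sector g T 0)
    (hv : v ∈ sector g T r) (k : ℤ) : 𝒱.mode u k v ∈ sector g T r := by
  rw [mem_sector] at hv ⊢
  rw [hg.map_mode, mem_sector_zero.1 hu, hv, map_smul]

theorem IsAutomorphism.fixedProj_res {T : ℕ} (f : LaurentSeries ℂ) {u : V}
    (hu : u ∈ sector g T 0) (v : V) :
    fixedProj g T (𝒱.res f u v) = 𝒱.res f u (fixedProj g T v) := by
  have : ∀ i : ℕ, ((g : V →ₗ[ℂ] V) ^ i) (𝒱.res f u v) = 𝒱.res f u (((g : V →ₗ[ℂ] V) ^ i) v) := by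
    intro i
    induction i with
    | zero => simp
    | succ i ih =>
      rw [pow_succ', Module.End.mul_apply, ih, Module.End.mul_apply, LinearEquiv.coe_coe,
        hg.map_res, mem_sector_zero.1 hu]
  simp [fixedProj, this]

theorem IsAutomorphism.map_mem_logO {T : ℕ} {n : ℚ} {x : V} (hx : x ∈ 𝒱.logO g T n) :
    g x ∈ 𝒱.logO g T n := by
  suffices 𝒱.logO g T n ≤ (𝒱.logO g T n).comap (g : V →ₗ[ℂ] V) from this hx
  refine sup_le (Submodule.span_le.2 ?_) ?_
  · rintro _ ⟨r, hr, u, hu, v, rfl⟩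
    refine Submodule.mem_sup_left (Submodule.subset_span ⟨r, hr, g u, ?_, g v, hg.map_res _ _ _⟩)
    rw [mem_sector] at hu ⊢
    rw [hu, map_smul, hu]
  · rintro _ ⟨v, rfl⟩
    exact Submodule.mem_sup_right ⟨g v, (hg.map_D v).symm⟩

theorem IsAutomorphism.fixedProj_mem_logO {T : ℕ} {n : ℚ} {x : V} (hx : x ∈ 𝒱.logO g T n) :
    fixedProj g T x ∈ 𝒱.logO g T n := by
  have : ∀ i : ℕ, ((g : V →ₗ[ℂ] V) ^ i) x ∈ 𝒱.logO g T n := by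
    intro i
    induction i with
    | zero => exact hx
    | succ i ih =>
      rw [pow_succ', Module.End.mul_apply]
      exact hg.map_mem_logO ih
  simp only [fixedProj, LinearMap.smul_apply, LinearMap.sum_apply]
  exact Submodule.smul_mem _ _ (Submodule.sum_mem _ fun i _ => this i)

end Automorphism

theorem range_D_le_logO (g : V ≃ₗ[ℂ] V) (T : ℕ) (n : ℚ) :
    LinearMap.range 𝒱.D ≤ 𝒱.logO g T n := le_sup_right

/-- Pairing $u$ with the vacuum gives $u$ times the residue of `twistFun`, modulo the image of
$\mathcal D$. That residue is nonzero because $r/T$ is not an integer. -/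
theorem sector_le_logO (g : V ≃ₗ[ℂ] V) {T : ℕ} (n : ℚ) {r : ℕ} (hr : 0 < r) (hrT : r < T) :
    sector g T r ≤ 𝒱.logO g T n := by
  intro u hu
  have h1 : 𝒱.res (twistFun T n r) u 𝒱.vac ∈ 𝒱.logO g T n :=
    Submodule.mem_sup_left (Submodule.subset_span ⟨r, hrT, u, hu, _, rfl⟩)
  have h2 := sub_mem h1 (𝒱.range_D_le_logO g T n (𝒱.res_vac_right (twistFun T n r) u))
  rw [sub_sub_cancel] at h2
  exact (Submodule.smul_mem_iff _
    (coeff_expL_mul_pow_ne_zero (expShift_ne_natCast n hr hrT) _)).1 h2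

section FiniteOrder

variable {g : V ≃ₗ[ℂ] V} {T : ℕ}

theorem coe_pow_eq_one (hgT : g ^ T = 1) : (g : V →ₗ[ℂ] V) ^ T = 1 := by
  have : ∀ i : ℕ, ((g ^ i : V ≃ₗ[ℂ] V) : V →ₗ[ℂ] V) = (g : V →ₗ[ℂ] V) ^ i := by
    intro i
    induction i with
    | zero => rfl
    | succ i ih => rw [pow_succ, pow_succ, ← ih]; rfl
  rw [← this, hgT]
  rfl

theorem fixedProj_mem_sector_zero (hgT : g ^ T = 1) (u : V) : fixedProj g T u ∈ sector g T 0 := by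
  rw [mem_sector_zero, ← sub_eq_zero]
  have h2 := LinearMap.congr_fun (mul_geom_sum (g : V →ₗ[ℂ] V) T) u
  rw [coe_pow_eq_one hgT, sub_self] at h2
  simp only [fixedProj, LinearMap.smul_apply, map_smul]
  rw [← smul_sub]
  have h3 : g ((∑ i ∈ Finset.range T, (g : V →ₗ[ℂ] V) ^ i) u) -
    (∑ i ∈ Finset.range T, (g : V →ₗ[ℂ] V) ^ i) u = 0 := h2
  rw [h3, smul_zero]

/-- Discrete Fourier inversion: $\sum_{i<T}(\xi^rg)^iu$ lies in $V^r$, and the average of these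
vectors over $r$ has sum $u$. -/
theorem iSup_sector_eq_top (hT : 0 < T) (hgT : g ^ T = 1) :
    ⨆ r ∈ Finset.range T, sector g T r = ⊤ := by
  have hT' : (T : ℂ) ≠ 0 := by exact_mod_cast hT.ne'
  set ξ : ℂ := Complex.exp (2 * Real.pi * Complex.I / T) with hξ
  have hprim : IsPrimitiveRoot ξ T := Complex.isPrimitiveRoot_exp T hT.ne'
  have hsec : ∀ r : ℕ, Complex.exp (-2 * Real.pi * Complex.I * r / T) = (ξ ^ r)⁻¹ := by
    intro r
    rw [hξ, ← Complex.exp_nat_mul, ← Complex.exp_neg]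
    congr 1
    ring
  have hpow := coe_pow_eq_one hgT
  rw [eq_top_iff]
  intro u _
  have hmem : ∀ r : ℕ, (∑ i ∈ Finset.range T, (ξ ^ r • (g : V →ₗ[ℂ] V)) ^ i) u ∈ sector g T r := by
    intro r
    have h2 := LinearMap.congr_fun (mul_geom_sum (ξ ^ r • (g : V →ₗ[ℂ] V)) T) u
    rw [_root_.smul_pow, ← pow_mul, mul_comm r T, pow_mul, hprim.pow_eq_one, one_pow, one_smul,
      hpow,
      sub_self] at h2
    have h3 : ξ ^ r • g ((∑ i ∈ Finset.range T, (ξ ^ r • (g : V →ₗ[ℂ] V)) ^ i) u) -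
      (∑ i ∈ Finset.range T, (ξ ^ r • (g : V →ₗ[ℂ] V)) ^ i) u = 0 := h2
    rw [mem_sector, hsec, eq_inv_smul_iff₀ (pow_ne_zero _ (Complex.exp_ne_zero _))]
    exact sub_eq_zero.1 h3
  have hsum : (T : ℂ)⁻¹ • ∑ r ∈ Finset.range T,
      (∑ i ∈ Finset.range T, (ξ ^ r • (g : V →ₗ[ℂ] V)) ^ i) u = u := by
    simp only [LinearMap.sum_apply, _root_.smul_pow, LinearMap.smul_apply]
    rw [Finset.sum_comm]
    simp only [← Finset.sum_smul]
    rw [Finset.sum_eq_single 0]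
    · simp [smul_smul, hT']
    · intro i hi hi0
      have h1 : ξ ^ i ≠ 1 := hprim.pow_ne_one_of_pos_of_lt hi0 (Finset.mem_range.1 hi)
      have h2 : ∑ r ∈ Finset.range T, (ξ ^ r) ^ i = 0 := by
        simp only [← pow_mul, mul_comm _ i]
        simp only [pow_mul]
        rw [geom_sum_eq h1, ← pow_mul, mul_comm, pow_mul, hprim.pow_eq_one, one_pow, sub_self,
          zero_div]
      rw [h2, zero_smul]
    · intro h
      exact (h (Finset.mem_range.2 hT)).elim
  rw [← hsum]
  exact Submodule.smul_mem _ _ (Submodule.sum_mem _ fun r hr =>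
    Submodule.mem_iSup_of_mem r (Submodule.mem_iSup_of_mem hr (hmem r)))

theorem sub_fixedProj_mem {g : V ≃ₗ[ℂ] V} {T : ℕ} (n : ℚ) (hT : 0 < T) (hgT : g ^ T = 1) (u : V) :
    u - fixedProj g T u ∈ 𝒱.logO g T n := by
  suffices h : ⨆ r ∈ Finset.range T, sector g T r ≤
      (𝒱.logO g T n).comap (LinearMap.id - fixedProj g T) from
    h (iSup_sector_eq_top hT hgT ▸ Submodule.mem_top)
  refine iSup₂_le fun r hr u hu => ?_
  rw [Finset.mem_range] at hr
  rw [Submodule.mem_comap, LinearMap.sub_apply, LinearMap.id_apply, fixedProj_of_mem_sector hr hu]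
  split_ifs with h
  · rw [sub_self]
    exact zero_mem _
  · rw [sub_zero]
    exact 𝒱.sector_le_logO g n (Nat.pos_of_ne_zero h) hr hu

end FiniteOrder

section LogAlgebra

variable {𝒱} {g : V ≃ₗ[ℂ] V} {T : ℕ} (n : ℚ) (hg : 𝒱.IsAutomorphism g)
include hg

/-- Replacing $u$ by $\mathcal Du$ differentiates the series, and the derivative contains the next
power of $1/(e^z-1)$ with nonzero coefficient. Pole orders can therefore be raised inside `logO`. -/
theorem IsAutomorphism.res_expL_mul_pow_mem {r : ℕ} (hr : r < T) (j : ℕ) {u : V}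
    (hu : u ∈ sector g T r) (v : V) :
    𝒱.res (expL (expShift T n r) * invExpSubOne ^ (poleOrder T n r + 1 + j)) u v ∈
      𝒱.logO g T n := by
  induction j generalizing u with
  | zero => exact Submodule.mem_sup_left (Submodule.subset_span ⟨r, hr, u, hu, v, rfl⟩)
  | succ j ih =>
    have h1 := ih (hg.D_mem_sector hu)
    rw [res_D_left, derivative_expL_mul_pow, res_sub, res_smul, res_smul] at h1
    have h2 := add_mem h1 (Submodule.smul_mem _ (expShift T n r - (poleOrder T n r + 1 + j : ℕ))
      (ih hu))
    rw [neg_sub, sub_add_cancel] at h2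
    exact (Submodule.smul_mem_iff _ (by exact_mod_cast (by omega))).1 h2

theorem IsAutomorphism.res_twistFun_mul_mem {r : ℕ} (hr : r < T) (q : ℂ[X]) {u : V}
    (hu : u ∈ sector g T r) (v : V) :
    𝒱.res (twistFun T n r * polyY q) u v ∈ 𝒱.logO g T n := by
  induction q using Polynomial.induction_on' with
  | add p q hp hq => rw [map_add, mul_add, res_add]; exact add_mem hp hq
  | monomial k c =>
    rw [← C_mul_X_pow_eq_monomial, map_mul, polyY_C, map_pow, polyY_X, mul_left_comm,
      HahnSeries.C_mul_eq_smul, res_smul, twistFun, mul_assoc, ← pow_add]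
    exact Submodule.smul_mem _ _ (hg.res_expL_mul_pow_mem n hr k hu v)

theorem IsAutomorphism.res_mem_of_mem_idealY (hT : 0 < T) {f : LaurentSeries ℂ}
    (hf : f ∈ idealY (⌊n⌋₊ + 1)) {u : V} (hu : u ∈ sector g T 0) (v : V) :
    𝒱.res f u v ∈ 𝒱.logO g T n := by
  obtain ⟨_, ⟨q, rfl⟩, rfl⟩ := hf
  rw [map_mul, ← twistFun_zero hT]
  exact hg.res_twistFun_mul_mem n hT q hu v

/-- For a generator of twist type the commutator formula suffices: the correction terms are
multiples of `twistFun` by polynomials in $y$. For $\mathcal Db$ integration by parts produces the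
derivative of $q(y)$, whence the hypothesis on it. -/
theorem IsAutomorphism.res_polyY_mem (hT : 0 < T) {q : ℂ[X]}
    (hq : derivative ℂ (polyY q) ∈ idealY (⌊n⌋₊ + 1)) {u : V} (hu : u ∈ sector g T 0) {x : V}
    (hx : x ∈ 𝒱.logO g T n) : 𝒱.res (polyY q) u x ∈ 𝒱.logO g T n := by
  suffices 𝒱.logO g T n ≤ (𝒱.logO g T n).comap (𝒱.res (polyY q) u) from this hx
  refine sup_le (Submodule.span_le.2 ?_) ?_
  · rintro _ ⟨r, hr, a, ha, b, rfl⟩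
    change 𝒱.res (polyY q) u (𝒱.res (twistFun T n r) a b) ∈ 𝒱.logO g T n
    obtain ⟨N, hN⟩ := 𝒱.exists_mode_eq_zero u a
    have h := 𝒱.res_comm (I := N.toNat) (fun i hi => hN i (by omega)) (polyY q) (twistFun T n r) b
    rw [sub_eq_iff_eq_add] at h
    rw [h]
    refine add_mem (Submodule.sum_mem _ fun i _ => ?_)
      (Submodule.mem_sup_left (Submodule.subset_span ⟨r, hr, a, ha, _, rfl⟩))
    -- `idealY 0` is the space of all polynomials in $y$, so Hasse derivatives of $q(y)$ are again
    -- polynomials in $y$.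
    have h0 : ∀ f ∈ idealY 0, derivative ℂ f ∈ idealY 0 := fun f hf => derivative_mem_idealY hf
    obtain ⟨p, _, hp⟩ := hasseDeriv_mem h0 i (polyY_mem_idealY (q := q) (by simp))
    rw [hp]
    exact hg.res_twistFun_mul_mem n hr p (hg.mode_mem_sector hu ha i) b
  · rintro _ ⟨b, rfl⟩
    change 𝒱.res (polyY q) u (𝒱.D b) ∈ 𝒱.logO g T n
    have h := 𝒱.D_res (polyY q) u b
    rw [res_D_left, ← sub_eq_iff_eq_add, sub_neg_eq_add] at h
    rw [← h]
    exact add_mem (𝒱.range_D_le_logO g T n ⟨_, rfl⟩) (hg.res_mem_of_mem_idealY n hT hq hu b)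

/-- In the iterate formula the terms with $i\ge1$ contain a derivative of $H$, hence lie in `logO`.
For $i=0$ the first sum is $u*(v*w)$ and the second contains $H(-1-y)H(y)$, which is in the ideal.
-/
theorem IsAutomorphism.res_assoc_mem (hT : 0 < T) {u v : V} (hu : u ∈ sector g T 0)
    (hv : v ∈ sector g T 0) (w : V) :
    𝒱.res (polyY (unitPoly ⌊n⌋₊)) (𝒱.res (polyY (unitPoly ⌊n⌋₊)) u v) w -
      𝒱.res (polyY (unitPoly ⌊n⌋₊)) u (𝒱.res (polyY (unitPoly ⌊n⌋₊)) v w) ∈ 𝒱.logO g T n := by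
  set h := polyY (unitPoly ⌊n⌋₊) with hdef
  obtain ⟨A, hA⟩ := exists_mem_filtration h
  obtain ⟨N, hN⟩ := 𝒱.exists_mode_eq_zero u w
  obtain ⟨M, hM⟩ := 𝒱.exists_mode_eq_zero v w
  have key := 𝒱.res_assoc (u := u) (v := v) (w := w) (I := N.natAbs + M.natAbs + A.natAbs + 1)
    (fun i hi => hN i (by omega)) (fun k hk => hM k (by omega)) h hA
  have hd : ∀ i, hasseDeriv ℂ (i + 1) h ∈ idealY (⌊n⌋₊ + 1) :=
    hasseDeriv_succ_mem_idealY (derivative_polyY_mem_idealY (c := 1) (d := 0)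
      (by simpa using X_pow_dvd_unitPoly_sub_one ⌊n⌋₊)
      (by simpa using one_add_X_pow_dvd_unitPoly ⌊n⌋₊))
  rw [key, Finset.sum_range_succ', Finset.sum_range_succ']
  simp only [pow_zero, one_smul, LaurentSeries.hasseDeriv_zero, LinearMap.id_apply, Nat.cast_zero,
    HahnSeries.single_zero_one, one_mul]
  rw [add_sub_assoc, add_sub_assoc, sub_right_comm, sub_self, zero_sub]
  refine add_mem (Submodule.sum_mem _ fun i _ => Submodule.smul_mem _ _ ?_) (neg_mem (add_mem
    (Submodule.sum_mem _ fun i _ => ?_) ?_))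
  · exact hg.res_mem_of_mem_idealY n hT (hd i) hu _
  · exact hg.res_mem_of_mem_idealY n hT (mul_mem_idealY (flip_mem_idealY (hd i)) _) hv _
  · exact hg.res_mem_of_mem_idealY n hT (flip_mul_unitPoly_mem _) hv _

theorem IsAutomorphism.inducesAlgebra_log (hT : 0 < T) (hgT : g ^ T = 1) :
    InducesAlgebra (𝒱.logO g T n) (𝒱.logStar g T n) 𝒱.vac := by
  have hH : derivative ℂ (polyY (unitPoly ⌊n⌋₊)) ∈ idealY (⌊n⌋₊ + 1) :=
    derivative_polyY_mem_idealY (c := 1) (d := 0)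
      (by simpa using X_pow_dvd_unitPoly_sub_one ⌊n⌋₊)
      (by simpa using one_add_X_pow_dvd_unitPoly ⌊n⌋₊)
  have hH' : derivative ℂ (polyY ((unitPoly ⌊n⌋₊).comp (-1 - X))) ∈ idealY (⌊n⌋₊ + 1) :=
    derivative_polyY_mem_idealY (c := 0) (d := 1)
      (by simpa using X_pow_dvd_unitPoly_comp ⌊n⌋₊)
      (by simpa using one_add_X_pow_dvd_unitPoly_comp ⌊n⌋₊)
  have hfix : ∀ u, u ∈ sector g T 0 → fixedProj g T u = u := fun u hu => by
    rw [fixedProj_of_mem_sector hT hu, if_pos rfl]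
  have hvac : 𝒱.vac ∈ sector g T 0 := mem_sector_zero.2 hg.map_vac
  have hstar : ∀ u v, 𝒱.logStar g T n u v =
    𝒱.res (polyY (unitPoly ⌊n⌋₊)) (fixedProj g T u) v := fun _ _ => rfl
  refine ⟨fun a ha v => ?_, fun u v hv => ?_, fun u v w => ?_, fun u => ?_, fun u => ?_⟩
  · have ha' := hg.fixedProj_mem_logO ha
    have ha0 := fixedProj_mem_sector_zero hgT a
    rw [hstar]
    set b := fixedProj g T a
    -- Modulo `logO` the second argument may be replaced by its $g$-fixed part. Skew symmetry then
    -- moves $b\in$ `logO` to the right, where `res_polyY_mem` applies to the reflected idempotent.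
    have h1 := 𝒱.sub_fixedProj_mem n hT hgT (𝒱.res (polyY (unitPoly ⌊n⌋₊)) b v)
    rw [hg.fixedProj_res _ ha0] at h1
    refine (Submodule.sub_mem_iff_left _ ?_).1 h1
    have h2 := 𝒱.range_D_le_logO g T n
      (𝒱.res_skew (polyY (unitPoly ⌊n⌋₊)) b (fixedProj g T v))
    refine (Submodule.add_mem_iff_left _ ?_).1 h2
    rw [flip_polyY]
    exact hg.res_polyY_mem n hT hH' (fixedProj_mem_sector_zero hgT v) ha'
  · exact hg.res_polyY_mem n hT hH (fixedProj_mem_sector_zero hgT u) hv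
  · simp only [hstar]
    have hu := fixedProj_mem_sector_zero hgT u
    rw [hg.fixedProj_res _ hu]
    exact hg.res_assoc_mem n hT hu (fixedProj_mem_sector_zero hgT v) w
  · rw [hstar, hfix _ hvac, res_vac_left, coeff_unitPoly, one_smul, sub_self]
    exact zero_mem _
  · rw [hstar]
    have h1 := 𝒱.range_D_le_logO g T n
      (𝒱.res_vac_right (polyY (unitPoly ⌊n⌋₊)) (fixedProj g T u))
    rw [coeff_unitPoly, one_smul] at h1
    have h2 := sub_mem h1 (𝒱.sub_fixedProj_mem n hT hgT u)
    rwa [sub_sub_sub_cancel_right] at h2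

end LogAlgebra

end VertexAlgebra

/-! ### The power series of the coordinate change $\log(1+z)$ and their differential equations. -/

namespace PowerSeries

/-- The coefficients of `((1 + z) log (1 + z) - z) / z`. -/
noncomputable def flowCoeff (j : ℕ) : ℂ := (-1) ^ (j + 1) / (j * (j + 1))

-- Division by zero gives the correct constant coefficient: $((1+z)\log(1+z)-z)/z$ vanishes at
-- $z=0$. Sums over all $j\ge0$ thus involve only $L(j)$ with $j\ge1$.
@[simp]
theorem flowCoeff_zero : flowCoeff 0 = 0 := by simp [flowCoeff]

/-- The series `log (1 + z) / z`. -/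
noncomputable def logDiv : PowerSeries ℂ := PowerSeries.mk fun n => (-1) ^ n / (n + 1)

theorem constantCoeff_logDiv : constantCoeff logDiv = 1 := by
  rw [← coeff_zero_eq_constantCoeff_apply]
  simp [logDiv]

theorem logDiv_mul_inv : logDiv * logDiv⁻¹ = 1 :=
  PowerSeries.mul_inv_cancel _ (by rw [constantCoeff_logDiv]; exact one_ne_zero)

/-- `log (1 + z) / z` as a unit. -/
noncomputable def logUnit : (PowerSeries ℂ)ˣ :=
  ⟨logDiv, logDiv⁻¹, logDiv_mul_inv, by rw [mul_comm, logDiv_mul_inv]⟩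

theorem one_add_X_mul_derivative : (1 + X) * derivative ℂ (X * logDiv) = 1 := by
  have h : derivative ℂ (X * logDiv) = PowerSeries.mk fun n => (-1 : ℂ) ^ n := by
    ext n
    rw [coeff_derivative, coeff_succ_X_mul, logDiv, coeff_mk, coeff_mk]
    have : (n : ℂ) + 1 ≠ 0 := by exact_mod_cast n.succ_ne_zero
    field_simp
  rw [h]
  ext n
  rcases n with _ | n
  · simp [add_mul]
  · rw [add_mul, one_mul, map_add, coeff_succ_X_mul]
    simp [pow_succ, coeff_one]

theorem mk_flowCoeff : PowerSeries.mk flowCoeff = (1 + X) * logDiv - 1 := by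
  ext n
  rw [add_mul, one_mul, map_sub, map_add, coeff_mk, coeff_one]
  rcases n with _ | n
  · simp [logDiv]
  · rw [coeff_succ_X_mul, logDiv, coeff_mk, coeff_mk, if_neg n.succ_ne_zero, flowCoeff]
    have h1 : (n : ℂ) + 1 ≠ 0 := by exact_mod_cast n.succ_ne_zero
    have h2 : (n : ℂ) + 1 + 1 ≠ 0 := by exact_mod_cast (n + 1).succ_ne_zero
    push_cast
    field_simp
    ring

theorem derivative_X_mul_flowCoeff : derivative ℂ (X * PowerSeries.mk flowCoeff) = X * logDiv := by
  ext n
  rw [coeff_derivative, coeff_succ_X_mul, coeff_mk]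
  rcases n with _ | n
  · simp
  · rw [coeff_succ_X_mul, logDiv, coeff_mk, flowCoeff]
    have h1 : (n : ℂ) + 1 ≠ 0 := by exact_mod_cast n.succ_ne_zero
    have h2 : (n : ℂ) + 1 + 1 ≠ 0 := by exact_mod_cast (n + 1).succ_ne_zero
    push_cast
    field_simp
    ring

theorem logDiv_mul_derivative_zpow (k : ℤ) :
    logDiv * derivative ℂ ((logUnit ^ k : (PowerSeries ℂ)ˣ) : PowerSeries ℂ) =
      (k : PowerSeries ℂ) * derivative ℂ logDiv *
        ((logUnit ^ k : (PowerSeries ℂ)ˣ) : PowerSeries ℂ) := by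
  have hval : (logUnit : PowerSeries ℂ) = logDiv := rfl
  have hne : logDiv ≠ 0 := logUnit.ne_zero
  induction k with
  | zero => simp
  | succ k ih =>
    rw [zpow_add_one, Units.val_mul, hval, Derivation.leibniz]
    simp only [smul_eq_mul]
    push_cast at ih ⊢
    linear_combination logDiv * ih
  | pred k ih =>
    have h : ((logUnit ^ (-(k : ℤ)) : (PowerSeries ℂ)ˣ) : PowerSeries ℂ) =
        ((logUnit ^ (-(k : ℤ) - 1) : (PowerSeries ℂ)ˣ) : PowerSeries ℂ) * logDiv := by
      rw [← hval, ← Units.val_mul, ← zpow_add_one, sub_add_cancel]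
    rw [h, Derivation.leibniz] at ih
    simp only [smul_eq_mul] at ih
    refine mul_left_cancel₀ hne ?_
    push_cast at ih ⊢
    linear_combination ih

theorem one_add_X_mul_derivative_binomialSeries (a : ℂ) :
    (1 + X) * derivative ℂ (binomialSeries ℂ a) = a • binomialSeries ℂ a := by
  have h : ∀ m : ℕ, Ring.choose a (m + 1) * ((m : ℂ) + 1) = (a - m) * Ring.choose a m := by
    intro m
    have := Ring.choose_smul_choose a (Nat.le_succ m)
    rw [Nat.choose_succ_self_right, Nat.succ_eq_add_one, Nat.add_sub_cancel_left,
      Ring.choose_one_right, nsmul_eq_mul] at this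
    push_cast at this
    linear_combination this
  ext n
  rw [add_mul, one_mul, map_add, coeff_derivative, map_smul, binomialSeries_coeff,
    binomialSeries_coeff, smul_eq_mul, smul_eq_mul, smul_eq_mul, mul_one, mul_one, h]
  rcases n with _ | n
  · simp
  · rw [coeff_succ_X_mul, coeff_derivative, binomialSeries_coeff, smul_eq_mul, mul_one]
    push_cast
    ring

/-- The series `(log (1 + z) / z)ᵏ (1 + z)^(ν - 1)`. -/
noncomputable def coordSeries (k : ℤ) (ν : ℂ) : PowerSeries ℂ :=
  ((logUnit ^ k : (PowerSeries ℂ)ˣ) : PowerSeries ℂ) * binomialSeries ℂ (ν - 1)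

/-- This is the equation for $t\,\partial_t$ of the family obtained by replacing $z$ with $tz$. The
terms on the right match the parts of $[L(j),w_n]$ that involve $L(0)w$ and $L(-1)w$ in
`sum_flowCoeff_comm`. -/
theorem coordSeries_ode (k : ℤ) (ν : ℂ) :
    X * derivative ℂ (coordSeries k ν) =
      C ν * (derivative ℂ (X * PowerSeries.mk flowCoeff) * coordSeries k ν)
      - ((k : PowerSeries ℂ) + 1) * (PowerSeries.mk flowCoeff * coordSeries k ν)
      - X * derivative ℂ (PowerSeries.mk flowCoeff * coordSeries k ν) := by
  have h1 := logDiv_mul_derivative_zpow k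
  have h2 := one_add_X_mul_derivative_binomialSeries (ν - 1)
  have h3 := one_add_X_mul_derivative
  have h4 := mk_flowCoeff
  have h5 := derivative_X_mul_flowCoeff
  rw [coordSeries]
  set A := ((logUnit ^ k : (PowerSeries ℂ)ˣ) : PowerSeries ℂ)
  set B := binomialSeries ℂ (ν - 1)
  set c := PowerSeries.mk flowCoeff
  rw [PowerSeries.smul_eq_C_mul, map_sub, map_one] at h2
  simp only [Derivation.leibniz, smul_eq_mul, derivative_X, mul_one] at h3 h5 ⊢
  linear_combination X * (A * derivative ℂ B + B * derivative ℂ A) * h4 + X * logDiv * A * h2 +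
    X * (1 + X) * B * h1 + A * B * h5 + (k : PowerSeries ℂ) * A * B * (h3 + h4)
      - C ν * A * B * h5

theorem coeff_coordSeries_ode (k : ℤ) (ν : ℂ) (s : ℕ) :
    ∑ x ∈ Finset.HasAntidiagonal.antidiagonal s, flowCoeff x.1 * coeff x.2 (coordSeries k ν) *
      (-(k + s + 1) + (x.1 + 1) * ν) = s * coeff s (coordSeries k ν) := by
  have h := congrArg (coeff s) (coordSeries_ode k ν)
  have hX : ∀ F : PowerSeries ℂ, coeff s (X * derivative ℂ F) = s * coeff s F := by
    intro F
    rcases s with _ | s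
    · simp
    · rw [coeff_succ_X_mul, coeff_derivative]
      push_cast
      ring
  have hk : ((k : PowerSeries ℂ) + 1) = C ((k : ℂ) + 1) := by simp
  rw [map_sub, map_sub, hX, hX, hk, coeff_C_mul, coeff_C_mul, coeff_mul, coeff_mul] at h
  rw [h, Finset.mul_sum, Finset.mul_sum, Finset.mul_sum, ← Finset.sum_sub_distrib,
    ← Finset.sum_sub_distrib]
  refine Finset.sum_congr rfl fun x _ => ?_
  rw [coeff_derivative, coeff_succ_X_mul, coeff_mk]
  ring

/-- For $v(z)=(1+z)\log(1+z)-z$ one has $v''=1/(1+z)$, so for $i\ge1$ the $(i+1)$-st Hasse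
derivative of $v$ is $c_i(1+z)^{-i}$, with $c_i$ = `flowCoeff i`. The factor $(1+z)^{-i}$ lowers
$\nu$ by $i$. For $i=0$ the derivative is a logarithm, which `coordSeries_ode` handles. -/
theorem coeff_coordSeries_sub (k : ℤ) (ν : ℂ) {i : ℕ} (hi : 1 ≤ i) (r : ℕ) :
    ∑ x ∈ Finset.HasAntidiagonal.antidiagonal r,
      flowCoeff (i + x.1) * ((i + x.1 + 1).choose (i + 1) : ℂ) *
      coeff x.2 (coordSeries k ν) = flowCoeff i * coeff r (coordSeries k (ν - i)) := by
  have h : coordSeries k (ν - i) = binomialSeries ℂ (-(i : ℂ)) * coordSeries k ν := by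
    rw [coordSeries, coordSeries, mul_left_comm, ← binomialSeries_add]
    congr 2
    ring
  rw [h, coeff_mul, Finset.mul_sum]
  refine Finset.sum_congr rfl fun x _ => ?_
  rw [← mul_assoc]
  congr 1
  obtain ⟨i, rfl⟩ : ∃ l, i = l + 1 := ⟨i - 1, by omega⟩
  set j := x.1
  have h1 : Ring.choose (-((i + 1 : ℕ) : ℂ)) j = (-1) ^ j * ((i + j).choose i : ℂ) := by
    rw [Ring.choose_neg, show ((i + 1 : ℕ) : ℂ) + j - 1 = ((i + j : ℕ) : ℂ) by push_cast; ring,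
      Ring.choose_natCast, Nat.choose_symm_add, Units.smul_def, zsmul_eq_mul,
      Int.cast_negOnePow_natCast]
  rw [binomialSeries_coeff, h1, smul_eq_mul, mul_one, flowCoeff, flowCoeff]
  have h2 := Nat.add_one_mul_choose_eq (i + 1 + j) (i + 1)
  have h3 := Nat.add_one_mul_choose_eq (i + j) i
  have h2' : ((i : ℂ) + 1 + j + 1) * ((i + j + 1).choose (i + 1) : ℂ) =
      ((i + 1 + j + 1).choose (i + 1 + 1) : ℂ) * (i + 1 + 1) := by
    rw [show i + j + 1 = i + 1 + j by ring]
    exact_mod_cast h2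
  have h3' : ((i : ℂ) + j + 1) * ((i + j).choose i : ℂ) =
      ((i + j + 1).choose (i + 1) : ℂ) * (i + 1) := by exact_mod_cast h3
  have n1 : (i : ℂ) + 1 ≠ 0 := by exact_mod_cast i.succ_ne_zero
  have n2 : (i : ℂ) + 1 + 1 ≠ 0 := by exact_mod_cast (i + 1).succ_ne_zero
  have n3 : (i : ℂ) + 1 + j ≠ 0 := by exact_mod_cast (by omega : i + 1 + j ≠ 0)
  have n4 : (i : ℂ) + 1 + j + 1 ≠ 0 := by exact_mod_cast (by omega : i + 1 + j + 1 ≠ 0)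
  push_cast
  rw [show (-1 : ℂ) ^ (i + 1 + j + 1) = (-1) ^ (i + 1 + 1) * (-1) ^ j by ring]
  field_simp
  linear_combination (-((i : ℂ) + 1)) * h2' - ((i : ℂ) + 1 + j + 1) * h3'

end PowerSeries

/-! ### The operator of the coordinate change on $V$. -/

namespace VertexAlgebra

open PowerSeries (flowCoeff flowCoeff_zero)

variable {V : Type*} [AddCommGroup V] [Module ℂ V] (𝒱 : VertexAlgebra V)

/-- The component of degree `-m` of the coordinate change `z ↦ log (1 + z)`, acting on `V` through
the operators `L(j)` with `j ≥ 1`. -/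
noncomputable def coordPart (ω : V) : ℕ → Module.End ℂ V
  | 0 => 1
  | m + 1 => ((m : ℂ) + 1)⁻¹ • ∑ j : Fin (m + 1),
      flowCoeff (j + 1) • (𝒱.L ω (j + 1 : ℕ) * coordPart ω (m - j))

theorem coordPart_zero (ω : V) : 𝒱.coordPart ω 0 = 1 := by rw [coordPart]

/-- The flow equation $t\,\partial_tU_t=C_tU_t$ in degree $m$; this recursion drives every induction
on `coordPart`. -/
theorem smul_coordPart (ω : V) (m : ℕ) : (m : ℂ) • 𝒱.coordPart ω m =
    ∑ x ∈ Finset.HasAntidiagonal.antidiagonal m,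
      flowCoeff x.1 • (𝒱.L ω x.1 * 𝒱.coordPart ω x.2) := by
  rcases m with _ | m
  · simp
  · have hm : (m : ℂ) + 1 ≠ 0 := by exact_mod_cast m.succ_ne_zero
    rw [coordPart, Nat.cast_succ, smul_inv_smul₀ hm, Finset.Nat.sum_antidiagonal_succ,
      flowCoeff_zero, zero_smul, zero_add, Finset.Nat.sum_antidiagonal_eq_sum_range_succ_mk,
      Finset.sum_range]

variable {𝒱} {ω : V}

theorem mem_weightSpace {μ : ℂ} {v : V} : v ∈ 𝒱.weightSpace ω μ ↔ 𝒱.L ω 0 v = μ • v :=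
  Module.End.mem_eigenspace_iff

section Conformal

variable (hω : 𝒱.IsConformalVector ω)
include hω

theorem IsConformalVector.L_mem_weightSpace {μ : ℂ} {v : V} (hv : v ∈ 𝒱.weightSpace ω μ) (j : ℤ) :
    𝒱.L ω j v ∈ 𝒱.weightSpace ω (μ - j) := by
  obtain ⟨c, hc⟩ := hω.virasoro
  have h := LinearMap.congr_fun (hc 0 j) v
  simp only [LinearMap.sub_apply, Module.End.mul_apply, mem_weightSpace.1 hv, map_smul,
    LinearMap.add_apply, LinearMap.smul_apply, zero_add, Int.cast_zero] at h
  rw [mem_weightSpace, sub_eq_iff_eq_add.1 h]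
  simp
  module

theorem IsConformalVector.coordPart_mem_weightSpace (m : ℕ) {μ : ℂ} {v : V}
    (hv : v ∈ 𝒱.weightSpace ω μ) : 𝒱.coordPart ω m v ∈ 𝒱.weightSpace ω (μ - m) := by
  induction m using Nat.strong_induction_on with
  | _ m ih =>
    rcases Nat.eq_zero_or_pos m with rfl | hm
    · simpa [coordPart_zero] using hv
    · have h := LinearMap.congr_fun (𝒱.smul_coordPart ω m) v
      refine (Submodule.smul_mem_iff _ (show (m : ℂ) ≠ 0 by exact_mod_cast hm.ne')).1 ?_
      rw [← LinearMap.smul_apply, h, LinearMap.sum_apply]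
      refine Submodule.sum_mem _ fun x hx => ?_
      rw [LinearMap.smul_apply, Module.End.mul_apply]
      have hx' := Finset.HasAntidiagonal.mem_antidiagonal.1 hx
      rcases Nat.eq_zero_or_pos x.1 with h0 | h0
      · rw [h0, flowCoeff_zero, zero_smul]
        exact zero_mem _
      · have h2 := hω.L_mem_weightSpace (ih x.2 (by omega)) x.1
        rw [show μ - x.2 - ((x.1 : ℤ) : ℂ) = μ - m by rw [← hx']; push_cast; ring] at h2
        exact Submodule.smul_mem _ _ h2

theorem IsConformalVector.weightSpace_induction {p : V → Prop} (v : V)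
    (mem : ∀ μ, ∀ u ∈ 𝒱.weightSpace ω μ, p u) (zero : p 0)
    (add : ∀ u w, p u → p w → p (u + w)) : p v := by
  have h : v ∈ ⨆ μ, 𝒱.weightSpace ω μ := hω.isInternal.submodule_iSup_eq_top ▸ Submodule.mem_top
  exact Submodule.iSup_induction (motive := p) _ h mem zero add

end Conformal

theorem coordPart_vac (m : ℕ) : 𝒱.coordPart ω m 𝒱.vac = if m = 0 then 𝒱.vac else 0 := by
  induction m using Nat.strong_induction_on with
  | _ m ih =>
    rcases Nat.eq_zero_or_pos m with rfl | hm
    · simp [coordPart_zero]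
    · rw [if_neg hm.ne']
      have h := LinearMap.congr_fun (𝒱.smul_coordPart ω m) 𝒱.vac
      have hm' : (m : ℂ) ≠ 0 := by exact_mod_cast hm.ne'
      rw [LinearMap.smul_apply, LinearMap.sum_apply, Finset.sum_eq_zero] at h
      · exact (smul_eq_zero.1 h).resolve_left hm'
      · intro x hx
        have hx' := Finset.HasAntidiagonal.mem_antidiagonal.1 hx
        rw [LinearMap.smul_apply, Module.End.mul_apply]
        rcases Nat.eq_zero_or_pos x.1 with h0 | h0
        · rw [h0, flowCoeff_zero, zero_smul]
        · rw [ih x.2 (by omega)]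
          split_ifs
          · rw [L, 𝒱.mode_vac_of_nonneg ω (by omega), smul_zero]
          · rw [map_zero, smul_zero]

theorem IsAutomorphism.map_coordPart {g : V ≃ₗ[ℂ] V} (hg : 𝒱.IsAutomorphism g) (hgω : g ω = ω)
    (m : ℕ) (v : V) : g (𝒱.coordPart ω m v) = 𝒱.coordPart ω m (g v) := by
  induction m using Nat.strong_induction_on with
  | _ m ih =>
    rcases Nat.eq_zero_or_pos m with rfl | hm
    · simp [coordPart_zero]
    · have hm' : (m : ℂ) ≠ 0 := by exact_mod_cast hm.ne'
      refine smul_right_injective V hm' ?_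
      change (m : ℂ) • g (𝒱.coordPart ω m v) = (m : ℂ) • 𝒱.coordPart ω m (g v)
      rw [← map_smul, ← LinearMap.smul_apply, ← LinearMap.smul_apply, smul_coordPart,
        LinearMap.sum_apply, LinearMap.sum_apply, map_sum]
      refine Finset.sum_congr rfl fun x hx => ?_
      have hx' := Finset.HasAntidiagonal.mem_antidiagonal.1 hx
      rw [LinearMap.smul_apply, Module.End.mul_apply, LinearMap.smul_apply, Module.End.mul_apply,
        map_smul]
      rcases Nat.eq_zero_or_pos x.1 with h0 | h0
      · rw [h0, flowCoeff_zero, zero_smul, zero_smul]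
      · rw [L, hg.map_mode, hgω, ih x.2 (by omega)]

section VOA

variable (hω : 𝒱.IsVertexOperatorAlgebra ω)
include hω

theorem IsVertexOperatorAlgebra.exists_coordPart_eq_zero (v : V) :
    ∃ M : ℕ, ∀ m, M ≤ m → 𝒱.coordPart ω m v = 0 := by
  induction v using hω.toIsConformalVector.weightSpace_induction with
  | mem μ u hu =>
    by_cases h : 𝒱.weightSpace ω μ = ⊥
    · rw [h, Submodule.mem_bot] at hu
      exact ⟨0, fun m _ => by rw [hu, map_zero]⟩
    · obtain ⟨k, rfl⟩ := hω.integral μ h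
      obtain ⟨K, hK⟩ := hω.bounded_below
      refine ⟨(k - K).toNat + 1, fun m hm => ?_⟩
      have h1 := hω.toIsConformalVector.coordPart_mem_weightSpace m hu
      rw [show (k : ℂ) - m = ((k - m : ℤ) : ℂ) by push_cast; rfl, hK _ (by omega)] at h1
      exact (Submodule.mem_bot ℂ).1 h1
  | zero => exact ⟨0, fun m _ => map_zero _⟩
  | add u w hu hw =>
    obtain ⟨M, hM⟩ := hu
    obtain ⟨N, hN⟩ := hw
    exact ⟨max M N, fun m hm => by
      rw [map_add, hM m (le_of_max_le_left hm), hN m (le_of_max_le_right hm), add_zero]⟩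

/-- The action on `V` of the coordinate change `z ↦ log (1 + z)`. -/
noncomputable def IsVertexOperatorAlgebra.coordChange : Module.End ℂ V where
  toFun v := ∑ᶠ m, 𝒱.coordPart ω m v
  map_add' u v := by
    obtain ⟨M, hM⟩ := hω.exists_coordPart_eq_zero u
    obtain ⟨N, hN⟩ := hω.exists_coordPart_eq_zero v
    simp only [map_add]
    refine finsum_add_distrib ((Set.finite_Iio M).subset fun m hm => ?_)
      ((Set.finite_Iio N).subset fun m hm => ?_)
    · by_contra h
      exact hm (hM m (by simpa using h))
    · by_contra h
      exact hm (hN m (by simpa using h))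
  map_smul' c v := by
    simp only [map_smul, RingHom.id_apply]
    exact (smul_finsum c _).symm

theorem IsVertexOperatorAlgebra.coordChange_eq_sum {v : V} {M : ℕ}
    (hM : ∀ m, M ≤ m → 𝒱.coordPart ω m v = 0) :
    hω.coordChange v = ∑ m ∈ Finset.range M, 𝒱.coordPart ω m v :=
  finsum_eq_sum_range hM

theorem IsVertexOperatorAlgebra.coordChange_vac : hω.coordChange 𝒱.vac = 𝒱.vac := by
  rw [hω.coordChange_eq_sum (M := 1), Finset.sum_range_one, coordPart_vac, if_pos rfl]
  intro m hm
  rw [coordPart_vac, if_neg (by omega)]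

theorem IsVertexOperatorAlgebra.map_coordChange {g : V ≃ₗ[ℂ] V} (hg : 𝒱.IsAutomorphism g)
    (hgω : g ω = ω) (v : V) : g (hω.coordChange v) = hω.coordChange (g v) := by
  obtain ⟨M, hM⟩ := hω.exists_coordPart_eq_zero v
  rw [hω.coordChange_eq_sum hM, hω.coordChange_eq_sum (v := g v) (M := M), map_sum]
  · exact Finset.sum_congr rfl fun m _ => hg.map_coordPart hgω m v
  · intro m hm
    rw [← hg.map_coordPart hgω, hM m hm, map_zero]

/-- $U-1$ strictly lowers weights, which are bounded below. -/
theorem IsVertexOperatorAlgebra.exists_pow_coordChange_sub_one (v : V) :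
    ∃ p : ℕ, ((hω.coordChange - 1) ^ p) v = 0 := by
  obtain ⟨K, hK⟩ := hω.bounded_below
  set N := hω.coordChange - 1 with hN
  -- The generalized eigenspace packages the vectors killed by a power of `N` as a submodule, so
  -- that sums need no common exponent.
  have top : ∀ u, u ∈ Module.End.maxGenEigenspace N 0 ↔ ∃ p : ℕ, (N ^ p) u = 0 := by
    intro u
    simp [Module.End.mem_maxGenEigenspace]
  have key : ∀ d : ℕ, ∀ k : ℤ, k < K + d → ∀ u ∈ 𝒱.weightSpace ω k,
      u ∈ Module.End.maxGenEigenspace N 0 := by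
    intro d
    induction d with
    | zero =>
      intro k hk u hu
      rw [hK k (by simpa using hk), Submodule.mem_bot] at hu
      rw [hu]
      exact zero_mem _
    | succ d ih =>
      intro k hk u hu
      obtain ⟨M, hM⟩ := hω.exists_coordPart_eq_zero u
      have h1 : N u = ∑ m ∈ Finset.range M, 𝒱.coordPart ω (m + 1) u := by
        have := hω.coordChange_eq_sum (v := u) (M := M + 1) fun m hm => hM m (by omega)
        rw [hN, LinearMap.sub_apply, this, Finset.sum_range_succ', coordPart_zero]
        simp
      have h2 : N u ∈ Module.End.maxGenEigenspace N 0 := by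
        rw [h1]
        refine Submodule.sum_mem _ fun m _ => ih (k - (m + 1)) (by push_cast at hk; omega) _ ?_
        have := hω.toIsConformalVector.coordPart_mem_weightSpace (m + 1) hu
        rwa [show (k : ℂ) - (m + 1 : ℕ) = ((k - (m + 1) : ℤ) : ℂ) by push_cast; rfl] at this
      obtain ⟨p, hp⟩ := (top _).1 h2
      exact (top _).2 ⟨p + 1, by rw [pow_succ, Module.End.mul_apply, hp]⟩
  rw [← top]
  induction v using hω.toIsConformalVector.weightSpace_induction with
  | mem μ u hu =>
    by_cases h : 𝒱.weightSpace ω μ = ⊥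
    · rw [h, Submodule.mem_bot] at hu
      rw [hu]
      exact zero_mem _
    · obtain ⟨k, rfl⟩ := hω.integral μ h
      exact key ((k - K).toNat + 1) k (by omega) u hu
  | zero => exact zero_mem _
  | add u w hu hw => exact add_mem hu hw

theorem IsVertexOperatorAlgebra.coordChange_bijective : Function.Bijective hω.coordChange := by
  set N := hω.coordChange - 1 with hN
  have hU : hω.coordChange = 1 - -N := by rw [hN]; abel
  refine ⟨(injective_iff_map_eq_zero _).2 fun v hv => ?_, fun v => ?_⟩
  · obtain ⟨p, hp⟩ := hω.exists_pow_coordChange_sub_one v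
    have h1 : N v = -v := by rw [hN, LinearMap.sub_apply, hv]; simp
    have h2 : ∀ p : ℕ, (N ^ p) v = (-1 : ℂ) ^ p • v := by
      intro p
      induction p with
      | zero => simp
      | succ p ih => rw [pow_succ', Module.End.mul_apply, ih, map_smul, h1, pow_succ]; simp
    rw [← hN, h2] at hp
    exact (smul_eq_zero.1 hp).resolve_left (pow_ne_zero _ (by norm_num))
  · obtain ⟨p, hp⟩ := hω.exists_pow_coordChange_sub_one v
    -- The geometric series for $(1+N)^{-1}$, finite on `v`.
    refine ⟨(∑ i ∈ Finset.range p, (-N) ^ i) v, ?_⟩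
    rw [← Module.End.mul_apply, hU, mul_neg_geom_sum, LinearMap.sub_apply, neg_pow,
      Module.End.mul_apply, hp, map_zero, sub_zero, Module.End.one_apply]

/-- The coordinate change as a linear automorphism of `V`. -/
noncomputable def IsVertexOperatorAlgebra.coordEquiv : V ≃ₗ[ℂ] V :=
  LinearEquiv.ofBijective hω.coordChange hω.coordChange_bijective

end VOA

end VertexAlgebra

/-! ### Reindexing of sums over antidiagonals. -/

theorem Finset.Nat.sum_antidiagonal_assoc {M : Type*} [AddCommMonoid M] (f : ℕ → ℕ → ℕ → M)
    (n : ℕ) :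
    ∑ x ∈ Finset.HasAntidiagonal.antidiagonal n,
      ∑ y ∈ Finset.HasAntidiagonal.antidiagonal x.1, f y.1 y.2 x.2 =
    ∑ x ∈ Finset.HasAntidiagonal.antidiagonal n,
      ∑ y ∈ Finset.HasAntidiagonal.antidiagonal x.2, f x.1 y.1 y.2 := by
  rw [Finset.sum_sigma', Finset.sum_sigma']
  refine Finset.sum_nbij' (fun z => ⟨(z.2.1, z.2.2 + z.1.2), (z.2.2, z.1.2)⟩)
    (fun z => ⟨(z.1.1 + z.2.1, z.2.2), (z.1.1, z.2.1)⟩) ?_ ?_ ?_ ?_ ?_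
  all_goals
    rintro ⟨⟨a, b⟩, ⟨c, d⟩⟩ h
    simp only [Finset.mem_sigma, Finset.HasAntidiagonal.mem_antidiagonal] at h ⊢
    try simp
    try omega

theorem Finset.Nat.sum_antidiagonal_left_comm {M : Type*} [AddCommMonoid M] (f : ℕ → ℕ → ℕ → M)
    (n : ℕ) :
    ∑ x ∈ Finset.HasAntidiagonal.antidiagonal n,
      ∑ y ∈ Finset.HasAntidiagonal.antidiagonal x.2, f x.1 y.1 y.2 =
    ∑ x ∈ Finset.HasAntidiagonal.antidiagonal n,
      ∑ y ∈ Finset.HasAntidiagonal.antidiagonal x.2, f y.1 x.1 y.2 := by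
  rw [← Finset.Nat.sum_antidiagonal_assoc, ← Finset.Nat.sum_antidiagonal_assoc fun a b c => f b a c]
  refine Finset.sum_congr rfl fun x _ => ?_
  rw [← Finset.Nat.sum_antidiagonal_swap]
  rfl

theorem Finset.Nat.sum_range_sum_antidiagonal {M : Type*} [AddCommMonoid M] {f : ℕ → ℕ → M}
    {A B N : ℕ} (hN : A + B ≤ N) (hA : ∀ a b, A ≤ a → f a b = 0) (hB : ∀ a b, B ≤ b → f a b = 0) :
    ∑ n ∈ Finset.range N, ∑ x ∈ Finset.HasAntidiagonal.antidiagonal n, f x.1 x.2 =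
      ∑ a ∈ Finset.range A, ∑ b ∈ Finset.range B, f a b := by
  rw [Finset.sum_sigma', ← Finset.sum_product']
  refine Finset.sum_bij_ne_zero (fun z _ _ => z.2) ?_ ?_ ?_ ?_
  · rintro ⟨n, a, b⟩ _ h0
    rw [Finset.mem_product, Finset.mem_range, Finset.mem_range]
    exact ⟨by by_contra h; exact h0 (hA _ _ (by simpa using h)),
      by by_contra h; exact h0 (hB _ _ (by simpa using h))⟩
  · rintro ⟨n, a, b⟩ h _ ⟨n', a', b'⟩ h' _ heq
    simp only [Finset.mem_sigma, Finset.HasAntidiagonal.mem_antidiagonal, Prod.mk.injEq] at h h' heq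
    obtain ⟨rfl, rfl⟩ := heq
    obtain rfl : n = n' := by omega
    rfl
  · rintro ⟨a, b⟩ h h0
    rw [Finset.mem_product, Finset.mem_range, Finset.mem_range] at h
    refine ⟨⟨a + b, (a, b)⟩, ?_, h0, rfl⟩
    simp only [Finset.mem_sigma, Finset.HasAntidiagonal.mem_antidiagonal, Finset.mem_range]
    exact ⟨by omega, trivial⟩
  · intros
    rfl

namespace PowerSeries

theorem constantCoeff_coordSeries (k : ℤ) (ν : ℂ) : constantCoeff (coordSeries k ν) = 1 := by
  have h : Units.map (constantCoeff (R := ℂ)).toMonoidHom logUnit = 1 :=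
    Units.ext constantCoeff_logDiv
  have h2 : constantCoeff ((logUnit ^ k : (PowerSeries ℂ)ˣ) : PowerSeries ℂ) = 1 := by
    change ((Units.map (constantCoeff (R := ℂ)).toMonoidHom (logUnit ^ k) : ℂˣ) : ℂ) = 1
    rw [map_zpow, h, one_zpow, Units.val_one]
  rw [coordSeries, map_mul, h2, binomialSeries_constantCoeff, one_mul]

end PowerSeries

/-! ### How the coordinate change conjugates the modes. -/

namespace VertexAlgebra

open PowerSeries (flowCoeff flowCoeff_zero coordSeries coeff coeff_coordSeries_ode
  constantCoeff_coordSeries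
  coeff_coordSeries_sub)

open Finset.HasAntidiagonal (antidiagonal mem_antidiagonal)

variable {V : Type*} [AddCommGroup V] [Module ℂ V] {𝒱 : VertexAlgebra V} {ω : V}

/-- The commutator formula for $\omega_{j+1}$. Its $i=0$ term involves $L(-1)w=\mathcal Dw$ and
gives the multiple of $w_{n+j}$. -/
theorem IsConformalVector.L_mode_comm (hω : 𝒱.IsConformalVector ω) (j : ℕ) (w : V) (n : ℤ) :
    𝒱.L ω j * 𝒱.mode w n - 𝒱.mode w n * 𝒱.L ω j =
      (-(n + j + 1) : ℂ) • 𝒱.mode w (n + j) +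
        ∑ x ∈ antidiagonal j, ((j + 1).choose (x.1 + 1) : ℂ) •
          𝒱.mode (𝒱.L ω x.1 w) (n + x.2) := by
  ext v
  obtain ⟨N, hN⟩ := 𝒱.exists_mode_eq_zero ω w
  have h := 𝒱.mode_comm (u := ω) (v := w) (I := j + 2 + N.natAbs)
    (fun i hi => hN i (by omega)) (j + 1) n v
  have hc : ∀ i : ℕ, ((Ring.choose ((j : ℤ) + 1) i : ℤ) : ℂ) = ((j + 1).choose i : ℂ) := by
    intro i
    rw [show (j : ℤ) + 1 = ((j + 1 : ℕ) : ℤ) by push_cast; rfl, Ring.choose_natCast]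
    simp
  rw [← Finset.sum_subset (Finset.range_mono (Nat.le_add_right (j + 2) _)),
    Finset.sum_range_succ'] at h
  · rw [LinearMap.sub_apply, Module.End.mul_apply, Module.End.mul_apply, L, h, add_comm,
      LinearMap.add_apply, LinearMap.smul_apply, LinearMap.sum_apply,
      Finset.Nat.sum_antidiagonal_eq_sum_range_succ_mk]
    congr 1
    · have hD : 𝒱.mode ω (0 : ℕ) w = 𝒱.D w := by
        rw [← hω.L_neg_one]
        rfl
      rw [hD, mode_D, hc]
      simp only [Nat.choose_zero_right, Nat.cast_one, one_smul, Nat.cast_zero, sub_zero]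
      rw [show (j : ℤ) + 1 + n - 1 = n + j by ring]
      congr 1
      push_cast
      ring
    · refine Finset.sum_congr rfl fun i hi => ?_
      have hi' := Finset.mem_range.1 hi
      rw [hc, LinearMap.smul_apply, show (j : ℤ) + 1 + n - (i + 1 : ℕ) = n + (j - i : ℕ) by omega,
        L]
      rfl
  · intro i _ hi
    rw [Finset.mem_range] at hi
    rw [hc, Nat.choose_eq_zero_of_lt (by omega), Nat.cast_zero, zero_smul]

theorem IsConformalVector.sum_flowCoeff_comm (hω : 𝒱.IsConformalVector ω) {ν : ℂ} {w : V}
    (hw : w ∈ 𝒱.weightSpace ω ν) (k : ℤ) (r : ℕ) :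
    ∑ x ∈ antidiagonal r, (flowCoeff x.1 * coeff x.2 (coordSeries k ν)) •
        (𝒱.L ω x.1 * 𝒱.mode w (k + x.2) - 𝒱.mode w (k + x.2) * 𝒱.L ω x.1) =
      (r * coeff r (coordSeries k ν)) • 𝒱.mode w (k + r) +
        ∑ x ∈ antidiagonal r, (flowCoeff x.1 * coeff x.2 (coordSeries k (ν - x.1))) •
          𝒱.mode (𝒱.L ω x.1 w) (k + x.2) := by
  simp only [hω.L_mode_comm, smul_add, Finset.sum_add_distrib, Finset.smul_sum]
  have h1 : ∑ x ∈ antidiagonal r, ∑ y ∈ antidiagonal x.1,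
      (flowCoeff x.1 * coeff x.2 (coordSeries k ν)) • ((x.1 + 1).choose (y.1 + 1) : ℂ) •
        𝒱.mode (𝒱.L ω y.1 w) (k + x.2 + y.2) =
      ∑ x ∈ antidiagonal r, (∑ y ∈ antidiagonal x.2, flowCoeff (x.1 + y.1) *
        ((x.1 + y.1 + 1).choose (x.1 + 1) : ℂ) * coeff y.2 (coordSeries k ν)) •
          𝒱.mode (𝒱.L ω x.1 w) (k + x.2) := by
    have := Finset.Nat.sum_antidiagonal_assoc (fun a b c =>
      (flowCoeff (a + b) * ((a + b + 1).choose (a + 1) : ℂ) * coeff c (coordSeries k ν)) •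
        𝒱.mode (𝒱.L ω a w) (k + c + b)) r
    calc _ = _ := Finset.sum_congr rfl fun x _ => Finset.sum_congr rfl fun y hy => by
            rw [smul_smul, ← mem_antidiagonal.1 hy]
            congr 1
            ring
      _ = _ := this
      _ = _ := Finset.sum_congr rfl fun x _ => by
            rw [Finset.sum_smul]
            refine Finset.sum_congr rfl fun y hy => ?_
            rw [← mem_antidiagonal.1 hy]
            congr 2
            push_cast
            ring
  rw [h1]
  -- The terms with $L(i)w$, $i\ge1$, follow from `coeff_coordSeries_sub`. The $L(0)w=\nu w$ term is
  -- split off, to be joined with the $\mathcal Dw$ terms and evaluated by the differential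
  -- equation.
  have h2 : ∀ x ∈ antidiagonal r, (∑ y ∈ antidiagonal x.2, flowCoeff (x.1 + y.1) *
        ((x.1 + y.1 + 1).choose (x.1 + 1) : ℂ) * coeff y.2 (coordSeries k ν)) •
          𝒱.mode (𝒱.L ω x.1 w) (k + x.2) =
      (flowCoeff x.1 * coeff x.2 (coordSeries k (ν - x.1))) • 𝒱.mode (𝒱.L ω x.1 w) (k + x.2) +
      if x = (0, r) then (∑ y ∈ antidiagonal r, flowCoeff y.1 * coeff y.2 (coordSeries k ν) *
        ((y.1 + 1) * ν)) • 𝒱.mode w (k + r) else 0 := by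
    rintro ⟨i, s⟩ hx
    have hx' := mem_antidiagonal.1 hx
    rcases Nat.eq_zero_or_pos i with rfl | hi
    · obtain rfl : s = r := by simpa using hx'
      have hw' : 𝒱.L ω (0 : ℕ) w = ν • w := mem_weightSpace.1 hw
      simp only [hw', flowCoeff_zero, zero_mul, zero_smul, zero_add, if_true, Nat.choose_one_right]
      have hm : 𝒱.mode (ν • w) (k + s) = ν • 𝒱.mode w (k + s) := by simp [mode]
      rw [hm, smul_smul, Finset.sum_mul]
      congr 1
      refine Finset.sum_congr rfl fun y _ => ?_
      push_cast
      ring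
    · rw [coeff_coordSeries_sub k ν hi, if_neg, add_zero]
      intro h
      exact hi.ne' (congrArg Prod.fst h)
  have h3 : ∑ x ∈ antidiagonal r, (flowCoeff x.1 * coeff x.2 (coordSeries k ν)) •
      (-((k + x.2 : ℤ) + x.1 + 1) : ℂ) • 𝒱.mode w (k + x.2 + x.1) =
      (∑ x ∈ antidiagonal r, flowCoeff x.1 * coeff x.2 (coordSeries k ν) * -(k + r + 1)) •
        𝒱.mode w (k + r) := by
    rw [Finset.sum_smul]
    refine Finset.sum_congr rfl fun x hx => ?_
    rw [smul_smul, show k + x.2 + x.1 = k + r by rw [← mem_antidiagonal.1 hx]; push_cast; ring]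
    congr 2
    rw [← mem_antidiagonal.1 hx]
    push_cast
    ring
  rw [Finset.sum_congr rfl h2, Finset.sum_add_distrib, Finset.sum_ite_eq',
    if_pos (mem_antidiagonal.2 (zero_add r)), h3, add_left_comm, add_comm, ← add_smul,
    ← Finset.sum_add_distrib, ← coeff_coordSeries_ode]
  congr 2
  refine Finset.sum_congr rfl fun y _ => ?_
  ring

/-- The component of degree `-a` of the operator that corresponds to `uₖ` under the coordinate
change, for `u` of weight `μ`. -/
noncomputable def modePart (𝒱 : VertexAlgebra V) (ω : V) (u : V) (μ : ℂ) (k : ℤ) (a : ℕ) :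
    Module.End ℂ V :=
  ∑ x ∈ antidiagonal a, coeff x.2 (coordSeries k (μ - x.1)) •
    𝒱.mode (𝒱.coordPart ω x.1 u) (k + x.2)

/-- The equation $t\,\partial_tM_t=[C_t,M_t]$ in degree $a=p+s$: the part $s$ comes from
`sum_flowCoeff_comm` applied to $w=U_pu$, and the part $p$ from collecting the $L(i)U_{p-i}u$ with
`smul_coordPart`. -/
theorem IsConformalVector.smul_modePart (hω : 𝒱.IsConformalVector ω) {μ : ℂ} {u : V}
    (hu : u ∈ 𝒱.weightSpace ω μ) (k : ℤ) (a : ℕ) :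
    (a : ℂ) • 𝒱.modePart ω u μ k a = ∑ x ∈ antidiagonal a, flowCoeff x.1 •
      (𝒱.L ω x.1 * 𝒱.modePart ω u μ k x.2 - 𝒱.modePart ω u μ k x.2 * 𝒱.L ω x.1) := by
  have h1 : ∑ x ∈ antidiagonal a, flowCoeff x.1 •
      (𝒱.L ω x.1 * 𝒱.modePart ω u μ k x.2 - 𝒱.modePart ω u μ k x.2 * 𝒱.L ω x.1) =
      ∑ x ∈ antidiagonal a, ∑ y ∈ antidiagonal x.2,
        (flowCoeff x.1 * coeff y.2 (coordSeries k (μ - y.1))) •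
          (𝒱.L ω x.1 * 𝒱.mode (𝒱.coordPart ω y.1 u) (k + y.2) -
            𝒱.mode (𝒱.coordPart ω y.1 u) (k + y.2) * 𝒱.L ω x.1) := by
    refine Finset.sum_congr rfl fun x _ => ?_
    rw [modePart, Finset.mul_sum, Finset.sum_mul, ← Finset.sum_sub_distrib, Finset.smul_sum]
    refine Finset.sum_congr rfl fun y _ => ?_
    rw [mul_smul_comm, smul_mul_assoc, ← smul_sub, smul_smul]
  rw [h1, Finset.Nat.sum_antidiagonal_left_comm (fun j p s =>
    (flowCoeff j * coeff s (coordSeries k (μ - p))) •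
          (𝒱.L ω j * 𝒱.mode (𝒱.coordPart ω p u) (k + s) -
            𝒱.mode (𝒱.coordPart ω p u) (k + s) * 𝒱.L ω j))]
  simp only [hω.sum_flowCoeff_comm (hω.coordPart_mem_weightSpace _ hu) k]
  rw [Finset.sum_add_distrib, Finset.Nat.sum_antidiagonal_left_comm (fun p i s =>
    (flowCoeff i * coeff s (coordSeries k (μ - p - i))) •
      𝒱.mode (𝒱.L ω i (𝒱.coordPart ω p u)) (k + s)), ← Finset.Nat.sum_antidiagonal_assoc
      (fun i p s => (flowCoeff i * coeff s (coordSeries k (μ - p - i))) •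
      𝒱.mode (𝒱.L ω i (𝒱.coordPart ω p u)) (k + s)), ← Finset.sum_add_distrib, modePart,
      Finset.smul_sum]
  refine Finset.sum_congr rfl fun x hx => ?_
  have h2 : ∑ y ∈ antidiagonal x.1, (flowCoeff y.1 * coeff x.2 (coordSeries k (μ - y.2 - y.1))) •
      𝒱.mode (𝒱.L ω y.1 (𝒱.coordPart ω y.2 u)) (k + x.2) =
      (x.1 * coeff x.2 (coordSeries k (μ - x.1))) • 𝒱.mode (𝒱.coordPart ω x.1 u) (k + x.2) := by
    have h3 := LinearMap.congr_fun (𝒱.smul_coordPart ω x.1) u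
    rw [mul_comm, mul_smul]
    have h4 : (x.1 : ℂ) • 𝒱.mode (𝒱.coordPart ω x.1 u) (k + x.2) =
        𝒱.mode ((x.1 : ℂ) • 𝒱.coordPart ω x.1 u) (k + x.2) := by simp [mode]
    rw [h4, ← LinearMap.smul_apply, h3]
    simp only [mode, LinearMap.sum_apply, map_sum, Finset.sum_apply, Finset.smul_sum,
      LinearMap.smul_apply, map_smul, Pi.smul_apply, smul_smul, Module.End.mul_apply]
    refine Finset.sum_congr rfl fun y hy => ?_
    rw [mul_comm, ← mem_antidiagonal.1 hy]
    congr 4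
    push_cast
    ring
  rw [h2, ← add_smul, smul_smul, ← mem_antidiagonal.1 hx]
  congr 1
  push_cast
  ring

/-- Both $U_tu_k$ and $M_tU_t$ solve $t\,\partial_tX=C_tX$ with the same constant term:
$[C,M]U+MCU=CMU$. -/
theorem IsConformalVector.coordPart_mul_mode (hω : 𝒱.IsConformalVector ω) {μ : ℂ} {u : V}
    (hu : u ∈ 𝒱.weightSpace ω μ) (k : ℤ) (m : ℕ) :
    𝒱.coordPart ω m * 𝒱.mode u k =
      ∑ x ∈ antidiagonal m, 𝒱.modePart ω u μ k x.1 * 𝒱.coordPart ω x.2 := by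
  induction m using Nat.strong_induction_on with
  | _ m ih =>
    rcases Nat.eq_zero_or_pos m with rfl | hm
    · simp [coordPart_zero, modePart, constantCoeff_coordSeries]
    · have hm' : (m : ℂ) ≠ 0 := by exact_mod_cast hm.ne'
      refine smul_right_injective _ hm' ?_
      change (m : ℂ) • _ = (m : ℂ) • _
      rw [← smul_mul_assoc, smul_coordPart, Finset.sum_mul, Finset.smul_sum]
      have h1 : ∀ x ∈ antidiagonal m, (m : ℂ) • (𝒱.modePart ω u μ k x.1 * 𝒱.coordPart ω x.2) =
          ∑ y ∈ antidiagonal x.1, flowCoeff y.1 • ((𝒱.L ω y.1 * 𝒱.modePart ω u μ k y.2 -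
            𝒱.modePart ω u μ k y.2 * 𝒱.L ω y.1) * 𝒱.coordPart ω x.2) +
          ∑ y ∈ antidiagonal x.2, flowCoeff y.1 • (𝒱.modePart ω u μ k x.1 * 𝒱.L ω y.1 *
            𝒱.coordPart ω y.2) := by
        intro x hx
        rw [← mem_antidiagonal.1 hx, Nat.cast_add, add_smul, ← smul_mul_assoc, ← mul_smul_comm,
          hω.smul_modePart hu, smul_coordPart, Finset.sum_mul, Finset.mul_sum]
        simp only [smul_mul_assoc, mul_smul_comm, mul_assoc]
      rw [Finset.sum_congr rfl h1, Finset.sum_add_distrib,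
        Finset.Nat.sum_antidiagonal_assoc (fun j b q => flowCoeff j •
          ((𝒱.L ω j * 𝒱.modePart ω u μ k b - 𝒱.modePart ω u μ k b * 𝒱.L ω j) *
            𝒱.coordPart ω q)),
        Finset.Nat.sum_antidiagonal_left_comm (fun a j q => flowCoeff j •
          (𝒱.modePart ω u μ k a * 𝒱.L ω j * 𝒱.coordPart ω q)), ← Finset.sum_add_distrib]
      refine Finset.sum_congr rfl fun x hx => ?_
      rw [← Finset.sum_add_distrib]
      have hx' := mem_antidiagonal.1 hx
      rcases Nat.eq_zero_or_pos x.1 with h0 | h0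
      · simp [h0]
      · rw [smul_mul_assoc, mul_assoc, ih x.2 (by omega), Finset.mul_sum, Finset.smul_sum]
        refine Finset.sum_congr rfl fun y _ => ?_
        rw [← smul_add, sub_mul, sub_add_cancel, mul_assoc]

theorem res_single_mul_coe {w x : V} {k : ℤ} {S : ℕ} (hS : ∀ j, k + S ≤ j → 𝒱.mode w j x = 0)
    (G : PowerSeries ℂ) :
    𝒱.res (HahnSeries.single k 1 * (G : LaurentSeries ℂ)) w x =
      ∑ s ∈ Finset.range S, coeff s G • 𝒱.mode w (k + s) x := by
  have hinj : Function.Injective fun s : ℕ => k + (s : ℤ) := fun a b h => by simpa using h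
  rw [𝒱.res_eq_sum ((Finset.range S).map ⟨_, hinj⟩), Finset.sum_map]
  · refine Finset.sum_congr rfl fun s _ => ?_
    rw [Function.Embedding.coeFn_mk, HahnSeries.coeff_single_mul, PowerSeries.coeff_coe,
      if_neg (by omega), one_mul, show (k + (s : ℤ) - k).natAbs = s by omega]
  · intro j h1 h2
    rw [HahnSeries.coeff_single_mul, one_mul, PowerSeries.coeff_coe] at h1
    have h3 : k ≤ j := by
      by_contra h
      exact h1 (if_pos (by omega))
    have h4 : j < k + S := by
      by_contra h
      exact h2 (hS j (by omega))
    refine Finset.mem_map.2 ⟨(j - k).toNat, Finset.mem_range.2 (by omega), ?_⟩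
    rw [Function.Embedding.coeFn_mk]
    omega

theorem IsVertexOperatorAlgebra.coordChange_mode (hω : 𝒱.IsVertexOperatorAlgebra ω) {μ : ℂ} {u : V}
    (hu : u ∈ 𝒱.weightSpace ω μ) {P : ℕ} (hP : ∀ p, P ≤ p → 𝒱.coordPart ω p u = 0) (k : ℤ) (v : V) :
    hω.coordChange (𝒱.mode u k v) = ∑ p ∈ Finset.range P,
      𝒱.res (HahnSeries.single k 1 * (coordSeries k (μ - p) : LaurentSeries ℂ))
        (𝒱.coordPart ω p u) (hω.coordChange v) := by
  obtain ⟨Q, hQ⟩ := hω.exists_coordPart_eq_zero v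
  obtain ⟨M, hM⟩ := hω.exists_coordPart_eq_zero (𝒱.mode u k v)
  have bound : ∀ x : V, ∃ S : ℕ, ∀ p : ℕ, ∀ j : ℤ, k + S ≤ j →
      𝒱.mode (𝒱.coordPart ω p u) j x = 0 := by
    intro x
    choose N hN using fun p => 𝒱.exists_mode_eq_zero (𝒱.coordPart ω p u) x
    refine ⟨∑ p ∈ Finset.range P, (N p - k).natAbs, fun p j hj => ?_⟩
    rcases lt_or_ge p P with h | h
    · have := Finset.single_le_sum (f := fun p => (N p - k).natAbs) (fun _ _ => Nat.zero_le _)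
        (Finset.mem_range.2 h)
      exact hN p j (by omega)
    · rw [hP p h]
      simp [mode]
  have mp : ∀ x : V, ∃ A : ℕ, ∀ a, A ≤ a → 𝒱.modePart ω u μ k a x = 0 := by
    intro x
    obtain ⟨S, hS⟩ := bound x
    refine ⟨P + S, fun a ha => ?_⟩
    rw [modePart, LinearMap.sum_apply]
    refine Finset.sum_eq_zero fun y hy => ?_
    have hy' := mem_antidiagonal.1 hy
    rw [LinearMap.smul_apply]
    rcases lt_or_ge y.1 P with h | h
    · rw [hS _ _ (by omega), smul_zero]
    · rw [hP _ h]
      simp [mode]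
  choose A hA using mp
  obtain ⟨S, hS⟩ := bound (hω.coordChange v)
  -- One bound beyond which all `modePart`s kill every component of $Uv$ and which also covers the
  -- box $P\times S$, so both diagonal sums become sums over boxes.
  set B := P + S + ∑ q ∈ Finset.range Q, A (𝒱.coordPart ω q v) with hB
  have h1 : ∀ a q, B ≤ a → 𝒱.modePart ω u μ k a (𝒱.coordPart ω q v) = 0 := by
    intro a q ha
    rcases lt_or_ge q Q with h | h
    · have := Finset.single_le_sum (f := fun q => A (𝒱.coordPart ω q v)) (fun _ _ => Nat.zero_le _)
        (Finset.mem_range.2 h)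
      exact hA _ a (by omega)
    · rw [hQ q h, map_zero]
  rw [hω.coordChange_eq_sum (M := M + B + Q) (fun m hm => hM m (by omega))]
  have h2 : ∀ m, 𝒱.coordPart ω m (𝒱.mode u k v) = ∑ x ∈ antidiagonal m,
      𝒱.modePart ω u μ k x.1 (𝒱.coordPart ω x.2 v) := by
    intro m
    rw [← Module.End.mul_apply, hω.toIsConformalVector.coordPart_mul_mode hu, LinearMap.sum_apply]
    rfl
  rw [Finset.sum_congr rfl fun m _ => h2 m,
    Finset.Nat.sum_range_sum_antidiagonal
      (f := fun a q => 𝒱.modePart ω u μ k a (𝒱.coordPart ω q v)) (A := B) (B := Q) (by omega) h1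
      (fun a q hq => by rw [hQ q hq, map_zero])]
  simp only [← map_sum, ← hω.coordChange_eq_sum hQ]
  simp only [modePart, LinearMap.sum_apply, LinearMap.smul_apply]
  rw [Finset.Nat.sum_range_sum_antidiagonal (f := fun p s => coeff s (coordSeries k (μ - p)) •
    𝒱.mode (𝒱.coordPart ω p u) (k + s) (hω.coordChange v)) (A := P) (B := S) (by omega)]
  · exact Finset.sum_congr rfl fun p _ => (res_single_mul_coe (hS p) _).symm
  · intro p s hp
    rw [hP p hp]
    simp [mode]
  · intro p s hs
    rw [hS p _ (by omega), smul_zero]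

end VertexAlgebra

/-! ### The substitution $x=\log(1+z)$ in power series. -/

namespace PowerSeries

open LaurentSeries (expSeries expSubOneDiv derivative_expSeries X_mul_expSubOneDiv
  constantCoeff_expSubOneDiv)

theorem hasSubst_X_mul_logDiv : HasSubst (X * logDiv) :=
  HasSubst.of_constantCoeff_zero' (by simp)

/-- The substitution `X ↦ log (1 + X)`. -/
noncomputable def logSubst : PowerSeries ℂ →ₐ[ℂ] PowerSeries ℂ :=
  substAlgHom hasSubst_X_mul_logDiv

theorem logSubst_X : logSubst X = X * logDiv := substAlgHom_X hasSubst_X_mul_logDiv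

theorem derivative_logSubst (f : PowerSeries ℂ) :
    (1 + X) * derivative ℂ (logSubst f) = logSubst (derivative ℂ f) := by
  rw [logSubst, coe_substAlgHom, derivative_subst hasSubst_X_mul_logDiv, mul_left_comm,
    one_add_X_mul_derivative, mul_one]

theorem constantCoeff_logSubst (f : PowerSeries ℂ) :
    constantCoeff (logSubst f) = constantCoeff f := by
  have h := sub_const_eq_X_mul_shift f
  rw [sub_eq_iff_eq_add] at h
  have hC : (C (constantCoeff f) : PowerSeries ℂ) = algebraMap ℂ _ (constantCoeff f) := rfl
  conv_lhs => rw [h, hC]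
  rw [map_add, map_mul, logSubst_X, AlgHom.commutes, ← hC]
  simp

/-- Both sides solve $(1+X)F'=aF$ with constant term $1$. The product of the left side with
$(1+X)^{-a}$ has derivative zero. -/
theorem logSubst_expSeries (a : ℂ) : logSubst (expSeries a) = binomialSeries ℂ a := by
  have h1 := derivative_logSubst (expSeries a)
  rw [derivative_expSeries, map_smul, smul_eq_C_mul] at h1
  have h2 := one_add_X_mul_derivative_binomialSeries (-a)
  rw [smul_eq_C_mul, map_neg] at h2
  have hX : (1 + X : PowerSeries ℂ) ≠ 0 := by
    intro h
    simpa using congrArg constantCoeff h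
  have h3 : logSubst (expSeries a) * binomialSeries ℂ (-a) = 1 := by
    refine derivative.ext (mul_left_cancel₀ hX ?_) ?_
    · rw [Derivation.leibniz, Derivation.map_one_eq_zero, smul_eq_mul, smul_eq_mul]
      linear_combination binomialSeries ℂ (-a) * h1 + logSubst (expSeries a) * h2
    · rw [map_mul, constantCoeff_logSubst, binomialSeries_constantCoeff]
      rw [expSeries, ← coeff_zero_eq_constantCoeff_apply, coeff_rescale]
      simp
  have h4 : binomialSeries ℂ (-a) * binomialSeries ℂ a = (1 : PowerSeries ℂ) := by
    rw [← binomialSeries_add, neg_add_cancel, binomialSeries_zero]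
  rw [← mul_one (logSubst (expSeries a)), ← h4, ← mul_assoc, h3, one_mul]

theorem logSubst_inv_expSubOneDiv : logSubst expSubOneDiv⁻¹ = logDiv := by
  have h1 := congrArg logSubst X_mul_expSubOneDiv
  rw [map_mul, map_sub, map_one, logSubst_X, logSubst_expSeries] at h1
  have h2 : binomialSeries ℂ (1 : ℂ) - 1 = (X : PowerSeries ℂ) := by
    have := binomialSeries_nat (R := ℂ) (A := ℂ) 1
    rw [Nat.cast_one, pow_one] at this
    rw [this, add_sub_cancel_left]
  rw [h2, mul_assoc] at h1
  have h3 : logDiv * logSubst expSubOneDiv = 1 :=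
    mul_left_cancel₀ X_ne_zero (h1.trans (mul_one X).symm)
  have h4 := congrArg logSubst (PowerSeries.mul_inv_cancel expSubOneDiv
    (by rw [constantCoeff_expSubOneDiv]; exact one_ne_zero))
  rw [map_mul, map_one] at h4
  rw [← one_mul (logSubst expSubOneDiv⁻¹), ← h3, mul_assoc, h4, mul_one]

theorem coeff_one_coordSeries (μ : ℂ) : coeff 1 (coordSeries (-2) μ) = μ := by
  have h := coeff_coordSeries_ode (-2) μ 1
  rw [Finset.Nat.sum_antidiagonal_succ] at h
  simp [constantCoeff_coordSeries, flowCoeff] at h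
  rw [← h]
  norm_num
  ring

end PowerSeries

/-! ### Weighted residues, and the image of the logarithmic operations under $U$. -/

namespace VertexAlgebra

open LaurentSeries PowerSeries

variable {V : Type*} [AddCommGroup V] [Module ℂ V] {𝒱 : VertexAlgebra V} {ω : V}

/-- The bilinear map which is `Res_z F(z) (1 + z)^(wt u - 1) Y(u, z) v` for homogeneous `u`. -/
noncomputable def IsConformalVector.bracket (hω : 𝒱.IsConformalVector ω) (F : LaurentSeries ℂ) :
    V →ₗ[ℂ] V →ₗ[ℂ] V :=
  DirectSum.toModule ℂ ℂ (V →ₗ[ℂ] V) (fun μ =>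
    𝒱.res (F * (binomialSeries ℂ (μ - 1) : PowerSeries ℂ)) ∘ₗ (𝒱.weightSpace ω μ).subtype)
    ∘ₗ hω.decomp.symm.toLinearMap

theorem IsConformalVector.decomp_lof (hω : 𝒱.IsConformalVector ω) (μ : ℂ)
    (w : 𝒱.weightSpace ω μ) :
    hω.decomp (DirectSum.lof ℂ ℂ (fun μ => 𝒱.weightSpace ω μ) μ w) = w :=
  DirectSum.coeLinearMap_lof (𝒱.weightSpace ω) μ w

theorem IsConformalVector.decomp_symm_of_mem (hω : 𝒱.IsConformalVector ω) {μ : ℂ} {w : V}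
    (hw : w ∈ 𝒱.weightSpace ω μ) :
    hω.decomp.symm w = DirectSum.lof ℂ ℂ (fun μ => 𝒱.weightSpace ω μ) μ ⟨w, hw⟩ := by
  rw [LinearEquiv.symm_apply_eq]
  exact (hω.decomp_lof μ ⟨w, hw⟩).symm

theorem IsConformalVector.bracket_of_mem (hω : 𝒱.IsConformalVector ω) (F : LaurentSeries ℂ) {μ : ℂ}
    {w : V} (hw : w ∈ 𝒱.weightSpace ω μ) (v : V) :
    hω.bracket F w v = 𝒱.res (F * (binomialSeries ℂ (μ - 1) : PowerSeries ℂ)) w v := by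
  simp [bracket, hω.decomp_symm_of_mem hw]

/-- The bracket as a linear map of the Laurent series. -/
noncomputable def IsConformalVector.bracketMap (hω : 𝒱.IsConformalVector ω) (w v : V) :
    LaurentSeries ℂ →ₗ[ℂ] V where
  toFun F := hω.bracket F w v
  map_add' F G := by
    induction w using hω.weightSpace_induction with
    | mem μ w hw => simp only [hω.bracket_of_mem _ hw, add_mul, res_add]
    | zero => simp
    | add w x hw hx =>
      simp only [map_add, LinearMap.add_apply, hw, hx]
      abel
  map_smul' c F := by
    induction w using hω.weightSpace_induction with
    | mem μ w hw =>
      simp only [hω.bracket_of_mem _ hw, ← HahnSeries.C_mul_eq_smul, mul_assoc]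
      rw [HahnSeries.C_mul_eq_smul, res_smul, RingHom.id_apply]
    | zero => simp
    | add w x hw hx => simp only [map_add, LinearMap.add_apply, hw, hx, smul_add]

theorem IsConformalVector.bracketMap_apply (hω : 𝒱.IsConformalVector ω) (F : LaurentSeries ℂ)
    (w v : V) : hω.bracketMap w v F = hω.bracket F w v := rfl

theorem IsConformalVector.bracketMap_mem (hω : 𝒱.IsConformalVector ω) (w v : V) :
    hω.bracketMap w v ∈ continuousMaps V := by
  induction w using hω.weightSpace_induction with
  | mem μ w hw =>
    convert comp_mul_mem_continuousMaps (𝒱.resMap_mem w v)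
      (binomialSeries ℂ (μ - 1) : PowerSeries ℂ)
    ext F
    rw [bracketMap_apply, hω.bracket_of_mem _ hw, LinearMap.comp_apply, mulMap_apply, resMap_apply,
      mul_comm]
  | zero =>
    convert zero_mem (continuousMaps V)
    ext F
    simp [bracketMap_apply]
  | add w x hw hx =>
    convert add_mem hw hx
    ext F
    simp [bracketMap_apply]

/-- For $w$ of weight $\mu$ the series is $z^{-2}(1+\mu z+\cdots)$, and on the vacuum only the modes
$w_{-2}$ and $w_{-1}$ contribute. -/
theorem IsConformalVector.bracket_vac (hω : 𝒱.IsConformalVector ω) (w : V) :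
    hω.bracket (HahnSeries.single (-2) 1 *
      (((logUnit ^ (-2 : ℤ) : (PowerSeries ℂ)ˣ) : PowerSeries ℂ) : LaurentSeries ℂ)) w 𝒱.vac =
      𝒱.L ω (-1) w + 𝒱.L ω 0 w := by
  induction w using hω.weightSpace_induction with
  | mem μ w hw =>
    rw [hω.bracket_of_mem _ hw, mul_assoc, ← PowerSeries.coe_mul]
    have h := res_single_mul_coe (𝒱 := 𝒱) (w := w) (x := 𝒱.vac) (k := -2) (S := 2)
      (fun j hj => 𝒱.mode_vac_of_nonneg w (by simpa using hj)) (coordSeries (-2) μ)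
    rw [coordSeries] at h
    rw [h, ← coordSeries, Finset.sum_range_succ, Finset.sum_range_one,
      coeff_one_coordSeries, coeff_zero_eq_constantCoeff_apply, constantCoeff_coordSeries,
      mem_weightSpace.1 hw, hω.L_neg_one, one_smul]
    exact congrArg (_ + μ • ·) (𝒱.mode_neg_one_vac w)
  | zero => simp
  | add w x hw hx =>
    simp only [map_add, LinearMap.add_apply, hw, hx]
    abel

section VOA

variable (hω : 𝒱.IsVertexOperatorAlgebra ω)

theorem IsVertexOperatorAlgebra.coordChange_mode_eq_bracket (u v : V) (k : ℤ) :
    hω.coordChange (𝒱.mode u k v) =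
      hω.bracket (HahnSeries.single k 1 *
        (((logUnit ^ k : (PowerSeries ℂ)ˣ) : PowerSeries ℂ) : LaurentSeries ℂ))
        (hω.coordChange u) (hω.coordChange v) := by
  induction u using hω.toIsConformalVector.weightSpace_induction with
  | mem μ u hu =>
    obtain ⟨P, hP⟩ := hω.exists_coordPart_eq_zero u
    rw [hω.coordChange_mode hu hP, hω.coordChange_eq_sum hP, map_sum, LinearMap.sum_apply]
    refine Finset.sum_congr rfl fun p _ => ?_
    rw [hω.bracket_of_mem _ (hω.toIsConformalVector.coordPart_mem_weightSpace p hu), coordSeries,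
      PowerSeries.coe_mul, mul_assoc]
  | zero => simp [mode]
  | add u w hu hw =>
    have : 𝒱.mode (u + w) k v = 𝒱.mode u k v + 𝒱.mode w k v := by simp [mode]
    rw [this, map_add, hu, hw, map_add, map_add, LinearMap.add_apply]

theorem IsVertexOperatorAlgebra.coordChange_res_single_mul (u v : V) (k : ℤ) (p : PowerSeries ℂ) :
    hω.coordChange (𝒱.res (HahnSeries.single k 1 * (p : LaurentSeries ℂ)) u v) =
      hω.bracket (HahnSeries.single k 1 *
        (((logUnit ^ k : (PowerSeries ℂ)ˣ) * logSubst p : PowerSeries ℂ) : LaurentSeries ℂ))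
        (hω.coordChange u) (hω.coordChange v) := by
  obtain ⟨B, hB⟩ := 𝒱.resMap_mem u v
  obtain ⟨C, hC⟩ := hω.toIsConformalVector.bracketMap_mem (hω.coordChange u) (hω.coordChange v)
  have coe_mem : ∀ f : PowerSeries ℂ, (f : LaurentSeries ℂ) ∈ filtration 0 := by
    intro f j hj
    rw [PowerSeries.coeff_coe, if_pos hj]
  have coe_pow : ∀ (f : PowerSeries ℂ) (j : ℕ), ((f ^ j : PowerSeries ℂ) : LaurentSeries ℂ) =
      (f : LaurentSeries ℂ) ^ j := fun f j => map_pow (HahnSeries.ofPowerSeries ℤ ℂ) f j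
  -- Multiples of $z^{k+J}$ are killed on both sides. The series `p` splits into a polynomial of
  -- degree below `J`, treated monomial by monomial, and such a tail.
  set J : ℕ := (B - k).natAbs + (C - k).natAbs with hJ
  have hXpow : ∀ j : ℕ, ((X ^ j : PowerSeries ℂ) : LaurentSeries ℂ) =
      HahnSeries.single (j : ℤ) 1 := by
    intro j
    rw [coe_pow, PowerSeries.coe_X, HahnSeries.single_pow]
    simp
  have high : ∀ (D : ℤ), D ≤ k + J → ∀ f : PowerSeries ℂ,
      HahnSeries.single k 1 * ((X ^ J * f : PowerSeries ℂ) : LaurentSeries ℂ) ∈ filtration D := by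
    intro D hD f
    rw [PowerSeries.coe_mul, hXpow, ← mul_assoc, HahnSeries.single_mul_single, one_mul]
    have h := mul_mem_filtration (single_mem_filtration (k + J) (1 : ℂ)) (coe_mem f)
    exact fun j hj => h j (by omega)
  let ι : PowerSeries ℂ →ₗ[ℂ] LaurentSeries ℂ :=
    mulMap (HahnSeries.single k 1) ∘ₗ
      { toFun := fun f => (f : LaurentSeries ℂ)
        map_add' := fun f g => PowerSeries.coe_add f g
        map_smul' := fun c f => PowerSeries.coe_smul c f }
  let ψ : PowerSeries ℂ →ₗ[ℂ] V := hω.coordChange ∘ₗ 𝒱.resMap u v ∘ₗ ι -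
    hω.bracketMap (hω.coordChange u) (hω.coordChange v) ∘ₗ ι ∘ₗ
      LinearMap.mulLeft ℂ ((logUnit ^ k : (PowerSeries ℂ)ˣ) : PowerSeries ℂ) ∘ₗ
        logSubst.toLinearMap
  have hψ : ∀ f : PowerSeries ℂ, ψ f =
      hω.coordChange (𝒱.resMap u v (HahnSeries.single k 1 * (f : LaurentSeries ℂ))) -
      hω.bracketMap (hω.coordChange u) (hω.coordChange v) (HahnSeries.single k 1 *
        (((logUnit ^ k : (PowerSeries ℂ)ˣ) * logSubst f : PowerSeries ℂ) : LaurentSeries ℂ)) :=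
    fun _ => rfl
  have hpow : ∀ j : ℕ, ψ (X ^ j) = 0 := by
    intro j
    rw [hψ, hXpow, HahnSeries.single_mul_single, one_mul, resMap_apply, res_single, one_smul,
      hω.coordChange_mode_eq_bracket, sub_eq_zero, map_pow logSubst, logSubst_X, mul_pow,
      mul_left_comm,
      PowerSeries.coe_mul, hXpow, ← mul_assoc, HahnSeries.single_mul_single, one_mul, zpow_add,
      Units.val_mul]
    rfl
  have hpoly : ∀ q : Polynomial ℂ, ψ (q : PowerSeries ℂ) = 0 := by
    intro q
    induction q using Polynomial.induction_on' with
    | add p q hp hq => rw [Polynomial.coe_add, map_add, hp, hq, add_zero]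
    | monomial j c =>
      rw [Polynomial.coe_monomial, monomial_eq_C_mul_X_pow, ← smul_eq_C_mul, map_smul, hpow,
        smul_zero]
  have htail : ∀ f : PowerSeries ℂ, ψ (X ^ J * f) = 0 := by
    intro f
    rw [hψ, hB _ (high B (by omega) f), map_mul logSubst, map_pow logSubst, logSubst_X,
      mul_pow, mul_assoc (X ^ J),
      mul_left_comm, hC _ (high C (by omega) _), map_zero, sub_zero]
  have := hψ p
  rw [eq_X_pow_mul_shift_add_trunc J p, map_add, htail, hpoly, add_zero,
    ← eq_X_pow_mul_shift_add_trunc] at this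
  exact sub_eq_zero.1 this.symm

theorem expL_mul_invExpSubOne_pow (a : ℂ) (b : ℕ) :
    expL a * invExpSubOne ^ b = HahnSeries.single (-(b : ℤ)) 1 *
      ((expSeries a * expSubOneDiv⁻¹ ^ b : PowerSeries ℂ) : LaurentSeries ℂ) := by
  have coe_pow : ∀ (f : PowerSeries ℂ) (j : ℕ), ((f ^ j : PowerSeries ℂ) : LaurentSeries ℂ) =
      (f : LaurentSeries ℂ) ^ j := fun f j => map_pow (HahnSeries.ofPowerSeries ℤ ℂ) f j
  rw [invExpSubOne_eq, mul_pow, HahnSeries.single_pow, PowerSeries.coe_mul, coe_pow, mul_left_comm,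
    expL]
  simp

/-- Under $x=\log(1+z)$ one has $e^{ax}(e^x-1)^{-b}=(1+z)^az^{-b}$. Formally, the unit power from
$x^{-b}$ cancels the one from $(x/(e^x-1))^b$. -/
theorem IsVertexOperatorAlgebra.coordChange_res (u v : V) (a : ℂ) (b : ℕ) :
    hω.coordChange (𝒱.res (expL a * invExpSubOne ^ b) u v) =
      hω.bracket (kernel a b) (hω.coordChange u) (hω.coordChange v) := by
  have h : ((logUnit ^ (-(b : ℤ)) : (PowerSeries ℂ)ˣ) : PowerSeries ℂ) * logDiv ^ b = 1 := by
    have : (logDiv : PowerSeries ℂ) ^ b =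
        ((logUnit ^ (b : ℤ) : (PowerSeries ℂ)ˣ) : PowerSeries ℂ) := by
      rw [zpow_natCast, Units.val_pow_eq_pow_val]
      rfl
    rw [this, ← Units.val_mul, ← zpow_add, neg_add_cancel, zpow_zero, Units.val_one]
  rw [expL_mul_invExpSubOne_pow, hω.coordChange_res_single_mul, map_mul logSubst, map_pow logSubst,
    logSubst_expSeries, logSubst_inv_expSubOneDiv, mul_left_comm, h, mul_one, kernel, mul_comm]

theorem IsVertexOperatorAlgebra.coordChange_D (u : V) :
    hω.coordChange (𝒱.D u) = 𝒱.L ω (-1) (hω.coordChange u) + 𝒱.L ω 0 (hω.coordChange u) := by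
  rw [← hω.bracket_vac]
  exact (hω.coordChange_mode_eq_bracket u 𝒱.vac (-2)).trans (by rw [hω.coordChange_vac])

end VOA

end VertexAlgebra

/-! ### Transport of the logarithmic algebra to $A_{g,n}(V,\omega)$. -/

theorem LaurentSeries.kernel_mul_binomialSeries (a c : ℂ) (b : ℕ) :
    VertexAlgebra.kernel a b *
      ((PowerSeries.binomialSeries ℂ c : PowerSeries ℂ) : LaurentSeries ℂ) =
      VertexAlgebra.kernel (a + c) b := by
  rw [VertexAlgebra.kernel, VertexAlgebra.kernel, mul_right_comm, ← PowerSeries.coe_mul,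
    ← PowerSeries.binomialSeries_add]

namespace InducesAlgebra

variable {V : Type*} [AddCommGroup V] [Module ℂ V] {O O' : Submodule ℂ V}
  {star star' : V →ₗ[ℂ] V →ₗ[ℂ] V} {e e' : V}

theorem congr (h : InducesAlgebra O star e) (U : V ≃ₗ[ℂ] V) (hO : O.map (U : V →ₗ[ℂ] V) = O')
    (hs : ∀ u v, U (star u v) = star' (U u) (U v)) (he : U e = e') :
    InducesAlgebra O' star' e' := by
  have hU : ∀ u v, star' u v = U (star (U.symm u) (U.symm v)) := fun u v => by simp [hs]
  have hmem : ∀ x, x ∈ O' ↔ U.symm x ∈ O := by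
    intro x
    rw [← hO, Submodule.mem_map_equiv]
  have he' : U.symm e' = e := by rw [← he, U.symm_apply_apply]
  refine ⟨fun u hu v => ?_, fun u v hv => ?_, fun u v w => ?_, fun u => ?_, fun u => ?_⟩
  · rw [hmem, hU, U.symm_apply_apply]
    exact h.star_mem_left _ ((hmem u).1 hu) _
  · rw [hmem, hU, U.symm_apply_apply]
    exact h.star_mem_right _ _ ((hmem v).1 hv)
  · rw [hmem, map_sub]
    simp only [hU, U.symm_apply_apply]
    exact h.assoc _ _ _
  · rw [hmem, map_sub, hU, U.symm_apply_apply, he']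
    exact h.one_star _
  · rw [hmem, map_sub, hU, U.symm_apply_apply, he']
    exact h.star_one _

end InducesAlgebra

/-- The isomorphism of quotient algebras induced by a linear automorphism. -/
noncomputable def QuotientAlgebra.congr {V : Type*} [AddCommGroup V] [Module ℂ V]
    {O O' : Submodule ℂ V} {star star' : V →ₗ[ℂ] V →ₗ[ℂ] V} {e e' : V}
    (h : InducesAlgebra O star e) (h' : InducesAlgebra O' star' e') (U : V ≃ₗ[ℂ] V)
    (hO : O.map (U : V →ₗ[ℂ] V) = O') (hs : ∀ u v, U (star u v) = star' (U u) (U v))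
    (he : U e = e') : QuotientAlgebra h ≃ₐ[ℂ] QuotientAlgebra h' :=
  AlgEquiv.ofLinearEquiv (Submodule.Quotient.equiv O O' U hO) (congrArg (mk h') he) (by
    intro x y
    obtain ⟨u, rfl⟩ := mk_surjective h x
    obtain ⟨v, rfl⟩ := mk_surjective h y
    exact congrArg (mk h') (hs u v))

namespace VertexAlgebra

open LaurentSeries PowerSeries

variable {V : Type*} [AddCommGroup V] [Module ℂ V] {𝒱 : VertexAlgebra V} {ω : V}

theorem IsConformalVector.circ_eq_bracket (hω : 𝒱.IsConformalVector ω) (T : ℕ) (n : ℚ) (r : ℕ)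
    {μ : ℂ} {u : V} (hu : u ∈ 𝒱.weightSpace ω μ) (v : V) :
    𝒱.circ T n r μ u v =
      hω.bracket (kernel (expShift T n r) (poleOrder T n r + 1)) u v := by
  rw [hω.bracket_of_mem _ hu, kernel_mul_binomialSeries, circ, expShift, poleOrder]
  exact congrArg (fun a => 𝒱.res (kernel a _) u v) (by ring)

theorem IsConformalVector.star_eq_bracket (hω : 𝒱.IsConformalVector ω) (g : V ≃ₗ[ℂ] V) (T : ℕ)
    (n : ℚ) (u v : V) :
    hω.star g T n u v = ∑ m ∈ Finset.range (⌊n⌋₊ + 1),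
      ((-1 : ℂ) ^ m * ((m + ⌊n⌋₊).choose ⌊n⌋₊ : ℂ)) •
        hω.bracket (kernel ((⌊n⌋₊ + 1 : ℕ) : ℂ) (⌊n⌋₊ + 1 + m)) (fixedProj g T u) v := by
  rw [star, LinearMap.comp_apply, LinearMap.comp_apply, LinearEquiv.coe_coe]
  generalize fixedProj g T u = w
  induction w using hω.weightSpace_induction with
  | mem μ w hw =>
    simp only [hω.decomp_symm_of_mem hw, hω.bracket_of_mem _ hw, kernel_mul_binomialSeries,
      DirectSum.toModule_lof, LinearMap.comp_apply, Submodule.subtype_apply, starAux,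
      LinearMap.sum_apply, LinearMap.smul_apply]
    refine Finset.sum_congr rfl fun m _ => ?_
    have h1 : ((⌊n⌋₊ + 1 : ℕ) : ℂ) + (μ - 1) = μ + ⌊n⌋₊ := by
      push_cast
      ring
    rw [h1, add_right_comm]
  | zero => simp
  | add w x hw hx =>
    simp only [map_add, LinearMap.add_apply, hw, hx, smul_add, Finset.sum_add_distrib]

theorem IsAutomorphism.mem_weightSpace {g : V ≃ₗ[ℂ] V} (hg : 𝒱.IsAutomorphism g)
    (hgω : g ω = ω) {μ : ℂ} {u : V} (hu : u ∈ 𝒱.weightSpace ω μ) : g u ∈ 𝒱.weightSpace ω μ := by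
  rw [VertexAlgebra.mem_weightSpace] at hu ⊢
  rw [← map_smul, ← hu, L, hg.map_mode, hgω]

section VOA

variable (hω : 𝒱.IsVertexOperatorAlgebra ω) {g : V ≃ₗ[ℂ] V}

theorem IsVertexOperatorAlgebra.coordChange_mem_sector (hg : 𝒱.IsAutomorphism g) (hgω : g ω = ω)
    {T r : ℕ} {u : V} (hu : u ∈ sector g T r) : hω.coordChange u ∈ sector g T r := by
  rw [mem_sector] at hu ⊢
  rw [hω.map_coordChange hg hgω, hu, map_smul]

theorem IsVertexOperatorAlgebra.coordChange_fixedProj (hg : 𝒱.IsAutomorphism g) (hgω : g ω = ω)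
    (T : ℕ) (u : V) : hω.coordChange (fixedProj g T u) = fixedProj g T (hω.coordChange u) := by
  have : ∀ i : ℕ, hω.coordChange (((g : V →ₗ[ℂ] V) ^ i) u) =
      ((g : V →ₗ[ℂ] V) ^ i) (hω.coordChange u) := by
    intro i
    induction i with
    | zero => simp
    | succ i ih =>
      rw [pow_succ', Module.End.mul_apply, LinearEquiv.coe_coe, ← hω.map_coordChange hg hgω, ih,
        Module.End.mul_apply, LinearEquiv.coe_coe]
  simp [fixedProj, this]

theorem IsVertexOperatorAlgebra.coordChange_logStar (hg : 𝒱.IsAutomorphism g) (hgω : g ω = ω)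
    (T : ℕ) (n : ℚ) (u v : V) : hω.coordChange (𝒱.logStar g T n u v) =
      hω.star g T n (hω.coordChange u) (hω.coordChange v) := by
  rw [hω.star_eq_bracket, ← hω.coordChange_fixedProj hg hgω, logStar, LinearMap.comp_apply,
    unitPoly, map_sum, ← resMap_apply, map_sum, map_sum]
  refine Finset.sum_congr rfl fun m _ => ?_
  rw [map_mul, polyY_C, HahnSeries.C_mul_eq_smul, ← expL_mul_polyY_pow, map_smul, map_smul,
    resMap_apply, hω.coordChange_res]

theorem IsVertexOperatorAlgebra.bracket_mem_O (hg : 𝒱.IsAutomorphism g) (hgω : g ω = ω) {T : ℕ}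
    (n : ℚ) {r : ℕ} (hr : r < T) {u : V} (hu : u ∈ sector g T r) (v : V) :
    hω.bracket (kernel (expShift T n r) (poleOrder T n r + 1)) u v ∈ 𝒱.O ω g T n := by
  suffices h : sector g T r ≤ (𝒱.O ω g T n).comap
      ((hω.bracket (kernel (expShift T n r) (poleOrder T n r + 1))).flip v) from h hu
  intro u hu
  obtain ⟨x, rfl⟩ := hω.decomp.surjective u
  rw [Submodule.mem_comap, LinearMap.flip_apply]
  -- The generators of `O` need homogeneous vectors. As $g$ fixes $\omega$ it preserves weight
  -- spaces, so homogeneous components of a vector of $V^r$ stay in $V^r$.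
  have hx : ∀ μ, (x μ : V) ∈ sector g T r := by
    let γ : (DirectSum ℂ fun μ => 𝒱.weightSpace ω μ) →ₗ[ℂ] DirectSum ℂ fun μ => 𝒱.weightSpace ω μ :=
      DirectSum.lmap fun μ => (g : V →ₗ[ℂ] V).restrict (p := 𝒱.weightSpace ω μ)
        (q := 𝒱.weightSpace ω μ) fun y hy => hg.mem_weightSpace hgω hy
    have hγ : hω.decomp.toLinearMap ∘ₗ γ = (g : V →ₗ[ℂ] V) ∘ₗ hω.decomp.toLinearMap := by
      ext μ y
      simp [γ, hω.decomp_lof]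
    have h1 : γ x = Complex.exp (-2 * Real.pi * Complex.I * r / T) • x := by
      apply hω.decomp.injective
      rw [map_smul, ← mem_sector.1 hu]
      exact LinearMap.congr_fun hγ x
    intro μ
    have h2 := congrArg (fun y => ((y μ : 𝒱.weightSpace ω μ) : V)) h1
    rw [mem_sector]
    exact h2
  classical
  have h3 : hω.decomp x = ∑ μ ∈ DFinsupp.support x, (x μ : V) :=
    DirectSum.coeLinearMap_eq_dfinsuppSum _ x
  rw [h3, map_sum, LinearMap.sum_apply]
  refine Submodule.sum_mem _ fun μ _ => ?_
  rw [← hω.circ_eq_bracket T n r (x μ).2]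
  exact Submodule.subset_span (Or.inl ⟨r, hr, μ, _, ⟨hx μ, (x μ).2⟩, v, rfl⟩)

theorem IsVertexOperatorAlgebra.map_logO (hg : 𝒱.IsAutomorphism g) (hgω : g ω = ω) (T : ℕ)
    (n : ℚ) : (𝒱.logO g T n).map (hω.coordEquiv : V →ₗ[ℂ] V) = 𝒱.O ω g T n := by
  have happ : ∀ x, hω.coordEquiv x = hω.coordChange x := fun _ => rfl
  have hsymm : ∀ x, hω.coordChange (hω.coordEquiv.symm x) = x := hω.coordEquiv.apply_symm_apply
  refine le_antisymm (Submodule.map_le_iff_le_comap.2 (sup_le (Submodule.span_le.2 ?_) ?_))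
    (Submodule.span_le.2 ?_)
  · rintro _ ⟨r, hr, u, hu, v, rfl⟩
    change hω.coordChange _ ∈ 𝒱.O ω g T n
    rw [twistFun, hω.coordChange_res]
    exact hω.bracket_mem_O hg hgω n hr (hω.coordChange_mem_sector hg hgω hu) _
  · rintro _ ⟨u, rfl⟩
    change hω.coordChange _ ∈ 𝒱.O ω g T n
    rw [hω.coordChange_D]
    exact Submodule.subset_span (Or.inr ⟨_, rfl⟩)
  · rintro _ (⟨r, hr, μ, u, hu, v, rfl⟩ | ⟨u, rfl⟩)
    · refine ⟨𝒱.res (twistFun T n r) (hω.coordEquiv.symm u) (hω.coordEquiv.symm v),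
        Submodule.mem_sup_left (Submodule.subset_span ⟨r, hr, _, ?_, _, rfl⟩), ?_⟩
      · refine mem_sector.2 (hω.coordEquiv.injective ?_)
        rw [happ, happ, ← hω.map_coordChange hg hgω, map_smul, hsymm]
        exact mem_sector.1 hu.1
      · change hω.coordChange _ = _
        rw [twistFun, hω.coordChange_res, hω.circ_eq_bracket T n r hu.2, hsymm, hsymm]
    · refine ⟨𝒱.D (hω.coordEquiv.symm u), Submodule.mem_sup_right ⟨_, rfl⟩, ?_⟩
      change hω.coordChange _ = _
      rw [hω.coordChange_D, hsymm]

end VOA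

end VertexAlgebra

/-- For two vertex operator algebra structures `ω`, `ω'` on one vertex algebra and an automorphism
`g` of both, of order `T`, the products `*_{g,n}` make `V ⧸ O_{g,n}(V, ω)` and `V ⧸ O_{g,n}(V, ω')`
into associative algebras `A_{g,n}(V, ω)` and `A_{g,n}(V, ω')`, and these are isomorphic. -/
theorem lemma4p3 {V : Type*} [AddCommGroup V] [Module ℂ V] (𝒱 : VertexAlgebra V) (ω ω' : V)
    (hω : 𝒱.IsVertexOperatorAlgebra ω) (hω' : 𝒱.IsVertexOperatorAlgebra ω')
    (g : V ≃ₗ[ℂ] V) (hg : 𝒱.IsAutomorphism g) (hgω : g ω = ω) (hgω' : g ω' = ω')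
    (T : ℕ) (hT : 0 < T) (hgT : orderOf g = T)
    (n : ℚ) (hn : ∃ p : ℕ, n = (p : ℚ) / T) :
    ∃ (A : InducesAlgebra (𝒱.O ω g T n) (hω.star g T n) 𝒱.vac)
      (A' : InducesAlgebra (𝒱.O ω' g T n) (hω'.star g T n) 𝒱.vac),
      Nonempty (QuotientAlgebra A ≃ₐ[ℂ] QuotientAlgebra A') := by
  -- The algebra `L` involves neither conformal vector; each of the two algebras is its image under
  -- the corresponding coordinate change.
  have L := hg.inducesAlgebra_log n hT (hgT ▸ pow_orderOf_eq_one g)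
  have hO := hω.map_logO hg hgω T n
  have hO' := hω'.map_logO hg hgω' T n
  have hs := hω.coordChange_logStar hg hgω T n
  have hs' := hω'.coordChange_logStar hg hgω' T n
  have A := L.congr hω.coordEquiv hO hs hω.coordChange_vac
  have A' := L.congr hω'.coordEquiv hO' hs' hω'.coordChange_vac
  exact ⟨A, A', ⟨(QuotientAlgebra.congr L A hω.coordEquiv hO hs hω.coordChange_vac).symm.trans
    (QuotientAlgebra.congr L A' hω'.coordEquiv hO' hs' hω'.coordChange_vac)⟩⟩
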